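/- Let $0<r\le 1$ and let $X$ be an $r$-normable quasi-Banach space, i.e. a complete quasi-normed space with $\|x+y\|^r\le\|x\|^r+\|y\|^r$ for all $x,y\in X$. Let $(\Omega,\mathcal A,\mathbb P)$ be a complete probability space with a filtration $(\mathcal F_n)_{n\ge1}$, and put $\mathcal F_0=\{\Omega,\varnothing\}$, $\mathcal F_\infty=\sigma(\mathcal F_n:n\ge1)$. $X$-valued random variables are Borel measurable with separable range. For a sequence $f=(f_n)_{n\ge1}$ of $X$-valued random variables put $f_0=0$, let $d_n=f_n-f_{n-1}$ be its difference sequence, $f^*=\sup_n\|f_n\|$, and $\|f\|=\lim_n\|f_n\|$ when the limit exists. A sequence $(e_n)_{n\ge1}$ of $X$-valued random variables on $(\Omega,\mathcal A,\mathbb P)$ is a *decoupled tangent sequence* of an adapted sequence $(d_n)_{n\ge1}$ if $\mathbb P(d_n\in B\mid\mathcal F_{n-1})=\mathbb P(e_n\in B\mid\mathcal F_\infty)$ a.s. for all $n\ge1$ and all Borel sets $B\subseteq X$, and $(e_n)_{n\ge1}$ is $\mathcal F_\infty$-conditionally independent. A *decoupled sum sequence* of $f$ is a sequence $g$ whose difference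 sequence is a decoupled tangent sequence of the difference sequence of $f$. Let $\mathcal D_\infty$ be the set of all adapted, uniformly bounded $X$-valued sequences $f=(f_n)_{n\ge1}$ such that $d_n$ is $\mathcal F_{n-1}$-conditionally symmetric (that is, $\mathbb P(d_n\in B\mid\mathcal F_{n-1})=\mathbb P(-d_n\in B\mid\mathcal F_{n-1})$ a.s. for all Borel $B$) for all $n\ge1$, such that $d_n=0$ for all sufficiently large $n$, and such that $f$ has a decoupled sum sequence on $(\Omega,\mathcal A,\mathbb P)$. For $p\in(0,\infty)$ and $f\in\mathcal D_\infty$ put $T_p(f)=\big(\mathbb E\big[\|\sum_{k\ge1}e_k\|^p\,\big|\,\mathcal F_\infty\big]\big)^{1/p}$, where $(e_k)$ is a decoupled tangent sequence of $(d_k)$ (the result does not depend, up to null sets, on the choice of $(e_k)$). For integers $0\le k\le l$ let ${}^kf^l$ be the sequence with difference sequence $(\mathbf 1_{\{k<n\le l\}}d_n)_{n\ge1}$. Let $p,q\in(0,\infty)$ and $\varrho=\min\{r,p\}$. Let $\Phi:\mathbb R_+\to\mathbb R_+$ be non-decreasing and continuous with $\Phi(0)=0$ and $\Phi(st)\le s^q\Phi(t)$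 for all $s\ge1$, $t\ge0$. Suppose that for some $A>0$ and some $b\in\big(0,2^{-2p/\varrho+p-1}\big)$ $$\sup_{f\in\mathcal D_\infty}\ \sup_{0\le k\le l}\ \sup_{B\in\mathcal F_k,\ \mathbb P(B)>0}\mathbb P\big(\|{}^kf^l\|>A\,\|T_p({}^kf^l)\|_\infty\,\big|\,B\big)<b .$$ Then for all $f\in\mathcal D_\infty$ and every decoupled sum sequence $g$ of $f$ $$\mathbb E\,\Phi(f^*)\le C\;\mathbb E\,\Phi(\|g\|),$$ where $$C=2^{\frac{2q}{\varrho}-q+2}\Big[2^{\frac{2p}{\varrho}-p+\frac{2q}{\varrho}-q+1}\big(2^{2q}+2^{\frac q\varrho}\big)R^{\frac q\varrho}+(1-2^{-\varrho})^{-\frac q\varrho}\Big],\qquad R=\big[2A^\varrho+1\big]^{\frac1\varrho}\Big[1-\big[2^{\frac{2p}\varrho-p+1}b\big]^{\frac\varrho q}\Big]^{-\frac1\varrho}.$$ In particular, for $r=1$ and $p\ge1$ one can take $$C=2^{2q+2}\Big[2^{p+q+1}(2^q+1)\,[2A+1]^q\Big[1-[2^{p+1}b]^{\frac1q}\Big]^{-q}+1\Big].$$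 -/

import Mathlib

open MeasureTheory Filter
open scoped NNReal ENNReal ProbabilityTheory

noncomputable section

namespace Decoupling

/-- `X`, with quasi-norm `N`, is an `r`-normable (constant `1`) quasi-Banach space, metrized by
`dist x y = N (x - y) ^ r`. -/
structure IsQuasiBanach {X : Type*} [AddCommGroup X] [Module ℝ X] [MetricSpace X]
    (r : ℝ) (N : X → ℝ≥0) : Prop where
  eq_zero_of_apply_eq_zero : ∀ x, N x = 0 → x = 0
  smul : ∀ (c : ℝ) (x : X), N (c • x) = ‖c‖₊ * N x
  add_rpow_le : ∀ x y, N (x + y) ^ r ≤ N x ^ r + N y ^ r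
  dist_eq : ∀ x y, dist x y = (N (x - y) : ℝ) ^ r
  complete : CompleteSpace X

section Sequences

variable {Ω X : Type*}

/-- Difference sequence, meaningful at the indices `n ≥ 1`. Sequences indexed by `n ≥ 1` are
modelled as sequences on `ℕ` with value `0` at the index `0`. -/
def diff [AddCommGroup X] (f : ℕ → Ω → X) (n : ℕ) : Ω → X :=
  f n - f (n - 1)

/-- The sequence `f ^ k` stopped at time `k`: its `n`-th difference is `1_{n ≤ k} d_n`. -/
def stopped [AddCommGroup X] (k : ℕ) (f : ℕ → Ω → X) (n : ℕ) : Ω → X :=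
  ∑ j ∈ Finset.Icc 1 n, if j ≤ k then diff f j else 0

/-- The sequence started at `k` and stopped at `l`. -/
def startedStopped [AddCommGroup X] (k l : ℕ) (f : ℕ → Ω → X) (n : ℕ) : Ω → X :=
  stopped l f n - stopped k f n

/-- The maximal function `f^* = sup_n ‖f_n‖` (used for almost surely bounded sequences). -/
def maximal (N : X → ℝ≥0) (f : ℕ → Ω → X) (ω : Ω) : ℝ≥0 :=
  ⨆ n, N (f n ω)

/-- `‖f‖ = lim_n ‖f_n‖` (used for sequences that are almost surely eventually constant). -/
def limNorm (N : X → ℝ≥0) (f : ℕ → Ω → X) (ω : Ω) : ℝ≥0 :=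
  limUnder atTop (fun n => N (f n ω))

end Sequences

section Probability

variable {Ω X : Type*} {mΩ : MeasurableSpace Ω} [AddCommGroup X] [MetricSpace X]
  [MeasurableSpace X]

/-- `ξ` is `m`-conditionally symmetric. -/
def CondSymmetric (μ : Measure Ω) (m : MeasurableSpace Ω) (ξ : Ω → X) : Prop :=
  ∀ B : Set X, MeasurableSet B → μ⟦ξ ⁻¹' B|m⟧ =ᵐ[μ] μ⟦(-ξ) ⁻¹' B|m⟧

/-- `(e_n)_{n ≥ 1}` is an `ℱ_∞`-decoupled tangent sequence of `(d_n)_{n ≥ 1}`. -/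
structure IsDecoupledTangent (μ : Measure Ω) (ℱ : Filtration ℕ mΩ) (d e : ℕ → Ω → X) : Prop where
  stronglyMeasurable : ∀ n, 1 ≤ n → StronglyMeasurable (e n)
  tangent : ∀ n, 1 ≤ n → ∀ B : Set X, MeasurableSet B →
    μ⟦d n ⁻¹' B|ℱ (n - 1)⟧ =ᵐ[μ] μ⟦e n ⁻¹' B|⨆ i, ℱ i⟧
  condIndep : ∀ n, 1 ≤ n → ∀ B : ℕ → Set X, (∀ j, MeasurableSet (B j)) →
    μ⟦⋂ j ∈ Finset.Icc 1 n, e j ⁻¹' B j|⨆ i, ℱ i⟧ =ᵐ[μ]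
      ∏ j ∈ Finset.Icc 1 n, μ⟦e j ⁻¹' B j|⨆ i, ℱ i⟧

/-- `g` is an `ℱ_∞`-decoupled sum sequence of `f`. -/
def IsDecoupledSum (μ : Measure Ω) (ℱ : Filtration ℕ mΩ) (f g : ℕ → Ω → X) : Prop :=
  g 0 = 0 ∧ IsDecoupledTangent μ ℱ (diff f) (diff g)

/-- The class `M_∞`: adapted, uniformly bounded, conditionally symmetric differences,
eventually constant. -/
structure MInf (μ : Measure Ω) (ℱ : Filtration ℕ mΩ) (N : X → ℝ≥0) (f : ℕ → Ω → X) : Prop where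
  zero : f 0 = 0
  adapted : ∀ n, StronglyMeasurable[ℱ n] (f n)
  bounded : ∃ M : ℝ≥0, ∀ n, ∀ᵐ ω ∂μ, N (f n ω) ≤ M
  condSymmetric : ∀ n, 1 ≤ n → CondSymmetric μ (ℱ (n - 1)) (diff f n)
  eventually_const : ∃ n₀, ∀ n, n₀ ≤ n → diff f n =ᵐ[μ] 0

/-- The class `D_∞`: members of `M_∞` with a decoupled sum sequence on the same space. -/
def DInf (μ : Measure Ω) (ℱ : Filtration ℕ mΩ) (N : X → ℝ≥0) : Set (ℕ → Ω → X) :=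
  {f | MInf μ ℱ N f ∧ ∃ g, IsDecoupledSum μ ℱ f g}

open scoped Classical in
/-- `T_p f = (E[‖∑_{k ≥ 1} e_k‖ ^ p | ℱ_∞]) ^ (1/p)` where `e` is a decoupled tangent sequence of
the difference sequence of `f`. Up to null sets it does not depend on the choice of `e`; the value
`0` is a default for sequences without decoupled tangent sequence. -/
def T (μ : Measure Ω) (ℱ : Filtration ℕ mΩ) (N : X → ℝ≥0) (p : ℝ) (f : ℕ → Ω → X) : Ω → ℝ :=
  if h : ∃ e, IsDecoupledTangent μ ℱ (diff f) e then
    fun ω => (μ[fun ω' => (N (∑' k : ℕ, h.choose (k + 1) ω') : ℝ) ^ p | ⨆ i, ℱ i]) ω ^ (1 / p)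
  else 0

/-- `sup_{f ∈ D_∞} sup_{0 ≤ k ≤ l} sup_{B ∈ ℱ_k} P(‖f'‖ > A ‖T_p f'‖_∞ | B)` for `f'` the sequence
`f` started at `k` and stopped at `l`, over those `B` for which the conditional probability is
defined. -/
def bmoSup (μ : Measure Ω) (ℱ : Filtration ℕ mΩ) (N : X → ℝ≥0) (p A : ℝ) : ℝ≥0∞ :=
  ⨆ f ∈ DInf μ ℱ N, ⨆ (k : ℕ) (l : ℕ) (_ : k ≤ l) (B : Set Ω) (_ : MeasurableSet[ℱ k] B)
    (_ : μ B ≠ 0),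
    ProbabilityTheory.cond μ B
      {ω | ENNReal.ofReal A * eLpNorm (T μ ℱ N p (startedStopped k l f)) ∞ μ
        < (limNorm N (startedStopped k l f) ω : ℝ≥0∞)}

end Probability

/-- The ratio `β / δ`, with `ρ = min r p`. -/
def ratio (ρ p q A b : ℝ) : ℝ :=
  (2 * A ^ ρ + 1) ^ (1 / ρ) *
    (1 - ((2 : ℝ) ^ (2 * p / ρ - p + 1) * b) ^ (ρ / q)) ^ (-(1 / ρ))

/-- The constant `C_{X,r,p,q}`, with `ρ = min r p`. -/
def const (ρ p q A b : ℝ) : ℝ :=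
  (2 : ℝ) ^ (2 * q / ρ - q + 2) *
    ((2 : ℝ) ^ (2 * p / ρ - p + 2 * q / ρ - q + 1) * ((2 : ℝ) ^ (2 * q) + (2 : ℝ) ^ (q / ρ)) *
        ratio ρ p q A b ^ (q / ρ) +
      (1 - (2 : ℝ) ^ (-ρ)) ^ (-(q / ρ)))

/-- The constant `C_{X,1,p,q}`, for `p ≥ 1`. -/
def constOne (p q A b : ℝ) : ℝ :=
  (2 : ℝ) ^ (2 * q + 2) *
    ((2 : ℝ) ^ (p + q + 1) * ((2 : ℝ) ^ q + 1) * (2 * A + 1) ^ q *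
        (1 - ((2 : ℝ) ^ (p + 1) * b) ^ (1 / q)) ^ (-q) + 1)

end Decoupling

end

set_option linter.unusedSectionVars false

/-! ### Elementary inequalities for `ρ`-subadditive quasi-norms -/

namespace Decoupling

/-! The quasi-norm is `ρ`-subadditive for `ρ = min r p`, and the theorem follows from a good-`λ`
inequality. Let `d` be the differences of `f` and `e` a decoupled tangent sequence, both shifted to
start at index `0`. A `TangentKernel` supplies symmetric random laws `κ j`, measurable for `ℱ j`,
such that `κ j` is the law of `d j` given `ℱ j`, while given `ℱ_∞` the `e j` are independent with
laws `κ j`. For fixed `ω`, a question about `e` thus becomes one about independent symmetric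
summands. There sign changes yield Lévy's inequality (`QuasiNorm.measure_le_of_partition`) and
Hoffmann-Jørgensen's inequality (`QuasiNorm.lintegral_rpow_sum_le`): if the summands are at most `s`
and a partial sum exceeds `s` only with small probability, then the `p`-th moment of the sum is at
most a constant times `s ^ p`.

Davis' decomposition calls a jump large if it exceeds twice the maximum of the preceding ones. Large
jumps grow geometrically, so their sum is controlled by the largest jump of `d`; its tail is
controlled by that of the largest `e j` (`TangentKernel.measure_exists_left_le`), hence by that of
the decoupled sum. The other jumps have the predictable bound `D j`.

For the part with small jumps, `TangentKernel.goodLambda` starts the sequence when it first exceeds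
`lam` and keeps an increment only as long as the preceding partial sums are at most `Λ`, the
predictable jump bound is at most `s`, and the laws known so far give small probability to large
partial sums. This selection is predictable, so the kept sequence again has a tangent kernel and
lies in `D_∞`. By Hoffmann-Jørgensen its `T_p` is at most a constant times `s`, and the hypothesis,
conditioned on the starting event, contributes the factor `b`. The exceptional events are handled by
Chebyshev's inequality and by the tail of the largest jump.

With `Λ = t`, `lam = t / β` and `s` proportional to `t / R`, integration of the tails against `Φ`
produces a term `b β ^ q E Φ(U)`, at most `E Φ(U) / 2`, where `U` is the maximal function of the
small-jump part. It can be absorbed because `U` is bounded.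

Kernels and measurable addition require separability. Everything is therefore carried out in a
closed separable subgroup `S` that contains the values of `f`, and almost surely those of the
tangent sequence (`IsDecoupledTangent.exists_restrict`). Only the group structure matters, whence
the weak axioms of `QuasiNorm`. -/

/-- The properties of a `ρ`-subadditive quasi-norm that enter the probabilistic arguments. -/
structure QuasiNorm {X : Type*} [AddCommGroup X] [MeasurableSpace X] (ρ : ℝ) (N : X → ℝ≥0) :
    Prop where
  pos : 0 < ρ
  le_one : ρ ≤ 1
  zero : N 0 = 0
  neg : ∀ x, N (-x) = N x
  double : ∀ x, N (x + x) = 2 * N x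
  add_rpow_le : ∀ x y, N (x + y) ^ ρ ≤ N x ^ ρ + N y ^ ρ
  measurable : Measurable N

namespace QuasiNorm

variable {X : Type*} [AddCommGroup X] [MeasurableSpace X] {ρ : ℝ} {N : X → ℝ≥0}

lemma sub_rpow_le (hN : QuasiNorm ρ N) (x y : X) : N (x - y) ^ ρ ≤ N x ^ ρ + N y ^ ρ := by
  simpa [sub_eq_add_neg, hN.neg] using hN.add_rpow_le x (-y)

lemma sum_rpow_le (hN : QuasiNorm ρ N) {ι : Type*} (s : Finset ι) (x : ι → X) :
    N (∑ i ∈ s, x i) ^ ρ ≤ ∑ i ∈ s, N (x i) ^ ρ := by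
  classical
  induction s using Finset.induction_on with
  | empty => simp [hN.zero, hN.pos.ne']
  | insert a s ha ih =>
    rw [Finset.sum_insert ha, Finset.sum_insert ha]
    exact (hN.add_rpow_le _ _).trans (by gcongr)

/-- If `2 u = v + w` then `v` or `w` is not much smaller than `u`. -/
lemma lt_or_lt_of_add_self_eq (hN : QuasiNorm ρ N) {u v w : X} (h : u + u = v + w) {t : ℝ≥0}
    (ht : t < N u) :
    (2 : ℝ≥0) ^ (1 - 1 / ρ) * t < N v ∨ (2 : ℝ≥0) ^ (1 - 1 / ρ) * t < N w := by
  have hρ := hN.pos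
  by_contra! hc
  have h1 : (2 * N u) ^ ρ ≤ (2 * t) ^ ρ := by
    calc (2 * N u) ^ ρ = N (v + w) ^ ρ := by rw [← h, hN.double]
      _ ≤ N v ^ ρ + N w ^ ρ := hN.add_rpow_le _ _
      _ ≤ ((2 : ℝ≥0) ^ (1 - 1 / ρ) * t) ^ ρ + ((2 : ℝ≥0) ^ (1 - 1 / ρ) * t) ^ ρ := by
          gcongr
          exacts [hc.1, hc.2]
      _ = (2 * t) ^ ρ := by
          rw [← two_mul, NNReal.mul_rpow, NNReal.mul_rpow, ← NNReal.rpow_mul, ← mul_assoc]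
          congr 1
          rw [sub_mul, one_div, inv_mul_cancel₀ hρ.ne', one_mul, NNReal.rpow_sub two_ne_zero,
            NNReal.rpow_one, mul_div_cancel₀ _ two_ne_zero]
  have h2 := (NNReal.rpow_le_rpow_iff hρ).1 h1
  exact absurd (le_of_mul_le_mul_left h2 two_pos) (not_le.2 ht)

lemma add_rpow_le_mul (hN : QuasiNorm ρ N) {p : ℝ} (hp : ρ ≤ p) (a b c : ℝ≥0)
    (h : c ^ ρ ≤ a ^ ρ + b ^ ρ) : c ^ p ≤ (2 : ℝ≥0) ^ (p / ρ - 1) * (a ^ p + b ^ p) := by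
  have hρ := hN.pos
  have h1 : ∀ a : ℝ≥0, a ^ p = (a ^ ρ) ^ (p / ρ) := fun a => by
    rw [← NNReal.rpow_mul, mul_div_cancel₀ _ hρ.ne']
  rw [h1 a, h1 b, h1 c]
  exact (NNReal.rpow_le_rpow h (div_nonneg (hρ.le.trans hp) hρ.le)).trans
    (NNReal.rpow_add_le_mul_rpow_add_rpow _ _ (by rwa [le_div_iff₀ hρ, one_mul]))

lemma rpow_le_of_add_self_eq (hN : QuasiNorm ρ N) {p : ℝ} (hp : ρ ≤ p) {u v w : X}
    (h : u + u = v + w) :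
    N u ^ p ≤ (2 : ℝ≥0) ^ (p / ρ - p - 1) * (N v ^ p + N w ^ p) := by
  have h1 := hN.add_rpow_le_mul hp (N v) (N w) (2 * N u)
    (by rw [← hN.double, h]; exact hN.add_rpow_le _ _)
  rw [NNReal.mul_rpow] at h1
  have h2 : (2 : ℝ≥0) ^ (p / ρ - 1) = 2 ^ p * 2 ^ (p / ρ - p - 1) := by
    rw [← NNReal.rpow_add two_ne_zero]; ring_nf
  rw [h2, mul_assoc] at h1
  exact le_of_mul_le_mul_left h1 (NNReal.rpow_pos two_pos)

end QuasiNorm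

/-! ### Sign changes and Lévy inequalities for symmetric product measures -/

section Product

variable {X : Type*} [AddCommGroup X] [MeasurableSpace X]

open scoped Classical in
/-- Change the signs of the coordinates outside `J`. -/
def signFlip (J : Finset ℕ) (x : ℕ → X) (i : ℕ) : X := if i ∈ J then x i else -x i

/-- Replace `x` by `0` if it is larger than `D`. -/
noncomputable def trunc (N : X → ℝ≥0) (D : ℝ≥0) (x : X) : X := if N x ≤ D then x else 0

/-- The terms outside `J` cancel between the sequence and its reflection. This exhibits a partial
sum as the mean of two full sums with the same law. -/
lemma sum_add_sum_signFlip {J : Finset ℕ} {L : ℕ} (hJ : J ⊆ Finset.range L) (x : ℕ → X) :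
    ∑ i ∈ J, x i + ∑ i ∈ J, x i = ∑ i ∈ Finset.range L, x i
      + ∑ i ∈ Finset.range L, signFlip J x i := by
  classical
  rw [← Finset.sum_add_distrib, ← Finset.sum_add_distrib]
  refine Finset.sum_subset_zero_on_sdiff hJ ?_ ?_
  · intro i hi
    simp [signFlip, (Finset.mem_sdiff.1 hi).2]
  · intro i hi
    simp [signFlip, hi]

variable [MeasurableAdd₂ X] [MeasurableNeg X] {ρ : ℝ} {N : X → ℝ≥0}
  {ν : ℕ → Measure X} [∀ j, IsProbabilityMeasure (ν j)]

lemma measurePreserving_signFlip (hν : ∀ j, (ν j).map Neg.neg = ν j) (J : Finset ℕ) :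
    MeasurePreserving (signFlip J) (Measure.infinitePi ν) (Measure.infinitePi ν) := by
  classical
  have hf : ∀ i, Measurable (fun y : X => if i ∈ J then y else -y) := fun i => by
    split_ifs <;> fun_prop
  refine ⟨measurable_pi_iff.2 fun i => (hf i).comp (measurable_pi_apply i), ?_⟩
  have h := Measure.infinitePi_map_pi (μ := ν) (f := fun i y => if i ∈ J then y else -y) hf
  refine h.trans ?_
  congr 1
  funext i
  by_cases hi : i ∈ J
  · simp [hi]
  · simpa [hi] using hν i

lemma measurable_sum_coord (J : Finset ℕ) : Measurable (fun x : ℕ → X => ∑ i ∈ J, x i) := by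
  fun_prop

lemma QuasiNorm.measurable_sum (hN : QuasiNorm ρ N) (J : Finset ℕ) :
    Measurable (fun x : ℕ → X => N (∑ i ∈ J, x i)) :=
  hN.measurable.comp (measurable_sum_coord J)

lemma QuasiNorm.measurable_trunc (hN : QuasiNorm ρ N) (D : ℝ≥0) : Measurable (trunc N D) :=
  Measurable.ite (hN.measurable measurableSet_Iic) measurable_id measurable_const

/-- Reflection principle: where the partial sum is large, the full sum or the reflected full sum is
large. Both have the same probability on `E`, since the reflection preserves `E` and the measure. -/
lemma QuasiNorm.measure_inter_sum_le (hN : QuasiNorm ρ N) (hν : ∀ j, (ν j).map Neg.neg = ν j)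
    {L : ℕ} {J : Finset ℕ} (hJ : J ⊆ Finset.range L) {E : Set (ℕ → X)} (hE : MeasurableSet E)
    (hEJ : ∀ x, signFlip J x ∈ E ↔ x ∈ E) (t : ℝ≥0) :
    Measure.infinitePi ν (E ∩ {x | t < N (∑ i ∈ J, x i)}) ≤
      2 * Measure.infinitePi ν
        (E ∩ {x | (2 : ℝ≥0) ^ (1 - 1 / ρ) * t < N (∑ i ∈ Finset.range L, x i)}) := by
  set F := {x : ℕ → X | (2 : ℝ≥0) ^ (1 - 1 / ρ) * t < N (∑ i ∈ Finset.range L, x i)} with hF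
  have hFm : MeasurableSet F := measurableSet_lt measurable_const (hN.measurable_sum _)
  have hpre : Measure.infinitePi ν (signFlip J ⁻¹' (E ∩ F)) = Measure.infinitePi ν (E ∩ F) :=
    (measurePreserving_signFlip hν J).measure_preimage (hE.inter hFm).nullMeasurableSet
  calc _ ≤ Measure.infinitePi ν ((E ∩ F) ∪ signFlip J ⁻¹' (E ∩ F)) := by
        refine measure_mono fun x hx => ?_
        rcases hN.lt_or_lt_of_add_self_eq (sum_add_sum_signFlip hJ x) hx.2 with h | h
        · exact Or.inl ⟨hx.1, h⟩
        · exact Or.inr ⟨(hEJ x).2 hx.1, h⟩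
    _ ≤ _ := measure_union_le _ _
    _ = _ := by rw [hpre, two_mul]

/-- A general form of Lévy's maximal inequality. -/
lemma QuasiNorm.measure_le_of_partition (hN : QuasiNorm ρ N)
    (hν : ∀ j, (ν j).map Neg.neg = ν j) {L : ℕ} {ι : Type*} (I : Finset ι) (J : ι → Finset ℕ)
    (E : ι → Set (ℕ → X)) (hJ : ∀ i ∈ I, J i ⊆ Finset.range L)
    (hE : ∀ i ∈ I, MeasurableSet (E i)) (hdisj : (I : Set ι).PairwiseDisjoint E)
    (hEJ : ∀ i ∈ I, ∀ x, x ∈ E i → signFlip (J i) x ∈ E i) (t : ℝ≥0) (W : Set (ℕ → X))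
    (hW : W ⊆ ⋃ i ∈ I, E i ∩ {x | t < N (∑ j ∈ J i, x j)}) :
    Measure.infinitePi ν W ≤ 2 * Measure.infinitePi ν
      {x | (2 : ℝ≥0) ^ (1 - 1 / ρ) * t < N (∑ i ∈ Finset.range L, x i)} := by
  -- As the reflection is an involution, one-sided invariance of `E i` is full invariance.
  have hinv : ∀ (J : Finset ℕ) (x : ℕ → X), signFlip J (signFlip J x) = x := fun J x => by
    classical
    funext i
    by_cases hi : i ∈ J <;> simp [signFlip, hi]
  set F := {x : ℕ → X | (2 : ℝ≥0) ^ (1 - 1 / ρ) * t < N (∑ i ∈ Finset.range L, x i)} with hF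
  have hFm : MeasurableSet F := measurableSet_lt measurable_const (hN.measurable_sum _)
  calc _ ≤ _ := measure_mono hW
    _ ≤ ∑ i ∈ I, Measure.infinitePi ν (E i ∩ {x | t < N (∑ j ∈ J i, x j)}) :=
        measure_biUnion_finset_le _ _
    _ ≤ ∑ i ∈ I, 2 * Measure.infinitePi ν (E i ∩ F) :=
        Finset.sum_le_sum fun i hi => hN.measure_inter_sum_le hν (hJ i hi) (hE i hi)
          (fun x => ⟨fun h => by simpa [hinv] using hEJ i hi _ h, hEJ i hi x⟩) t
    _ = 2 * Measure.infinitePi ν (⋃ i ∈ I, E i ∩ F) := by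
        rw [← Finset.mul_sum, measure_biUnion_finset]
        · exact fun i hi j hj hij => (hdisj hi hj hij).mono Set.inter_subset_left
            Set.inter_subset_left
        · exact fun i hi => (hE i hi).inter hFm
    _ ≤ _ := by
        gcongr
        exact Set.iUnion₂_subset fun i _ => Set.inter_subset_right

/-- The events are indexed by the first large coordinate `n`, with `J = {n}`. They involve the
coordinates only through `N`, so sign changes do not affect them. -/
lemma QuasiNorm.measure_exists_coord_le (hN : QuasiNorm ρ N)
    (hν : ∀ j, (ν j).map Neg.neg = ν j) (L : ℕ) (t : ℝ≥0) :
    Measure.infinitePi ν {x | ∃ j < L, t < N (x j)} ≤ 2 * Measure.infinitePi ν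
      {x | (2 : ℝ≥0) ^ (1 - 1 / ρ) * t < N (∑ i ∈ Finset.range L, x i)} := by
  classical
  refine hN.measure_le_of_partition hν (Finset.range L) (fun n => {n})
    (fun n => {x | t < N (x n) ∧ ∀ m < n, N (x m) ≤ t}) ?_ ?_ ?_ ?_ t _ ?_
  · intro i hi
    simpa using hi
  · intro i _
    have := hN.measurable
    refine measurableSet_setOfPred.2 (.and ?_ (.forall fun m => .imp measurable_const ?_))
    · exact measurableSet_setOfPred.1 (measurableSet_lt measurable_const (by fun_prop))
    · exact measurableSet_setOfPred.1 (measurableSet_le (by fun_prop) measurable_const)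
  · intro i _ j _ hij
    refine Set.disjoint_left.2 fun x hx hx' => ?_
    rcases lt_or_gt_of_ne hij with h | h
    · exact absurd (hx'.2 _ h) (not_le.2 hx.1)
    · exact absurd (hx.2 _ h) (not_le.2 hx'.1)
  · intro i _ x hx
    refine ⟨by simpa [signFlip] using hx.1, fun m hm => ?_⟩
    simpa [signFlip, hm.ne, hN.neg] using hx.2 m hm
  · rintro x ⟨j, hj, hx⟩
    have hex : ∃ j, t < N (x j) := ⟨j, hx⟩
    have h1 := Nat.find_spec hex
    simp only [Set.mem_iUnion, Finset.mem_range]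
    exact ⟨Nat.find hex, (Nat.find_le hx).trans_lt hj,
      ⟨h1, fun m hm => not_lt.1 (Nat.find_min hex hm)⟩, by simpa using h1⟩

lemma QuasiNorm.trunc_neg (hN : QuasiNorm ρ N) (D : ℝ≥0) (x : X) :
    trunc N D (-x) = -trunc N D x := by
  unfold trunc
  rw [hN.neg]
  split_ifs <;> simp

/-- Truncation deletes coordinates, so a truncated partial sum is a sum over a random set `J` of
indices. The events fix both the first exceedance `n` and the value of `J`; the reflection moves
only deleted coordinates below `n`, and these stay deleted because `N` is even. -/
lemma QuasiNorm.measure_exists_sum_trunc_le (hN : QuasiNorm ρ N)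
    (hν : ∀ j, (ν j).map Neg.neg = ν j) (D : ℕ → ℝ≥0) (L : ℕ) (t : ℝ≥0) :
    Measure.infinitePi ν {x | ∃ n ≤ L, t < N (∑ j ∈ Finset.range n, trunc N (D j) (x j))} ≤
      2 * Measure.infinitePi ν
        {x | (2 : ℝ≥0) ^ (1 - 1 / ρ) * t < N (∑ i ∈ Finset.range L, x i)} := by
  classical
  have hNm := hN.measurable
  have hsum : ∀ n (x : ℕ → X), ∑ j ∈ Finset.range n, trunc N (D j) (x j) =
      ∑ j ∈ (Finset.range n).filter (fun j => N (x j) ≤ D j), x j := fun n x => by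
    rw [Finset.sum_filter]; rfl
  have hmeas : ∀ n, Measurable (fun x : ℕ → X =>
      N (∑ j ∈ Finset.range n, trunc N (D j) (x j))) := fun n =>
    hNm.comp (Finset.measurable_sum _ fun j _ =>
      (hN.measurable_trunc (D j)).comp (measurable_pi_apply j))
  refine hN.measure_le_of_partition hν (Finset.range (L + 1) ×ˢ (Finset.range L).powerset)
    (fun i => i.2)
    (fun i => {x | t < N (∑ j ∈ Finset.range i.1, trunc N (D j) (x j)) ∧
      (∀ m < i.1, N (∑ j ∈ Finset.range m, trunc N (D j) (x j)) ≤ t) ∧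
      (Finset.range i.1).filter (fun j => N (x j) ≤ D j) = i.2}) ?_ ?_ ?_ ?_ t _ ?_
  · intro i hi
    simpa using (Finset.mem_product.1 hi).2
  · intro i _
    refine measurableSet_setOfPred.2 (.and ?_ (.and (.forall fun m => .imp measurable_const ?_) ?_))
    · exact measurableSet_setOfPred.1 (measurableSet_lt measurable_const (hmeas _))
    · exact measurableSet_setOfPred.1 (measurableSet_le (hmeas _) measurable_const)
    · simp only [Finset.ext_iff, Finset.mem_filter]
      refine .forall fun j => .iff (.and measurable_const ?_) measurable_const
      exact measurableSet_setOfPred.1 (measurableSet_le (by fun_prop) measurable_const)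
  · intro i _ k _ hik
    refine Set.disjoint_left.2 fun x hx hx' => hik ?_
    have h1 : i.1 = k.1 := by
      rcases lt_trichotomy i.1 k.1 with h | h | h
      · exact absurd (hx'.2.1 _ h) (not_le.2 hx.1)
      · exact h
      · exact absurd (hx.2.1 _ h) (not_le.2 hx'.1)
    exact Prod.ext h1 (by rw [← hx.2.2, ← hx'.2.2, h1])
  · rintro ⟨n, J⟩ _ x ⟨h1, h2, h3⟩
    have hNs : ∀ j, N (signFlip J x j) = N (x j) := fun j => by
      unfold signFlip; split_ifs <;> simp [hN.neg]
    have hpart : ∀ m ≤ n, ∑ j ∈ Finset.range m, trunc N (D j) (signFlip J x j) =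
        ∑ j ∈ Finset.range m, trunc N (D j) (x j) := fun m hm => by
      refine Finset.sum_congr rfl fun j hj => ?_
      by_cases hjJ : j ∈ J
      · simp [signFlip, hjJ]
      · have : ¬ N (x j) ≤ D j := fun hc => hjJ (by
          simp only at h3
          rw [← h3]
          exact Finset.mem_filter.2 ⟨Finset.mem_range.2 ((Finset.mem_range.1 hj).trans_le hm), hc⟩)
        simp only [trunc, hNs, this, if_false]
    refine ⟨by rw [hpart n le_rfl]; exact h1, fun m hm => by rw [hpart m hm.le]; exact h2 m hm, ?_⟩
    simp only [hNs]
    exact h3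
  · rintro x ⟨n, hn, hx⟩
    have hex : ∃ n, t < N (∑ j ∈ Finset.range n, trunc N (D j) (x j)) := ⟨n, hx⟩
    have h1 := Nat.find_spec hex
    have h2 := (Nat.find_min' hex hx).trans hn
    simp only [Set.mem_iUnion]
    refine ⟨(Nat.find hex, (Finset.range (Nat.find hex)).filter (fun j => N (x j) ≤ D j)), ?_,
      ⟨h1, fun m hm => not_lt.1 (Nat.find_min hex hm), rfl⟩, ?_⟩
    · refine Finset.mem_product.2 ⟨Finset.mem_range.2 (by lia), Finset.mem_powerset.2 ?_⟩
      exact (Finset.filter_subset _ _).trans (Finset.range_subset_range.2 h2)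
    · rw [Set.mem_ofPred_eq, ← hsum]
      exact h1

/-- Moment version of the reflection principle: twice the subsum is the sum of two equidistributed
full sums, each contributing `2 ^ (p / ρ - p - 1)`. -/
lemma QuasiNorm.lintegral_sum_subset_le (hN : QuasiNorm ρ N) {p : ℝ} (hp : ρ ≤ p)
    (hν : ∀ j, (ν j).map Neg.neg = ν j) {L : ℕ} {J : Finset ℕ} (hJ : J ⊆ Finset.range L) :
    ∫⁻ x, (N (∑ i ∈ J, x i) ^ p : ℝ≥0) ∂(Measure.infinitePi ν) ≤
      ((2 : ℝ≥0) ^ (p / ρ - p) : ℝ≥0) *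
        ∫⁻ x, (N (∑ i ∈ Finset.range L, x i) ^ p : ℝ≥0) ∂(Measure.infinitePi ν) := by
  have hm : Measurable fun x : ℕ → X => ((N (∑ i ∈ Finset.range L, x i) ^ p : ℝ≥0) : ℝ≥0∞) :=
    ((hN.measurable_sum _).pow_const p).coe_nnreal_ennreal
  have hfl := measurePreserving_signFlip hν J
  have hflip : ∫⁻ x, (N (∑ i ∈ Finset.range L, signFlip J x i) ^ p : ℝ≥0)
      ∂(Measure.infinitePi ν) =
      ∫⁻ x, (N (∑ i ∈ Finset.range L, x i) ^ p : ℝ≥0) ∂(Measure.infinitePi ν) :=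
    hfl.lintegral_comp hm
  calc _ ≤ ∫⁻ x, ((2 : ℝ≥0) ^ (p / ρ - p - 1) : ℝ≥0) *
        (((N (∑ i ∈ Finset.range L, x i) ^ p : ℝ≥0) : ℝ≥0∞) +
          (N (∑ i ∈ Finset.range L, signFlip J x i) ^ p : ℝ≥0)) ∂(Measure.infinitePi ν) := by
        refine lintegral_mono fun x => ?_
        have := hN.rpow_le_of_add_self_eq hp (sum_add_sum_signFlip hJ x)
        rw [← ENNReal.coe_add, ← ENNReal.coe_mul]
        exact ENNReal.coe_le_coe.2 this
    _ = _ := by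
        rw [lintegral_const_mul' _ _ ENNReal.coe_ne_top, lintegral_add_left hm, hflip,
          ← two_mul, ← mul_assoc]
        congr 1
        rw [NNReal.rpow_sub_one two_ne_zero]
        have h2 : ((2 : ℝ≥0∞)) = ((2 : ℝ≥0) : ℝ≥0∞) := rfl
        rw [h2, ← ENNReal.coe_mul, div_mul_cancel₀ _ two_ne_zero]

end Product
end Decoupling

namespace Decoupling

/-! ### Hoffmann-Jørgensen's inequality -/

section Product

variable {X : Type*} [AddCommGroup X] [MeasurableSpace X]
  {ν : ℕ → Measure X} [∀ j, IsProbabilityMeasure (ν j)]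

-- Independence of disjoint blocks of coordinates. Dependence on a block is expressed as invariance
-- under replacing the other coordinates by `0`.
open scoped Classical in
lemma lintegral_infinitePi_mul {S T : Finset ℕ} (hST : Disjoint S T) {F G : (ℕ → X) → ℝ≥0∞}
    (hF : Measurable F) (hG : Measurable G)
    (hFS : ∀ x, F (fun i => if i ∈ S then x i else 0) = F x)
    (hGT : ∀ x, G (fun i => if i ∈ T then x i else 0) = G x) :
    ∫⁻ x, F x * G x ∂(Measure.infinitePi ν) =
      (∫⁻ x, F x ∂(Measure.infinitePi ν)) * ∫⁻ x, G x ∂(Measure.infinitePi ν) := by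
  have hind : ProbabilityTheory.iIndepFun (fun (i : ℕ) (x : ℕ → X) => x i)
      (Measure.infinitePi ν) :=
    ProbabilityTheory.iIndepFun_infinitePi (X := fun _ y => y) fun _ => measurable_id
  have h := hind.indepFun_finset S T hST fun i => measurable_pi_apply i
  have hext : ∀ U : Finset ℕ, Measurable
      (fun (y : U → X) (i : ℕ) => if h : i ∈ U then y ⟨i, h⟩ else 0) := fun U => by
    refine measurable_pi_iff.2 fun i => ?_
    by_cases hi : i ∈ U
    · simpa [hi] using measurable_pi_apply _
    · simp [hi]
  have h' := h.comp (hF.comp (hext S)) (hG.comp (hext T))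
  have hF' : (F ∘ fun (y : S → X) (i : ℕ) => if h : i ∈ S then y ⟨i, h⟩ else 0) ∘
      (fun (a : ℕ → X) (i : S) => a i) = F := by
    funext x
    rw [← hFS x]
    simp [Function.comp_def]
  have hG' : (G ∘ fun (y : T → X) (i : ℕ) => if h : i ∈ T then y ⟨i, h⟩ else 0) ∘
      (fun (a : ℕ → X) (i : T) => a i) = G := by
    funext x
    rw [← hGT x]
    simp [Function.comp_def]
  rw [hF', hG'] at h'
  exact ProbabilityTheory.lintegral_mul_eq_lintegral_mul_lintegral_of_indepFun hF hG h'

variable [MeasurableAdd₂ X] [MeasurableNeg X] {ρ : ℝ} {N : X → ℝ≥0}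

/-- The set of sequences whose partial sums exceed `s` for the first time at `k + 1`. -/
def firstExceed (N : X → ℝ≥0) (s : ℝ≥0) (k : ℕ) : Set (ℕ → X) :=
  {x | s < N (∑ j ∈ Finset.range (k + 1), x j) ∧
    ∀ m ≤ k, N (∑ j ∈ Finset.range m, x j) ≤ s}

lemma QuasiNorm.measurableSet_firstExceed (hN : QuasiNorm ρ N) (s : ℝ≥0) (k : ℕ) :
    MeasurableSet (firstExceed N s k) := by
  refine measurableSet_setOfPred.2 (.and ?_ (.forall fun m => .imp measurable_const ?_))
  · exact measurableSet_setOfPred.1 (measurableSet_lt measurable_const (hN.measurable_sum _))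
  · exact measurableSet_setOfPred.1 (measurableSet_le (hN.measurable_sum _) measurable_const)

/-- A sum that exceeds `s` with controlled jumps is bounded through the first exceedance. -/
lemma QuasiNorm.rpow_sum_le_firstExceed (hN : QuasiNorm ρ N) {p : ℝ} (hp : ρ ≤ p) {L : ℕ}
    {s : ℝ≥0} {x : ℕ → X} (hx : ∀ j < L, N (x j) ≤ s) :
    ((N (∑ i ∈ Finset.range L, x i) ^ p : ℝ≥0) : ℝ≥0∞) ≤ (s ^ p : ℝ≥0) +
      ∑ k ∈ Finset.range L, (firstExceed N s k).indicator (1 : (ℕ → X) → ℝ≥0∞) x *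
        ((((2 : ℝ≥0) ^ (2 * p / ρ - 1) * s ^ p : ℝ≥0) : ℝ≥0∞) +
          ((2 : ℝ≥0) ^ (p / ρ - 1) : ℝ≥0) *
            (N (∑ i ∈ Finset.Ico (k + 1) L, x i) ^ p : ℝ≥0)) := by
  have hρ := hN.pos
  have hp0 : 0 < p := hρ.trans_le hp
  by_cases hle : N (∑ i ∈ Finset.range L, x i) ≤ s
  · refine le_add_right (ENNReal.coe_le_coe.2 (NNReal.rpow_le_rpow hle hp0.le))
  · have hex : ∃ n, s < N (∑ i ∈ Finset.range n, x i) := ⟨L, not_le.1 hle⟩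
    obtain ⟨k, hk⟩ : ∃ k, Nat.find hex = k + 1 := by
      refine Nat.exists_eq_succ_of_ne_zero fun h0 => ?_
      have := Nat.find_spec hex
      rw [h0] at this
      simp [hN.zero] at this
    have hspec := Nat.find_spec hex
    rw [hk] at hspec
    have hmin : ∀ m ≤ k, N (∑ j ∈ Finset.range m, x j) ≤ s := fun m hm =>
      not_lt.1 (Nat.find_min hex (by lia))
    have hkL : k < L := by
      have := Nat.find_min' hex (not_le.1 hle)
      lia
    have hmem : x ∈ firstExceed N s k := ⟨hspec, hmin⟩
    have hsplit : ∑ i ∈ Finset.range L, x i =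
        (∑ i ∈ Finset.range k, x i + x k) + ∑ i ∈ Finset.Ico (k + 1) L, x i := by
      rw [← Finset.sum_range_succ, Finset.sum_range_add_sum_Ico _ hkL]
    have hfirst : N (∑ i ∈ Finset.range L, x i) ^ ρ ≤ ((2 : ℝ≥0) ^ (1 / ρ) * s) ^ ρ
        + N (∑ i ∈ Finset.Ico (k + 1) L, x i) ^ ρ := by
      rw [hsplit]
      refine (hN.add_rpow_le _ _).trans (add_le_add_left ?_ _)
      refine (hN.add_rpow_le _ _).trans ?_
      rw [NNReal.mul_rpow, ← NNReal.rpow_mul, one_div, inv_mul_cancel₀ hρ.ne', NNReal.rpow_one,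
        two_mul]
      exact add_le_add (NNReal.rpow_le_rpow (hmin k le_rfl) hρ.le)
        (NNReal.rpow_le_rpow (hx k hkL) hρ.le)
    have hmain := hN.add_rpow_le_mul hp _ _ _ hfirst
    refine le_add_left ?_
    refine le_trans ?_ (Finset.single_le_sum (fun _ _ => zero_le) (Finset.mem_range.2 hkL))
    simp only [Set.indicator_of_mem hmem, Pi.one_apply, one_mul]
    rw [← ENNReal.coe_mul, ← ENNReal.coe_add]
    refine ENNReal.coe_le_coe.2 (hmain.trans_eq ?_)
    rw [mul_add, NNReal.mul_rpow, ← NNReal.rpow_mul, ← mul_assoc, ← NNReal.rpow_add two_ne_zero]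
    congr 3
    field_simp
    ring

/-- Hoffmann-Jørgensen's inequality for symmetric independent summands. -/
lemma QuasiNorm.lintegral_rpow_sum_le (hN : QuasiNorm ρ N) {p : ℝ} (hp : ρ ≤ p)
    (hν : ∀ j, (ν j).map Neg.neg = ν j) {L : ℕ} {s : ℝ≥0}
    (hD : ∀ j < L, ∀ᵐ y ∂(ν j), N y ≤ s)
    (hs : Measure.infinitePi ν {x | ∃ n ≤ L, s < N (∑ j ∈ Finset.range n, x j)} ≤
      (((2 : ℝ≥0) ^ (2 * p / ρ - p))⁻¹ : ℝ≥0)) :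
    ∫⁻ x, (N (∑ i ∈ Finset.range L, x i) ^ p : ℝ≥0) ∂(Measure.infinitePi ν) ≤
      ((2 : ℝ≥0) ^ (2 * p / ρ) * s ^ p : ℝ≥0) := by
  classical
  set P := Measure.infinitePi ν with hP
  have hρ := hN.pos
  have hp0 : 0 < p := hρ.trans_le hp
  have hae : ∀ᵐ x ∂P, ∀ j < L, N (x j) ≤ s := by
    rw [ae_all_iff]
    intro j
    by_cases hj : j < L
    · have := (measurePreserving_eval_infinitePi ν j).quasiMeasurePreserving.ae (hD j hj)
      filter_upwards [this] with x hx _ using hx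
    · exact Eventually.of_forall fun x h => absurd h hj
  set M := ∫⁻ x, (N (∑ i ∈ Finset.range L, x i) ^ p : ℝ≥0) ∂P with hM
  -- Finiteness is needed because half of `M` is absorbed at the end.
  have hMtop : M ≠ ∞ := by
    have hbd : M ≤ ∫⁻ _, (((∑ _i ∈ Finset.range L, s ^ ρ) ^ (p / ρ) : ℝ≥0) : ℝ≥0∞) ∂P := by
      refine lintegral_mono_ae ?_
      filter_upwards [hae] with x hx
      refine ENNReal.coe_le_coe.2 ?_
      have h1 : N (∑ i ∈ Finset.range L, x i) ^ p =
          (N (∑ i ∈ Finset.range L, x i) ^ ρ) ^ (p / ρ) := by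
        rw [← NNReal.rpow_mul, mul_div_cancel₀ _ hρ.ne']
      rw [h1]
      refine NNReal.rpow_le_rpow ((hN.sum_rpow_le _ _).trans ?_) (by positivity)
      exact Finset.sum_le_sum fun i hi =>
        NNReal.rpow_le_rpow (hx i (Finset.mem_range.1 hi)) hρ.le
    rw [lintegral_const, measure_univ, mul_one] at hbd
    exact ne_top_of_le_ne_top ENNReal.coe_ne_top hbd
  have hmE := hN.measurableSet_firstExceed s
  have hmS : ∀ k, Measurable fun x : ℕ → X =>
      ((N (∑ i ∈ Finset.Ico (k + 1) L, x i) ^ p : ℝ≥0) : ℝ≥0∞) := fun k =>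
    ((hN.measurable_sum _).pow_const p).coe_nnreal_ennreal
  have hmI : ∀ k, Measurable ((firstExceed N s k).indicator (1 : (ℕ → X) → ℝ≥0∞)) := fun k =>
    measurable_one.indicator (hmE k)
  set c : ℝ≥0 := (2 : ℝ≥0) ^ (2 * p / ρ - 1) * s ^ p with hc
  set c' : ℝ≥0 := (2 : ℝ≥0) ^ (p / ρ - 1) with hc'
  -- The first exceedance at `k + 1` depends on the coordinates up to `k`, the remaining sum on the
  -- later ones. By symmetry the moment of the remaining sum is comparable with `M`.
  have hterm : ∀ k ∈ Finset.range L, ∫⁻ x, (firstExceed N s k).indicator 1 x *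
      ((c : ℝ≥0∞) + c' * (N (∑ i ∈ Finset.Ico (k + 1) L, x i) ^ p : ℝ≥0)) ∂P ≤
      P (firstExceed N s k) * (c + c' * (((2 : ℝ≥0) ^ (p / ρ - p) : ℝ≥0) * M)) := by
    intro k hk
    rw [lintegral_infinitePi_mul (S := Finset.range (k + 1)) (T := Finset.Ico (k + 1) L)]
    · rw [lintegral_indicator_one (hmE k)]
      gcongr
      rw [lintegral_add_left measurable_const, lintegral_const, measure_univ, mul_one,
        lintegral_const_mul _ (hmS k)]
      gcongr
      exact hN.lintegral_sum_subset_le hp hν (fun i hi => by simp at hi ⊢; lia)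
    · rw [Finset.disjoint_left]
      intro i hi
      simp at hi ⊢
      lia
    · exact hmI k
    · exact measurable_const.add ((hmS k).const_mul _)
    · intro x
      have hsub : ∀ m ≤ k + 1, ∑ i ∈ Finset.range m,
          (if i ∈ Finset.range (k + 1) then x i else 0) = ∑ i ∈ Finset.range m, x i :=
        fun m hm => Finset.sum_congr rfl fun i hi => by
          have : i < k + 1 := (Finset.mem_range.1 hi).trans_le hm
          simp [this]
      have hiff : (fun i => if i ∈ Finset.range (k + 1) then x i else 0) ∈ firstExceed N s k ↔
          x ∈ firstExceed N s k := by
        unfold firstExceed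
        simp only [Set.mem_ofPred_eq]
        rw [hsub _ le_rfl]
        refine and_congr Iff.rfl (forall₂_congr fun m hm => ?_)
        rw [hsub m (by lia)]
      by_cases hx : x ∈ firstExceed N s k
      · rw [Set.indicator_of_mem hx, Set.indicator_of_mem (hiff.2 hx)]
        rfl
      · rw [Set.indicator_of_notMem hx, Set.indicator_of_notMem (mt hiff.1 hx)]
    · intro x
      have : ∑ i ∈ Finset.Ico (k + 1) L, (if i ∈ Finset.Ico (k + 1) L then x i else 0) =
          ∑ i ∈ Finset.Ico (k + 1) L, x i := Finset.sum_congr rfl fun i hi => by simp [hi]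
      rw [this]
  have hdisj : ∑ k ∈ Finset.range L, P (firstExceed N s k) ≤
      (((2 : ℝ≥0) ^ (2 * p / ρ - p))⁻¹ : ℝ≥0) := by
    rw [← measure_biUnion_finset _ fun k _ => hmE k]
    · refine (measure_mono ?_).trans hs
      refine Set.iUnion₂_subset fun k hk x hx => ⟨k + 1, ?_, hx.1⟩
      exact Finset.mem_range.1 hk
    · intro i _ j _ hij
      refine Set.disjoint_left.2 fun x hx hx' => ?_
      rcases lt_or_gt_of_ne hij with h | h
      · exact absurd (hx'.2 _ h) (not_le.2 hx.1)
      · exact absurd (hx.2 _ h) (not_le.2 hx'.1)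
  have hmain : M ≤ (s ^ p : ℝ≥0) + (((2 : ℝ≥0) ^ (2 * p / ρ - p))⁻¹ : ℝ≥0) *
      (c + c' * (((2 : ℝ≥0) ^ (p / ρ - p) : ℝ≥0) * M)) := by
    calc M ≤ ∫⁻ x, ((s ^ p : ℝ≥0) + ∑ k ∈ Finset.range L, (firstExceed N s k).indicator 1 x *
        ((c : ℝ≥0∞) + c' * (N (∑ i ∈ Finset.Ico (k + 1) L, x i) ^ p : ℝ≥0))) ∂P := by
          refine lintegral_mono_ae ?_
          filter_upwards [hae] with x hx using hN.rpow_sum_le_firstExceed hp hx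
      _ = (s ^ p : ℝ≥0) + ∑ k ∈ Finset.range L, ∫⁻ x, (firstExceed N s k).indicator 1 x *
        ((c : ℝ≥0∞) + c' * (N (∑ i ∈ Finset.Ico (k + 1) L, x i) ^ p : ℝ≥0)) ∂P := by
          rw [lintegral_add_left measurable_const, lintegral_const, measure_univ, mul_one,
            lintegral_finsetSum]
          exact fun k _ => (hmI k).mul (measurable_const.add ((hmS k).const_mul _))
      _ ≤ (s ^ p : ℝ≥0) + ∑ k ∈ Finset.range L, P (firstExceed N s k) *
          (c + c' * (((2 : ℝ≥0) ^ (p / ρ - p) : ℝ≥0) * M)) := by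
          gcongr with k hk
          exact hterm k hk
      _ ≤ _ := by
          rw [← Finset.sum_mul]
          gcongr
  lift M to ℝ≥0 using hMtop with M'
  norm_cast at hmain ⊢
  have e1 : ((2 : ℝ≥0) ^ (2 * p / ρ - p))⁻¹ * c = 2 ^ (p - 1) * s ^ p := by
    rw [hc, ← mul_assoc, ← NNReal.rpow_neg, ← NNReal.rpow_add two_ne_zero]
    ring_nf
  -- The probability threshold in the hypothesis `hs` is exactly the one that makes the coefficient
  -- of `M` equal to one half.
  have e2 : ((2 : ℝ≥0) ^ (2 * p / ρ - p))⁻¹ * (c' * (2 ^ (p / ρ - p) * M')) = 2⁻¹ * M' := by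
    rw [hc', ← mul_assoc, ← mul_assoc, mul_assoc (_⁻¹), ← NNReal.rpow_neg,
      ← NNReal.rpow_add two_ne_zero, ← NNReal.rpow_add two_ne_zero]
    congr 1
    rw [← NNReal.rpow_neg_one]
    congr 1
    ring
  rw [mul_add, e1, e2] at hmain
  have h3 : (2 : ℝ≥0) + 2 ^ p ≤ 2 ^ (2 * p / ρ) := by
    have hpr : 1 ≤ p / ρ := by rwa [le_div_iff₀ hρ, one_mul]
    have hpr' : p ≤ p / ρ := by
      rw [le_div_iff₀ hρ]
      exact mul_le_of_le_one_right hp0.le hN.le_one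
    have h4 : (2 : ℝ≥0) ^ (2 * p / ρ) = 2 ^ (p / ρ) * 2 ^ (p / ρ) := by
      rw [← NNReal.rpow_add two_ne_zero]; ring_nf
    have h5 : (2 : ℝ≥0) ≤ 2 ^ (p / ρ) := by
      simpa using NNReal.rpow_le_rpow_of_exponent_le (x := 2) one_le_two hpr
    have h6 : (2 : ℝ≥0) ^ p ≤ 2 ^ (p / ρ) :=
      NNReal.rpow_le_rpow_of_exponent_le one_le_two hpr'
    rw [h4]
    calc (2 : ℝ≥0) + 2 ^ p ≤ 2 ^ (p / ρ) + 2 ^ (p / ρ) := add_le_add h5 h6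
      _ = 2 * 2 ^ (p / ρ) := (two_mul _).symm
      _ ≤ _ := by gcongr
  refine le_trans ?_ (mul_le_mul_left h3 (s ^ p))
  rw [NNReal.rpow_sub_one two_ne_zero] at hmain
  have hmain' : (M' : ℝ) ≤ (s : ℝ) ^ p + ((2 : ℝ) ^ p / 2 * (s : ℝ) ^ p + 2⁻¹ * M') := by
    exact_mod_cast hmain
  rw [← NNReal.coe_le_coe]
  push_cast
  linarith

end Product
end Decoupling

namespace Decoupling

/-! ### Disintegrations, conditional probabilities and tangent kernels -/

section Disintegration

variable {Ω S Y Z : Type*} {mΩ : MeasurableSpace Ω} [MeasurableSpace S] [MeasurableSpace Y]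
  [MeasurableSpace Z]

lemma measurable_measure_map {κ : S → Measure Y} (hκ : Measurable κ)
    (hp : ∀ s, IsProbabilityMeasure (κ s)) {φ : S → Y → Z}
    (hφ : Measurable (fun z : S × Y => φ z.1 z.2)) :
    Measurable (fun s => (κ s).map (φ s)) := by
  let K : ProbabilityTheory.Kernel S Y := ⟨κ, hκ⟩
  have : ProbabilityTheory.IsMarkovKernel K := ⟨hp⟩
  refine Measure.measurable_of_measurable_coe _ fun B hB => ?_
  have h : ∀ s, (κ s).map (φ s) B = K s (Prod.mk s ⁻¹' ((fun z : S × Y => φ z.1 z.2) ⁻¹' B)) :=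
    fun s => Measure.map_apply (hφ.comp measurable_prodMk_left) hB
  simp_rw [h]
  exact ProbabilityTheory.Kernel.measurable_kernel_prodMk_left (hφ hB)

/-- On cylinders the product measure is a finite product of measurable functions, and cylinders form
a generating `π`-system. -/
lemma measurable_infinitePi {κ : ℕ → S → Measure Y} (hκ : ∀ j, Measurable (κ j))
    (hp : ∀ j s, IsProbabilityMeasure (κ j s)) :
    Measurable (fun s => Measure.infinitePi (fun j => κ j s)) := by
  refine .measure_of_isPiSystem_of_isProbabilityMeasure
    (generateFrom_squareCylinders (α := fun _ : ℕ => Y)).symm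
    (isPiSystem_squareCylinders (fun _ => MeasurableSpace.isPiSystem_measurableSet)
      fun _ => MeasurableSet.univ) ?_
  rintro _ ⟨s, t, ht, rfl⟩
  have h : ∀ i, MeasurableSet (t i) := fun i => ht i (Set.mem_univ i)
  simp_rw [Measure.infinitePi_pi _ (fun i _ => h i)]
  exact Finset.measurable_prod _ fun i _ => (Measure.measurable_coe (h i)).comp (hκ i)

variable {μ : Measure Ω} [IsProbabilityMeasure μ]

/-- Two probability measures that agree on rectangles with second side in a generating `π`-system
are equal. Rectangles suffice for the applications, where only cylinder probabilities are known. -/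
lemma map_eq_compProd_of_isPiSystem {q : Ω → S} (hq : Measurable q) {κ : S → Measure Y}
    (hκ : Measurable κ) (hp : ∀ s, IsProbabilityMeasure (κ s)) {y : Ω → Y} (hy : Measurable y)
    {C : Set (Set Y)} (hC : MeasurableSpace.generateFrom C = ‹MeasurableSpace Y›)
    (hpi : IsPiSystem C) (huniv : Set.univ ∈ C)
    (h : ∀ G, MeasurableSet G → ∀ B ∈ C,
      μ (q ⁻¹' G ∩ y ⁻¹' B) = ∫⁻ ω in q ⁻¹' G, κ (q ω) B ∂μ) :
    μ.map (fun ω => (q ω, y ω)) = (μ.map q).compProd ⟨κ, hκ⟩ := by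
  have : ProbabilityTheory.IsMarkovKernel (⟨κ, hκ⟩ : ProbabilityTheory.Kernel S Y) := ⟨hp⟩
  have hqp : IsProbabilityMeasure (μ.map q) := Measure.isProbabilityMeasure_map hq.aemeasurable
  have hqy : IsProbabilityMeasure (μ.map fun ω => (q ω, y ω)) :=
    Measure.isProbabilityMeasure_map (hq.prodMk hy).aemeasurable
  refine ext_of_generate_finite (Set.image2 (· ×ˢ ·) {s | MeasurableSet s} C)
    (generateFrom_eq_prod MeasurableSpace.generateFrom_measurableSet hC
      isCountablySpanning_measurableSet ⟨fun _ => Set.univ, fun _ => huniv, Set.iUnion_const _⟩).symm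
    (MeasurableSpace.isPiSystem_measurableSet.prod hpi) ?_ (by simp)
  rintro _ ⟨G, hG, B, hB, rfl⟩
  have hBm : MeasurableSet B := by
    rw [← hC]; exact MeasurableSpace.measurableSet_generateFrom hB
  rw [Measure.map_apply (hq.prodMk hy) (MeasurableSet.prod hG hBm),
    Measure.compProd_apply_prod hG hBm, Set.mk_preimage_prod, h G hG B hB,
    setLIntegral_map hG _ hq]
  · rfl
  · exact (Measure.measurable_coe hBm).comp hκ

/-- A disintegration that is known on a `π`-system determines integrals of jointly measurable
functions. -/
lemma lintegral_disintegration {q : Ω → S} (hq : Measurable q) {κ : S → Measure Y}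
    (hκ : Measurable κ) (hp : ∀ s, IsProbabilityMeasure (κ s)) {y : Ω → Y} (hy : Measurable y)
    {C : Set (Set Y)} (hC : MeasurableSpace.generateFrom C = ‹MeasurableSpace Y›)
    (hpi : IsPiSystem C) (huniv : Set.univ ∈ C)
    (h : ∀ G, MeasurableSet G → ∀ B ∈ C,
      μ (q ⁻¹' G ∩ y ⁻¹' B) = ∫⁻ ω in q ⁻¹' G, κ (q ω) B ∂μ)
    {F : S × Y → ℝ≥0∞} (hF : Measurable F) :
    ∫⁻ ω, F (q ω, y ω) ∂μ = ∫⁻ ω, ∫⁻ z, F (q ω, z) ∂(κ (q ω)) ∂μ := by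
  have : ProbabilityTheory.IsMarkovKernel (⟨κ, hκ⟩ : ProbabilityTheory.Kernel S Y) := ⟨hp⟩
  have h1 := map_eq_compProd_of_isPiSystem hq hκ hp hy hC hpi huniv h
  rw [← lintegral_map hF (hq.prodMk hy), h1, Measure.lintegral_compProd hF, lintegral_map _ hq]
  · rfl
  · exact Measurable.lintegral_kernel_prod_right' hF

lemma measure_of_lintegral_disintegration {q : Ω → S} (hq : Measurable q) {κ : S → Measure Y}
    {y : Ω → Y} (hy : Measurable y)
    (h : ∀ F : S × Y → ℝ≥0∞, Measurable F →
      ∫⁻ ω, F (q ω, y ω) ∂μ = ∫⁻ ω, ∫⁻ z, F (q ω, z) ∂(κ (q ω)) ∂μ)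
    {W : Set (S × Y)} (hW : MeasurableSet W) :
    μ {ω | (q ω, y ω) ∈ W} = ∫⁻ ω, κ (q ω) {z | (q ω, z) ∈ W} ∂μ := by
  have h1 := h (W.indicator 1) (measurable_one.indicator hW)
  have h2 : ∀ ω, W.indicator (1 : S × Y → ℝ≥0∞) (q ω, y ω) =
      {ω | (q ω, y ω) ∈ W}.indicator 1 ω := fun ω => rfl
  have h3 : ∀ ω, ∫⁻ z, W.indicator (1 : S × Y → ℝ≥0∞) (q ω, z) ∂(κ (q ω)) =
      κ (q ω) {z | (q ω, z) ∈ W} := fun ω => by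
    have hs : MeasurableSet {z | (q ω, z) ∈ W} := measurable_prodMk_left hW
    rw [← lintegral_indicator_one hs]
    rfl
  have h4 : MeasurableSet {ω | (q ω, y ω) ∈ W} := (hq.prodMk hy) hW
  simp_rw [h2, h3] at h1
  rwa [lintegral_indicator_one h4] at h1

end Disintegration

section CondExp

variable {Ω : Type*} {m mΩ : MeasurableSpace Ω} {μ : Measure Ω} [IsProbabilityMeasure μ]

/-- Together with its converse below, this translates between conditional probabilities, used by the
definitions, and integrated identities over conditioning events, used by the proof. -/
lemma condExp_indicator_ae_eq_of_law (hm : m ≤ mΩ) {E : Set Ω} (hE : MeasurableSet E)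
    {w : Ω → ℝ≥0∞} (hw : Measurable[m] w) (hw1 : ∀ ω, w ω ≤ 1)
    (h : ∀ G, MeasurableSet[m] G → μ (G ∩ E) = ∫⁻ ω in G, w ω ∂μ) :
    μ⟦E|m⟧ =ᵐ[μ] fun ω => (w ω).toReal := by
  have hwi : Integrable (fun ω => (w ω).toReal) μ := by
    refine Integrable.of_bound (hw.mono hm le_rfl).ennreal_toReal.aestronglyMeasurable 1
      (Eventually.of_forall fun ω => ?_)
    rw [Real.norm_of_nonneg ENNReal.toReal_nonneg]
    exact ENNReal.toReal_mono ENNReal.one_ne_top (hw1 ω)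
  refine (ae_eq_condExp_of_forall_setIntegral_eq hm
    ((integrable_const (1 : ℝ)).indicator hE) (fun s _ _ => hwi.integrableOn) ?_
    hw.ennreal_toReal.stronglyMeasurable.aestronglyMeasurable).symm
  intro G hG _
  rw [integral_toReal (hw.mono hm le_rfl).aemeasurable
    (Eventually.of_forall fun ω => (hw1 ω).trans_lt ENNReal.one_lt_top), ← h G hG,
    setIntegral_indicator hE]
  simp [Measure.real]

lemma law_of_condExp_indicator_ae_eq (hm : m ≤ mΩ) {E : Set Ω} (hE : MeasurableSet E)
    {w : Ω → ℝ≥0∞} (hw : Measurable w) (hw1 : ∀ ω, w ω ≤ 1)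
    (h : μ⟦E|m⟧ =ᵐ[μ] fun ω => (w ω).toReal) {G : Set Ω} (hG : MeasurableSet[m] G) :
    μ (G ∩ E) = ∫⁻ ω in G, w ω ∂μ := by
  have h1 : ∫ ω in G, (μ⟦E|m⟧) ω ∂μ = ∫ ω in G, E.indicator (fun _ => (1 : ℝ)) ω ∂μ :=
    setIntegral_condExp hm ((integrable_const (1 : ℝ)).indicator hE) hG
  rw [setIntegral_congr_ae (hm _ hG) (h.mono fun ω hω _ => hω),
    integral_toReal hw.aemeasurable
      (Eventually.of_forall fun ω => (hw1 ω).trans_lt ENNReal.one_lt_top),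
    setIntegral_indicator hE] at h1
  have h2 : (∫⁻ ω in G, w ω ∂μ).toReal = (μ (G ∩ E)).toReal := by
    simpa [Measure.real] using h1
  have h3 : ∫⁻ ω in G, w ω ∂μ ≠ ∞ := by
    refine ne_top_of_le_ne_top ENNReal.one_ne_top ?_
    calc ∫⁻ ω in G, w ω ∂μ ≤ ∫⁻ _ in G, 1 ∂μ := lintegral_mono fun ω => hw1 ω
      _ ≤ 1 := by simpa using prob_le_one
  exact ((ENNReal.toReal_eq_toReal_iff' h3 (measure_ne_top _ _)).1 h2).symm

end CondExp

section Kernel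

variable {Ω X : Type*} {mΩ : MeasurableSpace Ω} [AddCommGroup X] [MeasurableSpace X]

/-- Predictable symmetric kernels `κ j` that are the conditional laws both of `d j` given `ℱ j` and
of the conditionally independent sequence `e j` given `ℱ_∞`. -/
structure TangentKernel (μ : Measure Ω) (ℱ : Filtration ℕ mΩ) (d e : ℕ → Ω → X)
    (κ : ℕ → Ω → Measure X) : Prop where
  measurable_left : ∀ j, Measurable[ℱ (j + 1)] (d j)
  measurable_right : ∀ j, Measurable (e j)
  isProb : ∀ j ω, IsProbabilityMeasure (κ j ω)
  symm : ∀ j ω, (κ j ω).map Neg.neg = κ j ω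
  measurable_kernel : ∀ j, Measurable[ℱ j] (κ j)
  law_left : ∀ j G, MeasurableSet[ℱ j] G → ∀ B, MeasurableSet B →
    μ (G ∩ d j ⁻¹' B) = ∫⁻ ω in G, κ j ω B ∂μ
  law_right : ∀ n G, MeasurableSet[⨆ i, ℱ i] G → ∀ B : ℕ → Set X, (∀ j, MeasurableSet (B j)) →
    μ (G ∩ ⋂ j ∈ Finset.range n, e j ⁻¹' B j) = ∫⁻ ω in G, ∏ j ∈ Finset.range n, κ j ω (B j) ∂μ

variable {μ : Measure Ω} {ℱ : Filtration ℕ mΩ} {d e : ℕ → Ω → X}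
    {κ : ℕ → Ω → Measure X}

lemma iSup_filtration_le (ℱ : Filtration ℕ mΩ) : ⨆ i, ℱ i ≤ mΩ := iSup_le fun i => ℱ.le i

lemma TangentKernel.measurable_kernel_iSup (h : TangentKernel μ ℱ d e κ) (j : ℕ) :
    Measurable[⨆ i, ℱ i] (κ j) :=
  (h.measurable_kernel j).mono (le_iSup (fun i => ℱ i) j) le_rfl

variable [IsProbabilityMeasure μ]

lemma TangentKernel.lintegral_left (h : TangentKernel μ ℱ d e κ) (j : ℕ) {F : Ω × X → ℝ≥0∞}
    (hF : Measurable[(ℱ j).prod inferInstance] F) :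
    ∫⁻ ω, F (ω, d j ω) ∂μ = ∫⁻ ω, ∫⁻ x, F (ω, x) ∂(κ j ω) ∂μ :=
  -- The conditioning variable is the identity of `Ω`, whose target carries the smaller `σ`-algebra.
  @lintegral_disintegration Ω Ω X mΩ (ℱ j) _ μ _ id (measurable_id'' (ℱ.le j)) (κ j)
    (h.measurable_kernel j) (h.isProb j) (d j) ((h.measurable_left j).mono (ℱ.le _) le_rfl)
    {s | MeasurableSet s} MeasurableSpace.generateFrom_measurableSet
    MeasurableSpace.isPiSystem_measurableSet MeasurableSet.univ (h.law_left j) F hF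

/-- The conditional law of the whole sequence `e` given `ℱ_∞` is the product of the `κ j`. This
reduces statements about `e` to product measures, with all `ℱ_∞`-measurable data frozen. -/
lemma TangentKernel.lintegral_right (h : TangentKernel μ ℱ d e κ) {F : Ω × (ℕ → X) → ℝ≥0∞}
    (hF : Measurable[(⨆ i, ℱ i).prod inferInstance] F) :
    ∫⁻ ω, F (ω, fun j => e j ω) ∂μ =
      ∫⁻ ω, ∫⁻ x, F (ω, x) ∂(Measure.infinitePi fun j => κ j ω) ∂μ := by
  have hp := h.isProb
  refine @lintegral_disintegration Ω Ω (ℕ → X) mΩ (⨆ i, ℱ i) _ μ _ id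
    (measurable_id'' (iSup_filtration_le ℱ)) (fun ω => Measure.infinitePi fun j => κ j ω)
    (@measurable_infinitePi Ω X (⨆ i, ℱ i) _ κ h.measurable_kernel_iSup h.isProb)
    (fun ω => inferInstance) (fun ω j => e j ω) (measurable_pi_iff.2 h.measurable_right)
    _ generateFrom_squareCylinders
    (isPiSystem_squareCylinders (fun _ => MeasurableSpace.isPiSystem_measurableSet)
      fun _ => MeasurableSet.univ) ⟨∅, fun _ => Set.univ, by simp, by simp⟩ ?_ F hF
  rintro G hG _ ⟨s, t, ht, rfl⟩
  classical
  obtain ⟨n, hn⟩ := s.exists_nat_subset_range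
  have htm : ∀ i, MeasurableSet (t i) := fun i => ht i (Set.mem_univ i)
  -- A cylinder over a finite set of indices becomes one over an initial segment by leaving the
  -- additional coordinates free.
  have := h.law_right n G hG (fun j => if j ∈ s then t j else Set.univ) fun j => by
    split_ifs
    exacts [htm j, MeasurableSet.univ]
  have h2 : (fun ω j => e j ω) ⁻¹' ((s : Set ℕ).pi t) =
      ⋂ j ∈ Finset.range n, e j ⁻¹' (if j ∈ s then t j else Set.univ) := by
    ext ω
    simp only [Set.mem_preimage, Set.mem_pi, Set.mem_iInter, Finset.mem_coe]
    refine ⟨fun hh j _ => ?_, fun hh j hj => by simpa [hj] using hh j (hn hj)⟩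
    split_ifs with hj
    exacts [hh j hj, Set.mem_univ _]
  simp only [Set.preimage_id, id]
  rw [h2, this]
  refine lintegral_congr fun ω => ?_
  rw [Measure.infinitePi_pi _ fun i _ => htm i]
  symm
  refine Finset.prod_subset_one_on_sdiff hn (fun i hi => ?_) fun i hi => by simp [hi]
  simp [(Finset.mem_sdiff.1 hi).2]

lemma TangentKernel.measure_left (h : TangentKernel μ ℱ d e κ) (j : ℕ) {W : Set (Ω × X)}
    (hW : MeasurableSet[(ℱ j).prod inferInstance] W) :
    μ {ω | (ω, d j ω) ∈ W} = ∫⁻ ω, κ j ω {x | (ω, x) ∈ W} ∂μ :=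
  @measure_of_lintegral_disintegration Ω Ω X mΩ (ℱ j) _ μ _ id (measurable_id'' (ℱ.le j)) (κ j)
    (d j) ((h.measurable_left j).mono (ℱ.le _) le_rfl) (fun _ hF => h.lintegral_left j hF) W hW

lemma TangentKernel.measure_right (h : TangentKernel μ ℱ d e κ) {W : Set (Ω × (ℕ → X))}
    (hW : MeasurableSet[(⨆ i, ℱ i).prod inferInstance] W) :
    μ {ω | (ω, fun j => e j ω) ∈ W} =
      ∫⁻ ω, Measure.infinitePi (fun j => κ j ω) {x | (ω, x) ∈ W} ∂μ :=
  @measure_of_lintegral_disintegration Ω Ω (ℕ → X) mΩ (⨆ i, ℱ i) _ μ _ id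
    (measurable_id'' (iSup_filtration_le ℱ)) (fun ω => Measure.infinitePi fun j => κ j ω)
    (fun ω j => e j ω) (measurable_pi_iff.2 h.measurable_right)
    (fun _ hF => h.lintegral_right hF) W hW

end Kernel
end Decoupling

namespace Decoupling

/-! ### Predictable transforms and construction of tangent kernels -/

section Transform

lemma measurableSet_forall_transform {S Y Z : Type*} [MeasurableSpace S] [MeasurableSpace Y]
    [MeasurableSpace Z] {G : Set S} (hG : MeasurableSet G) {φ : ℕ → S → Y → Z}
    (hφ : ∀ j, Measurable (fun z : S × Y => φ j z.1 z.2)) {B : ℕ → Set Z}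
    (hB : ∀ j, MeasurableSet (B j)) (n : ℕ) :
    MeasurableSet {z : S × (ℕ → Y) | z.1 ∈ G ∧ ∀ j ∈ Finset.range n, φ j z.1 (z.2 j) ∈ B j} := by
  refine measurableSet_setOfPred.2 (.and ?_ (.forall fun j => .imp measurable_const ?_))
  · exact measurableSet_setOfPred.1 (measurable_fst hG)
  · have : Measurable fun z : S × (ℕ → Y) => φ j z.1 (z.2 j) :=
      (hφ j).comp (measurable_fst.prodMk ((measurable_pi_apply j).comp measurable_snd))
    exact measurableSet_setOfPred.1 (this (hB j))

variable {Ω X : Type*} {mΩ : MeasurableSpace Ω} [AddCommGroup X] [MeasurableSpace X]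
  [MeasurableNeg X] {μ : Measure Ω} [IsProbabilityMeasure μ] {ℱ : Filtration ℕ mΩ}
  {d e : ℕ → Ω → X} {κ : ℕ → Ω → Measure X}

lemma measurable_of_prod {m : MeasurableSpace Ω} {φ : Ω → X → X}
    (hφ : Measurable[m.prod inferInstance] (fun z : Ω × X => φ z.1 z.2)) (ω : Ω) :
    Measurable (φ ω) :=
  hφ.comp measurable_prodMk_left

lemma measurable_apply_of_prod {S Y Z : Type*} {m m' : MeasurableSpace S} [MeasurableSpace Y]
    [MeasurableSpace Z] (hm : m ≤ m') {φ : S → Y → Z}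
    (hφ : Measurable[m.prod inferInstance] (fun z : S × Y => φ z.1 z.2)) {y : S → Y}
    (hy : Measurable[m'] y) : Measurable[m'] (fun ω => φ ω (y ω)) := by
  have h : Measurable[m', m.prod inferInstance] (fun ω => (ω, y ω)) :=
    @Measurable.prodMk S m' S Y m _ _ _ (measurable_id'' hm) hy
  exact hφ.comp h

/-- Predictable odd transforms preserve tangent kernels. -/
lemma TangentKernel.transform (h : TangentKernel μ ℱ d e κ) {φ : ℕ → Ω → X → X}
    (hφ : ∀ j, Measurable[(ℱ j).prod inferInstance] (fun z : Ω × X => φ j z.1 z.2))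
    (hodd : ∀ j ω x, φ j ω (-x) = -φ j ω x) :
    TangentKernel μ ℱ (fun j ω => φ j ω (d j ω)) (fun j ω => φ j ω (e j ω))
      (fun j ω => (κ j ω).map (φ j ω)) where
  measurable_left j := measurable_apply_of_prod (ℱ.mono (Nat.le_succ j)) (hφ j)
    (h.measurable_left j)
  measurable_right j := measurable_apply_of_prod (ℱ.le j) (hφ j) (h.measurable_right j)
  isProb j ω := by
    have := h.isProb j ω
    exact Measure.isProbabilityMeasure_map (measurable_of_prod (hφ j) ω).aemeasurable
  symm j ω := by
    have hm := measurable_of_prod (hφ j) ω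
    rw [Measure.map_map measurable_neg hm]
    have : Neg.neg ∘ φ j ω = φ j ω ∘ Neg.neg := funext fun x => (hodd j ω x).symm
    rw [this, ← Measure.map_map hm measurable_neg, h.symm]
  measurable_kernel j := @measurable_measure_map Ω X X (ℱ j) _ _ _ (h.measurable_kernel j)
    (h.isProb j) _ (hφ j)
  law_left j G hG B hB := by
    have hW : MeasurableSet[(ℱ j).prod inferInstance]
        {z : Ω × X | z.1 ∈ G ∧ φ j z.1 z.2 ∈ B} :=
      MeasurableSet.inter (@measurable_fst Ω X (ℱ j) _ G hG) (hφ j hB)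
    have h1 := h.measure_left j hW
    rw [← lintegral_indicator (ℱ.le j _ hG)]
    refine h1.trans (lintegral_congr fun ω => ?_)
    by_cases hω : ω ∈ G
    · simp only [Set.mem_ofPred_eq, hω, true_and, Set.indicator_of_mem]
      rw [Measure.map_apply (measurable_of_prod (hφ j) ω) hB]
      rfl
    · simp [hω]
  law_right n G hG B hB := by
    have hp := h.isProb
    have hle : ∀ j, ℱ j ≤ ⨆ i, ℱ i := le_iSup (fun i => ℱ i)
    have hφ' : ∀ j, Measurable[(⨆ i, ℱ i).prod inferInstance]
        (fun z : Ω × X => φ j z.1 z.2) := fun j =>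
      (hφ j).mono (sup_le_sup (MeasurableSpace.comap_mono (hle j)) le_rfl) le_rfl
    have hW := @measurableSet_forall_transform Ω X X (⨆ i, ℱ i) _ _ G hG φ hφ' B hB n
    have h1 := h.measure_right hW
    rw [← lintegral_indicator (iSup_filtration_le ℱ _ hG)]
    have h2 : G ∩ ⋂ j ∈ Finset.range n, (fun ω => φ j ω (e j ω)) ⁻¹' B j =
        {ω | (ω, fun j => e j ω) ∈
          {z : Ω × (ℕ → X) | z.1 ∈ G ∧ ∀ j ∈ Finset.range n, φ j z.1 (z.2 j) ∈ B j}} := by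
      ext ω
      simp
    rw [h2]
    refine h1.trans (lintegral_congr fun ω => ?_)
    by_cases hω : ω ∈ G
    · simp only [Set.mem_ofPred_eq, hω, true_and, Set.indicator_of_mem]
      have h3 : {x : ℕ → X | ∀ j ∈ Finset.range n, φ j ω (x j) ∈ B j} =
          (Finset.range n : Set ℕ).pi (fun j => φ j ω ⁻¹' B j) := by
        ext x
        simp
      rw [h3, Measure.infinitePi_pi _ fun i _ => measurable_of_prod (hφ i) ω (hB i)]
      exact Finset.prod_congr rfl fun j _ =>
        (Measure.map_apply (measurable_of_prod (hφ j) ω) (hB j)).symm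
    · simp [hω]

end Transform

section Existence

variable {Ω X S : Type*} {mΩ : MeasurableSpace Ω} [AddCommGroup X] [MeasurableSpace X]
  [MeasurableNeg X] [StandardBorelSpace X] [MeasurableSpace S]
  {μ : Measure Ω} [IsProbabilityMeasure μ]

/-- A regular conditional law of `y` need not be symmetric at every point. Its average with its
reflection is, and still disintegrates `y`, because `y` and `-y` have the same joint law with `q`.
-/
lemma exists_symmetric_condDistrib {q : Ω → S} (hq : Measurable q) {y : Ω → X}
    (hy : Measurable y)
    (hsymm : ∀ G, MeasurableSet G → ∀ B : Set X, MeasurableSet B →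
      μ (q ⁻¹' G ∩ y ⁻¹' B) = μ (q ⁻¹' G ∩ (-y) ⁻¹' B)) :
    ∃ κ : S → Measure X, Measurable κ ∧ (∀ s, IsProbabilityMeasure (κ s)) ∧
      (∀ s, (κ s).map Neg.neg = κ s) ∧
      ∀ G, MeasurableSet G → ∀ B : Set X, MeasurableSet B →
        μ (q ⁻¹' G ∩ y ⁻¹' B) = ∫⁻ ω in q ⁻¹' G, κ (q ω) B ∂μ := by
  let K := ProbabilityTheory.condDistrib y q μ
  have hK : ∀ G, MeasurableSet G → ∀ B : Set X, MeasurableSet B →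
      μ (q ⁻¹' G ∩ y ⁻¹' B) = ∫⁻ ω in q ⁻¹' G, K (q ω) B ∂μ := fun G hG B hB =>
    (ProbabilityTheory.setLIntegral_preimage_condDistrib hq hy.aemeasurable hB hG).symm
  have happ : ∀ s (B : Set X), MeasurableSet B →
      ((2⁻¹ : ℝ≥0∞) • (K s + (K s).map Neg.neg)) B = 2⁻¹ * (K s B + K s (Neg.neg ⁻¹' B)) :=
    fun s B hB => by
      rw [Measure.smul_apply, Measure.add_apply, Measure.map_apply measurable_neg hB, smul_eq_mul]
  have h2 : (2⁻¹ : ℝ≥0∞) * 2 = 1 := ENNReal.inv_mul_cancel two_ne_zero ENNReal.ofNat_ne_top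
  refine ⟨fun s => (2⁻¹ : ℝ≥0∞) • (K s + (K s).map Neg.neg), ?_, ?_, ?_, ?_⟩
  · refine Measure.measurable_of_measurable_coe _ fun B hB => ?_
    simp_rw [happ _ B hB]
    exact ((K.measurable_coe hB).add (K.measurable_coe (measurable_neg hB))).const_mul _
  · intro s
    refine ⟨?_⟩
    rw [happ _ _ MeasurableSet.univ]
    simp only [Set.preimage_univ, measure_univ, one_add_one_eq_two, h2]
  · intro s
    ext B hB
    rw [Measure.map_apply measurable_neg hB, happ _ _ hB, happ _ _ (measurable_neg hB),
      ← Set.preimage_comp]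
    simp [add_comm]
  · intro G hG B hB
    simp_rw [happ _ B hB]
    have hm : ∀ B : Set X, MeasurableSet B → Measurable fun ω => K (q ω) B := fun B hB =>
      (K.measurable_coe hB).comp hq
    rw [lintegral_const_mul' _ _ (by simp),
      lintegral_add_left (hm B hB), ← hK G hG B hB, ← hK G hG _ (measurable_neg hB)]
    have h3 : y ⁻¹' (Neg.neg ⁻¹' B) = (-y) ⁻¹' B := rfl
    rw [h3, ← hsymm G hG B hB, ← two_mul, ← mul_assoc, h2, one_mul]

end Existence

section Differences

variable {Ω X : Type*} [AddCommGroup X]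

lemma diff_sum_range (d : ℕ → Ω → X) (j : ℕ) :
    diff (fun n => ∑ i ∈ Finset.range n, d i) (j + 1) = d j := by
  simp [diff, Finset.sum_range_succ]

lemma sum_range_diff {f : ℕ → Ω → X} (h0 : f 0 = 0) (n : ℕ) :
    ∑ j ∈ Finset.range n, diff f (j + 1) = f n := by
  have := Finset.sum_range_sub f n
  simpa [diff, h0] using this

lemma iInter_Icc_eq_iInter_range (n : ℕ) (E : ℕ → Set Ω) :
    ⋂ j ∈ Finset.Icc 1 n, E j = ⋂ j ∈ Finset.range n, E (j + 1) := by
  ext ω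
  simp only [Set.mem_iInter, Finset.mem_Icc, Finset.mem_range]
  refine ⟨fun h j hj => h (j + 1) ⟨by lia, by lia⟩, fun h j hj => ?_⟩
  obtain ⟨i, rfl⟩ : ∃ i, j = i + 1 := ⟨j - 1, by lia⟩
  exact h i (by lia)

lemma prod_Icc_eq_prod_range {M : Type*} [CommMonoid M] (n : ℕ) (a : ℕ → M) :
    ∏ j ∈ Finset.Icc 1 n, a j = ∏ j ∈ Finset.range n, a (j + 1) := by
  rw [Finset.range_eq_Ico, Finset.prod_Ico_add' a 0 n 1]
  rfl

end Differences

section Sequences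

variable {Ω X : Type*} {mΩ : MeasurableSpace Ω} [AddCommGroup X] [MetricSpace X]
  [MeasurableSpace X] [BorelSpace X] [SecondCountableTopology X] [IsTopologicalAddGroup X]
  {μ : Measure Ω} [IsProbabilityMeasure μ] {ℱ : Filtration ℕ mΩ}

lemma TangentKernel.condSymmetric {d e : ℕ → Ω → X} {κ : ℕ → Ω → Measure X}
    (h : TangentKernel μ ℱ d e κ) (j : ℕ) : CondSymmetric μ (ℱ j) (d j) := by
  intro B hB
  have hp := h.isProb j
  have hd : Measurable (d j) := (h.measurable_left j).mono (ℱ.le _) le_rfl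
  have hk : ∀ B : Set X, MeasurableSet B → Measurable[ℱ j] fun ω => κ j ω B := fun B hB =>
    (Measure.measurable_coe hB).comp (h.measurable_kernel j)
  refine (condExp_indicator_ae_eq_of_law (ℱ.le j) (hd hB) (hk B hB) (fun ω => prob_le_one)
    fun G hG => h.law_left j G hG B hB).trans
    (condExp_indicator_ae_eq_of_law (ℱ.le j) (hd.neg hB) (hk B hB) (fun ω => prob_le_one)
    fun G hG => ?_).symm
  have h1 := h.law_left j G hG _ (measurable_neg hB)
  refine h1.trans (lintegral_congr fun ω => ?_)
  rw [← Measure.map_apply measurable_neg hB, h.symm]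

/-- Sequences built by predictable transforms come with a tangent kernel; this makes them eligible
for `D_∞`, where the hypothesis of the theorem applies. -/
lemma TangentKernel.isDecoupledSum {d e : ℕ → Ω → X} {κ : ℕ → Ω → Measure X}
    (h : TangentKernel μ ℱ d e κ) :
    IsDecoupledSum μ ℱ (fun n => ∑ j ∈ Finset.range n, d j)
      (fun n => ∑ j ∈ Finset.range n, e j) := by
  have hp := h.isProb
  have hle := iSup_filtration_le ℱ
  have hkm : ∀ j, ∀ B : Set X, MeasurableSet B → Measurable[⨆ i, ℱ i] fun ω => κ j ω B :=
    fun j B hB => (Measure.measurable_coe hB).comp (h.measurable_kernel_iSup j)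
  have hone : ∀ j, ∀ B : Set X, MeasurableSet B →
      μ⟦e j ⁻¹' B|⨆ i, ℱ i⟧ =ᵐ[μ] fun ω => (κ j ω B).toReal := fun j B hB => by
    classical
    refine condExp_indicator_ae_eq_of_law hle (h.measurable_right j hB)
      (hkm j B hB) (fun ω => prob_le_one) fun G hG => ?_
    have h1 := h.law_right (j + 1) G hG (fun i => if i = j then B else Set.univ) fun i => by
      split_ifs
      exacts [hB, MeasurableSet.univ]
    have h2 : ⋂ i ∈ Finset.range (j + 1), e i ⁻¹' (if i = j then B else Set.univ) =
        e j ⁻¹' B := by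
      ext ω
      simp only [Set.mem_iInter, Finset.mem_range, Set.mem_preimage]
      refine ⟨fun hh => by simpa using hh j (by lia), fun hh i _ => ?_⟩
      split_ifs with hij
      exacts [hij ▸ hh, Set.mem_univ _]
    rw [h2] at h1
    refine h1.trans (lintegral_congr fun ω => ?_)
    rw [Finset.prod_eq_single j]
    · simp
    · intro i _ hij
      simp [hij]
    · intro hj
      simp at hj
  refine ⟨by simp, ?_, ?_, ?_⟩
  · intro n hn
    obtain ⟨j, rfl⟩ : ∃ j, n = j + 1 := ⟨n - 1, by lia⟩
    rw [diff_sum_range]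
    exact (h.measurable_right j).stronglyMeasurable
  · intro n hn B hB
    obtain ⟨j, rfl⟩ : ∃ j, n = j + 1 := ⟨n - 1, by lia⟩
    rw [diff_sum_range, diff_sum_range, Nat.add_sub_cancel]
    exact (condExp_indicator_ae_eq_of_law (ℱ.le j)
      (((h.measurable_left j).mono (ℱ.le _) le_rfl) hB)
      ((Measure.measurable_coe hB).comp (h.measurable_kernel j)) (fun ω => prob_le_one)
      fun G hG => h.law_left j G hG B hB).trans (hone j B hB).symm
  · intro n _ B hB
    rw [iInter_Icc_eq_iInter_range, prod_Icc_eq_prod_range]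
    simp_rw [diff_sum_range]
    have h1 := condExp_indicator_ae_eq_of_law hle
      (E := ⋂ j ∈ Finset.range n, e j ⁻¹' B (j + 1))
      (Finset.measurableSet_biInter _ fun j _ => h.measurable_right j (hB _))
      (w := fun ω => ∏ j ∈ Finset.range n, κ j ω (B (j + 1)))
      (Finset.measurable_prod _ fun j _ => hkm j _ (hB _))
      (fun ω => Finset.prod_le_one' fun j _ => prob_le_one)
      fun G hG => h.law_right n G hG (fun j => B (j + 1)) fun j => hB _
    have h2 : ∀ᵐ ω ∂μ, ∀ j, (μ⟦e j ⁻¹' B (j + 1)|⨆ i, ℱ i⟧) ω = (κ j ω (B (j + 1))).toReal :=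
      ae_all_iff.2 fun j => hone j _ (hB _)
    filter_upwards [h1, h2] with ω hω hω2
    rw [hω, Finset.prod_apply, ENNReal.toReal_prod]
    exact Finset.prod_congr rfl fun j _ => (hω2 j).symm

/-- Tangency transfers the kernel from `d` to each single `e j`, and conditional independence
multiplies the resulting conditional probabilities. -/
lemma IsDecoupledTangent.law_right {d e : ℕ → Ω → X} {κ : ℕ → Ω → Measure X}
    (h : IsDecoupledTangent μ ℱ d e) (hd : ∀ j, Measurable (d (j + 1)))
    (hκp : ∀ j ω, IsProbabilityMeasure (κ j ω)) (hκm : ∀ j, Measurable[ℱ j] (κ j))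
    (hκl : ∀ j, ∀ G, MeasurableSet[ℱ j] G → ∀ B : Set X, MeasurableSet B →
      μ (G ∩ d (j + 1) ⁻¹' B) = ∫⁻ ω in G, κ j ω B ∂μ)
    (n : ℕ) {G : Set Ω} (hG : MeasurableSet[⨆ i, ℱ i] G) {B : ℕ → Set X}
    (hB : ∀ j, MeasurableSet (B j)) :
    μ (G ∩ ⋂ j ∈ Finset.range n, e (j + 1) ⁻¹' B j) =
      ∫⁻ ω in G, ∏ j ∈ Finset.range n, κ j ω (B j) ∂μ := by
  have hem : ∀ j, Measurable (e (j + 1)) := fun j =>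
    (h.stronglyMeasurable _ (by lia)).measurable
  rcases Nat.eq_zero_or_pos n with rfl | hn
  · simp
  -- Decoupled tangent sequences are indexed from `1`, kernels from `0`.
  have h1 := h.condIndep n hn (fun j => B (j - 1)) fun j => hB _
  rw [iInter_Icc_eq_iInter_range, prod_Icc_eq_prod_range] at h1
  simp only [Nat.add_sub_cancel] at h1
  have hk : ∀ j, Measurable[ℱ j] fun ω => κ j ω (B j) := fun j =>
    (Measure.measurable_coe (hB j)).comp (hκm j)
  have h2 : ∀ᵐ ω ∂μ, ∀ j, (μ⟦e (j + 1) ⁻¹' B j|⨆ i, ℱ i⟧) ω = (κ j ω (B j)).toReal := by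
    refine ae_all_iff.2 fun j => ?_
    have h3 := h.tangent (j + 1) (by lia) (B j) (hB j)
    have h4 := condExp_indicator_ae_eq_of_law (ℱ.le j) (hd j (hB j)) (hk j)
      (fun ω => prob_le_one) fun G hG => hκl j G hG (B j) (hB j)
    filter_upwards [h3, h4] with ω h3 h4
    rw [← h3, ← h4]
    rfl
  refine law_of_condExp_indicator_ae_eq (iSup_filtration_le ℱ)
    (Finset.measurableSet_biInter _ fun j _ => hem j (hB _))
    (Finset.measurable_prod _ fun j _ => (hk j).mono (ℱ.le _) le_rfl)
    (fun ω => Finset.prod_le_one' fun j _ => prob_le_one) ?_ hG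
  filter_upwards [h1, h2] with ω h1 h2
  rw [h1, Finset.prod_apply, ENNReal.toReal_prod]
  exact Finset.prod_congr rfl fun j _ => h2 j

/-- The kernels of a tangent kernel serve for every other decoupled tangent sequence. -/
lemma TangentKernel.congr_right {d e : ℕ → Ω → X} {κ : ℕ → Ω → Measure X} {d' e' : ℕ → Ω → X}
    (h : TangentKernel μ ℱ d e κ) (hd : ∀ j, d' (j + 1) = d j)
    (h' : IsDecoupledTangent μ ℱ d' e') :
    TangentKernel μ ℱ d (fun j => e' (j + 1)) κ where
  measurable_left := h.measurable_left
  measurable_right j := (h'.stronglyMeasurable _ (by lia)).measurable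
  isProb := h.isProb
  symm := h.symm
  measurable_kernel := h.measurable_kernel
  law_left := h.law_left
  law_right n _ hG _ hB := h'.law_right
    (fun j => hd j ▸ (h.measurable_left j).mono (ℱ.le _) le_rfl) h.isProb h.measurable_kernel
    (fun j G hG B hB => hd j ▸ h.law_left j G hG B hB) n hG hB

/-- A conditionally symmetric sequence with a decoupled sum sequence has a tangent kernel. -/
lemma exists_tangentKernel [CompleteSpace X] {N : X → ℝ≥0} {f g : ℕ → Ω → X}
    (hf : MInf μ ℱ N f) (hg : IsDecoupledSum μ ℱ f g) :
    ∃ κ, TangentKernel μ ℱ (fun j => diff f (j + 1)) (fun j => diff g (j + 1)) κ := by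
  have hdm : ∀ j, Measurable[ℱ (j + 1)] (diff f (j + 1)) := fun j => by
    have h1 : Measurable[ℱ (j + 1)] (f (j + 1)) := (hf.adapted _).measurable
    have h2 : Measurable[ℱ (j + 1)] (f j) := (hf.adapted _).measurable.mono (ℱ.mono (by lia)) le_rfl
    exact h1.sub h2
  have hdm' : ∀ j, Measurable (diff f (j + 1)) := fun j => (hdm j).mono (ℱ.le _) le_rfl
  have hex : ∀ j, ∃ κ : Ω → Measure X, Measurable[ℱ j] κ ∧ (∀ s, IsProbabilityMeasure (κ s)) ∧
      (∀ s, (κ s).map Neg.neg = κ s) ∧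
      ∀ G, MeasurableSet[ℱ j] G → ∀ B : Set X, MeasurableSet B →
        μ (G ∩ diff f (j + 1) ⁻¹' B) = ∫⁻ ω in G, κ ω B ∂μ := fun j => by
    refine @exists_symmetric_condDistrib Ω X Ω mΩ _ _ _ _ (ℱ j) μ _ id
      (measurable_id'' (ℱ.le j)) (diff f (j + 1)) (hdm' j) ?_
    intro G hG B hB
    have hs := hf.condSymmetric (j + 1) (by lia) B hB
    rw [Nat.add_sub_cancel] at hs
    have hint : ∀ E : Set Ω, MeasurableSet E →
        ∫ ω in G, (μ⟦E|ℱ j⟧) ω ∂μ = (μ (G ∩ E)).toReal := fun E hE => by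
      rw [setIntegral_condExp (ℱ.le j) ((integrable_const (1 : ℝ)).indicator hE) hG,
        setIntegral_indicator hE]
      simp [Measure.real]
    have h1 := hint _ (hdm' j hB)
    rw [setIntegral_congr_ae (ℱ.le j _ hG) (hs.mono fun ω hω _ => hω),
      hint _ ((hdm' j).neg hB)] at h1
    exact ((ENNReal.toReal_eq_toReal_iff' (measure_ne_top _ _) (measure_ne_top _ _)).1 h1).symm
  choose κ hκm hκp hκs hκl using hex
  exact ⟨κ, hdm, fun j => (hg.2.stronglyMeasurable _ (by lia)).measurable, hκp, hκs, hκm, hκl,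
    fun n _ hG _ hB => hg.2.law_right hdm' hκp hκm hκl n hG hB⟩

end Sequences
end Decoupling

namespace Decoupling

/-! ### Maximal inequalities for tangent sequences -/

section Maximal

variable {Ω X : Type*} {mΩ : MeasurableSpace Ω} [AddCommGroup X] [MeasurableSpace X]
  [MeasurableAdd₂ X] [MeasurableNeg X] {μ : Measure Ω} [IsProbabilityMeasure μ]
  {ℱ : Filtration ℕ mΩ} {d e : ℕ → Ω → X} {κ : ℕ → Ω → Measure X} {ρ : ℝ} {N : X → ℝ≥0}

/-- Given `ℱ_∞`, the earlier `e j` contribute the `ℱ n`-measurable weight `w`. Under such a weight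
both `d n` and `e n` may be replaced by their common conditional law `κ n`. -/
lemma TangentKernel.measure_inter_left_eq_right (h : TangentKernel μ ℱ d e κ) {n : ℕ}
    {G : Set Ω} (hG : MeasurableSet[ℱ n] G) {B B' : Set X} (hB : MeasurableSet B)
    (hB' : MeasurableSet B') :
    μ (G ∩ (⋂ j ∈ Finset.range n, e j ⁻¹' B') ∩ d n ⁻¹' B) =
      μ (G ∩ (⋂ j ∈ Finset.range n, e j ⁻¹' B') ∩ e n ⁻¹' B) := by
  classical
  have hle : ∀ j, ℱ j ≤ ⨆ i, ℱ i := le_iSup (fun i => ℱ i)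
  set w : Ω → ℝ≥0∞ := fun ω => ∏ j ∈ Finset.range n, κ j ω B' with hw
  have hk : ∀ j (B : Set X), MeasurableSet B → Measurable[ℱ j] fun ω => κ j ω B := fun j B hB =>
    (Measure.measurable_coe hB).comp (h.measurable_kernel j)
  have hwm : Measurable[ℱ n] w := Finset.measurable_prod _ fun j hj =>
    (hk j B' hB').mono (ℱ.mono (Finset.mem_range.1 hj).le) le_rfl
  have hdB : MeasurableSet[ℱ (n + 1)] (d n ⁻¹' B) := h.measurable_left n hB
  have h1 : μ (G ∩ d n ⁻¹' B ∩ ⋂ j ∈ Finset.range n, e j ⁻¹' B') =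
      ∫⁻ ω in G ∩ d n ⁻¹' B, w ω ∂μ :=
    h.law_right n _ (((hle n) _ hG).inter ((hle (n + 1)) _ hdB)) (fun _ => B') fun _ => hB'
  have h2 : μ (G ∩ ⋂ j ∈ Finset.range (n + 1), e j ⁻¹' (if j = n then B else B')) =
      ∫⁻ ω in G, w ω * κ n ω B ∂μ := by
    rw [h.law_right (n + 1) G (hle n _ hG) (fun j => if j = n then B else B') fun j => by
      split_ifs
      exacts [hB, hB']]
    refine lintegral_congr fun ω => ?_
    rw [Finset.prod_range_succ, if_pos rfl]
    congr 1
    exact Finset.prod_congr rfl fun j hj => by rw [if_neg (Finset.mem_range.1 hj).ne]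
  have h3 : ⋂ j ∈ Finset.range (n + 1), e j ⁻¹' (if j = n then B else B') =
      (⋂ j ∈ Finset.range n, e j ⁻¹' B') ∩ e n ⁻¹' B := by
    rw [Finset.range_add_one, Finset.set_biInter_insert, Set.inter_comm, if_pos rfl]
    congr 1
    exact Set.iInter₂_congr fun j hj => by rw [if_neg (Finset.mem_range.1 hj).ne]
  have h4 : ∫⁻ ω in G ∩ d n ⁻¹' B, w ω ∂μ = ∫⁻ ω in G, w ω * κ n ω B ∂μ := by
    have hF : Measurable[(ℱ n).prod inferInstance]
        (fun z : Ω × X => G.indicator w z.1 * B.indicator 1 z.2) := by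
      refine Measurable.mul ?_ ?_
      · exact (hwm.indicator hG).comp (@measurable_fst Ω X (ℱ n) _)
      · exact (measurable_one.indicator hB).comp (@measurable_snd Ω X (ℱ n) _)
    have h5 := h.lintegral_left n hF
    rw [← lintegral_indicator ((ℱ.le n _ hG).inter ((ℱ.le (n + 1) _ hdB))),
      ← lintegral_indicator (ℱ.le n _ hG)]
    calc _ = ∫⁻ ω, G.indicator w ω * B.indicator 1 (d n ω) ∂μ := by
          refine lintegral_congr fun ω => ?_
          by_cases h6 : ω ∈ G <;> by_cases h7 : d n ω ∈ B <;> simp [h6, h7]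
      _ = _ := h5
      _ = _ := by
          refine lintegral_congr fun ω => ?_
          dsimp only
          rw [lintegral_const_mul _ (measurable_one.indicator hB), lintegral_indicator_one hB]
          by_cases h6 : ω ∈ G <;> simp [h6]
  rw [Set.inter_right_comm, h1, h4, ← h2, h3, Set.inter_assoc]

/-- Comparison of the maximal functions of tangent sequences. -/
lemma TangentKernel.measure_exists_left_le (h : TangentKernel μ ℱ d e κ) (hN : QuasiNorm ρ N)
    (L : ℕ) (t : ℝ≥0) :
    μ {ω | ∃ j < L, t < N (d j ω)} ≤ 2 * μ {ω | ∃ j < L, t < N (e j ω)} := by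
  classical
  set B : Set X := {x | t < N x} with hB
  have hBm : MeasurableSet B := hN.measurable measurableSet_Ioi
  set G : ℕ → Set Ω := fun n => ⋂ j ∈ Finset.range n, d j ⁻¹' Bᶜ with hG
  have hGm : ∀ n, MeasurableSet[ℱ n] (G n) := fun n =>
    Finset.measurableSet_biInter _ fun j hj =>
      ℱ.mono (Nat.succ_le_of_lt (Finset.mem_range.1 hj)) _ (h.measurable_left j hBm.compl)
  set E : ℕ → Set Ω := fun n => ⋂ j ∈ Finset.range n, e j ⁻¹' Bᶜ with hE
  have hEm : ∀ n, MeasurableSet (E n) := fun n =>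
    Finset.measurableSet_biInter _ fun j _ => h.measurable_right j hBm.compl
  -- If no `e j` is large, consider the first large `d n`: none of the earlier terms of either
  -- sequence is large, so `d n` may be exchanged for `e n`, and the events become disjoint parts of
  -- the event for `e`.
  have hsub : {ω | ∃ j < L, t < N (d j ω)} ⊆ {ω | ∃ j < L, t < N (e j ω)} ∪
      ⋃ n ∈ Finset.range L, G n ∩ E n ∩ d n ⁻¹' B := by
    rintro ω ⟨j, hj, hω⟩
    by_cases he : ∃ j < L, t < N (e j ω)
    · exact Or.inl he
    · right
      have hex : ∃ j, t < N (d j ω) := ⟨j, hω⟩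
      have hfl : Nat.find hex < L := (Nat.find_min' hex hω).trans_lt hj
      simp only [Set.mem_iUnion]
      refine ⟨Nat.find hex, Finset.mem_range.2 hfl, ⟨?_, ?_⟩, Nat.find_spec hex⟩
      · simp only [hG, Set.mem_iInter]
        exact fun i hi => Nat.find_min hex (Finset.mem_range.1 hi)
      · simp only [hE, Set.mem_iInter]
        exact fun i hi hc => he ⟨i, (Finset.mem_range.1 hi).trans hfl, hc⟩
  have hdisj : μ (⋃ n ∈ Finset.range L, G n ∩ E n ∩ e n ⁻¹' B) =
      ∑ n ∈ Finset.range L, μ (G n ∩ E n ∩ e n ⁻¹' B) := by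
    refine measure_biUnion_finset ?_ fun n _ =>
      (((ℱ.le n _ (hGm n)).inter (hEm n)).inter (h.measurable_right n hBm))
    have hlt : ∀ i j, i < j → ∀ ω, ω ∈ G i ∩ E i ∩ e i ⁻¹' B → ω ∈ G j ∩ E j ∩ e j ⁻¹' B →
        False := fun i j hij ω h1 h2 => by
      have h3 := h2.1.2
      simp only [hE, Set.mem_iInter] at h3
      exact h3 i (Finset.mem_range.2 hij) h1.2
    intro i _ j _ hij
    refine Set.disjoint_left.2 fun ω h1 h2 => ?_
    rcases lt_or_gt_of_ne hij with hlt' | hlt'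
    exacts [hlt i j hlt' ω h1 h2, hlt j i hlt' ω h2 h1]
  calc _ ≤ _ := measure_mono hsub
    _ ≤ _ := measure_union_le _ _
    _ ≤ μ {ω | ∃ j < L, t < N (e j ω)} + ∑ n ∈ Finset.range L, μ (G n ∩ E n ∩ d n ⁻¹' B) := by
        gcongr
        exact measure_biUnion_finset_le _ _
    _ = μ {ω | ∃ j < L, t < N (e j ω)} + ∑ n ∈ Finset.range L, μ (G n ∩ E n ∩ e n ⁻¹' B) := by
        congr 1
        exact Finset.sum_congr rfl fun n _ =>
          h.measure_inter_left_eq_right (hGm n) hBm hBm.compl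
    _ ≤ μ {ω | ∃ j < L, t < N (e j ω)} + μ {ω | ∃ j < L, t < N (e j ω)} := by
        rw [← hdisj]
        gcongr
        exact Set.iUnion₂_subset fun n hn ω hω => ⟨n, Finset.mem_range.1 hn, hω.2⟩
    _ = _ := (two_mul _).symm

lemma QuasiNorm.measurable_trunc_prod (hN : QuasiNorm ρ N) {S : Type*} [MeasurableSpace S]
    {D : S → ℝ≥0} (hD : Measurable D) :
    Measurable (fun z : S × X => trunc N (D z.1) z.2) :=
  Measurable.ite (measurableSet_le (hN.measurable.comp measurable_snd) (hD.comp measurable_fst))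
    measurable_snd measurable_const

lemma QuasiNorm.measurableSet_exists_sum (hN : QuasiNorm ρ N) {S : Type*} [MeasurableSpace S]
    {φ : ℕ → S → X → X} (hφ : ∀ j, Measurable (fun z : S × X => φ j z.1 z.2)) (L : ℕ) (t : ℝ≥0) :
    MeasurableSet {z : S × (ℕ → X) |
      ∃ n ≤ L, t < N (∑ j ∈ Finset.range n, φ j z.1 (z.2 j))} := by
  refine measurableSet_setOfPred.2 (.exists fun n => .and measurable_const ?_)
  refine measurableSet_setOfPred.1 (measurableSet_lt measurable_const (hN.measurable.comp ?_))
  exact Finset.measurable_sum _ fun j _ => (hφ j).comp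
    (measurable_fst.prodMk ((measurable_pi_apply j).comp measurable_snd))

lemma QuasiNorm.measurableSet_exists_sum_seq (hN : QuasiNorm ρ N) (L : ℕ) (t : ℝ≥0) :
    MeasurableSet {x : ℕ → X | ∃ n ≤ L, t < N (∑ j ∈ Finset.range n, x j)} :=
  measurableSet_setOfPred.2 (.exists fun _ => .and measurable_const
    (measurableSet_setOfPred.1 (measurableSet_lt measurable_const (hN.measurable_sum _))))

lemma TangentKernel.measure_seq (h : TangentKernel μ ℱ d e κ) {W : Set (ℕ → X)}
    (hW : MeasurableSet W) :
    μ {ω | (fun j => e j ω) ∈ W} = ∫⁻ ω, Measure.infinitePi (fun j => κ j ω) W ∂μ :=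
  h.measure_right (W := Prod.snd ⁻¹' W) (@measurable_snd Ω (ℕ → X) (⨆ i, ℱ i) _ W hW)

lemma QuasiNorm.measurableSet_lt_sum (hN : QuasiNorm ρ N) (L : ℕ) (t : ℝ≥0) :
    MeasurableSet {x : ℕ → X | t < N (∑ j ∈ Finset.range L, x j)} :=
  measurableSet_lt measurable_const (hN.measurable_sum _)

lemma TangentKernel.measure_exists_right_le (h : TangentKernel μ ℱ d e κ) (hN : QuasiNorm ρ N)
    (L : ℕ) (t : ℝ≥0) :
    μ {ω | ∃ j < L, t < N (e j ω)} ≤ 2 * μ {ω | (2 : ℝ≥0) ^ (1 - 1 / ρ) * t <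
      N (∑ j ∈ Finset.range L, e j ω)} := by
  have hp := h.isProb
  have hW : MeasurableSet {x : ℕ → X | ∃ j < L, t < N (x j)} := by
    have := hN.measurable
    refine measurableSet_setOfPred.2 (.exists fun n => .and measurable_const ?_)
    exact measurableSet_setOfPred.1 (measurableSet_lt measurable_const (by fun_prop))
  have hW' := hN.measurableSet_lt_sum (X := X) L ((2 : ℝ≥0) ^ (1 - 1 / ρ) * t)
  have h1 := h.measure_seq hW
  have h2 := h.measure_seq hW'
  simp only [Set.mem_ofPred_eq] at h1 h2
  rw [h1, h2, ← lintegral_const_mul' _ _ (by simp)]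
  exact lintegral_mono fun ω => hN.measure_exists_coord_le (fun j => h.symm j ω) L t

/-- The truncation levels are `ℱ_∞`-measurable, hence constants for fixed `ω`, and the inequality
for product measures can be integrated over `ω`. -/
lemma TangentKernel.measure_exists_sum_trunc_le (h : TangentKernel μ ℱ d e κ)
    (hN : QuasiNorm ρ N) {D : ℕ → Ω → ℝ≥0} (hD : ∀ j, Measurable[ℱ j] (D j)) (L : ℕ) (t : ℝ≥0) :
    μ {ω | ∃ n ≤ L, t < N (∑ j ∈ Finset.range n, trunc N (D j ω) (e j ω))} ≤
      2 * μ {ω | (2 : ℝ≥0) ^ (1 - 1 / ρ) * t < N (∑ j ∈ Finset.range L, e j ω)} := by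
  have hp := h.isProb
  have hW := @QuasiNorm.measurableSet_exists_sum X _ _ _ _ ρ N hN Ω (⨆ i, ℱ i)
    (fun j ω x => trunc N (D j ω) x) (fun j => @QuasiNorm.measurable_trunc_prod X _ _ _ _ ρ N hN Ω
      (⨆ i, ℱ i) (D j) ((hD j).mono (le_iSup (fun i => ℱ i) j) le_rfl)) L t
  have hW' := hN.measurableSet_lt_sum (X := X) L ((2 : ℝ≥0) ^ (1 - 1 / ρ) * t)
  have h1 := h.measure_right hW
  have h2 := h.measure_seq hW'
  simp only [Set.mem_ofPred_eq] at h1 h2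
  rw [h1, h2, ← lintegral_const_mul' _ _ (by simp)]
  exact lintegral_mono fun ω =>
    hN.measure_exists_sum_trunc_le (fun j => h.symm j ω) (fun j => D j ω) L t

end Maximal
end Decoupling

namespace Decoupling

/-! ### The good-`λ` inequality -/

section GoodLambda

variable {X : Type*} [AddCommGroup X] [MeasurableSpace X]

open scoped Classical in
/-- The laws `ν` up to the index `m`, followed by unit masses at `0`. -/
noncomputable def stopLaw (m : ℕ) (ν : ℕ → Measure X) (i : ℕ) : Measure X :=
  if i ≤ m then ν i else Measure.dirac 0

instance (m : ℕ) (ν : ℕ → Measure X) [∀ j, IsProbabilityMeasure (ν j)] (i : ℕ) :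
    IsProbabilityMeasure (stopLaw m ν i) := by
  unfold stopLaw
  split_ifs <;> infer_instance

open scoped Classical in
lemma infinitePi_stopLaw (m : ℕ) (ν : ℕ → Measure X) [∀ j, IsProbabilityMeasure (ν j)] :
    Measure.infinitePi (stopLaw m ν) =
      (Measure.infinitePi ν).map (fun x i => if i ≤ m then x i else 0) := by
  have hf : ∀ i, Measurable (fun y : X => if i ≤ m then y else 0) := fun i => by
    split_ifs <;> fun_prop
  rw [Measure.infinitePi_map_pi (μ := ν) (f := fun i y => if i ≤ m then y else 0) hf]
  congr 1
  funext i
  by_cases hi : i ≤ m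
  · simp [stopLaw, hi]
  · simp [stopLaw, hi, Measure.map_const]

open scoped Classical in
lemma measurable_stop (m : ℕ) : Measurable (fun (x : ℕ → X) i => if i ≤ m then x i else 0) := by
  refine measurable_pi_iff.2 fun i => ?_
  split_ifs <;> fun_prop

variable [MeasurableAdd₂ X] [MeasurableNeg X] {ρ : ℝ} {N : X → ℝ≥0}
  {ν : ℕ → Measure X} [∀ j, IsProbabilityMeasure (ν j)]

/-- The partial sums of a sequence set to `0` after `m` are among those of the original one. Hence
the stopping condition in `keepSet`, which sees only the laws up to `j`, is never triggered when all
the laws together satisfy it. -/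
lemma QuasiNorm.measure_stopLaw_le (hN : QuasiNorm ρ N) (m L : ℕ) (s : ℝ≥0) :
    Measure.infinitePi (stopLaw m ν) {x | ∃ n ≤ L, s < N (∑ j ∈ Finset.range n, x j)} ≤
      Measure.infinitePi ν {x | ∃ n ≤ L, s < N (∑ j ∈ Finset.range n, x j)} := by
  classical
  rw [infinitePi_stopLaw, Measure.map_apply (measurable_stop m)
    (hN.measurableSet_exists_sum_seq L s)]
  refine measure_mono ?_
  rintro x ⟨n, hn, hx⟩
  refine ⟨min n (m + 1), by lia, ?_⟩
  convert hx using 2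
  rw [← Finset.sum_filter]
  congr 1
  ext i
  simp

/-- A moment bound for the sum over `J` when the partial sums up to the last index of `J` are
controlled. -/
lemma QuasiNorm.lintegral_rpow_sum_subset_le (hN : QuasiNorm ρ N) {p : ℝ} (hp : ρ ≤ p)
    (hν : ∀ j, (ν j).map Neg.neg = ν j) {L : ℕ} {s : ℝ≥0} {J : Finset ℕ}
    (hJ : J ⊆ Finset.range L)
    (hD : ∀ m ∈ J, ∀ j ≤ m, ∀ᵐ y ∂(ν j), N y ≤ s)
    (hs : ∀ m ∈ J, Measure.infinitePi (stopLaw m ν)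
      {x | ∃ n ≤ L, s < N (∑ j ∈ Finset.range n, x j)} ≤
      (((2 : ℝ≥0) ^ (2 * p / ρ - p))⁻¹ : ℝ≥0)) :
    ∫⁻ x, (N (∑ i ∈ J, x i) ^ p : ℝ≥0) ∂(Measure.infinitePi ν) ≤
      (((2 : ℝ≥0) ^ (3 / ρ - 1) * s) ^ p : ℝ≥0) := by
  classical
  have hρ := hN.pos
  have hp0 : 0 < p := hρ.trans_le hp
  rcases J.eq_empty_or_nonempty with rfl | hne
  · simp [hN.zero, hp0.ne']
  set m := J.max' hne with hm
  have hmJ : m ∈ J := J.max'_mem hne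
  have hsym : ∀ j, (stopLaw m ν j).map Neg.neg = stopLaw m ν j := fun j => by
    unfold stopLaw
    split_ifs
    · exact hν j
    · rw [Measure.map_dirac' measurable_neg, neg_zero]
  have hD' : ∀ j < L, ∀ᵐ y ∂(stopLaw m ν j), N y ≤ s := fun j _ => by
    unfold stopLaw
    split_ifs with hj
    · exact hD m hmJ j hj
    · have hm0 : MeasurableSet {y : X | N y ≤ s} := hN.measurable measurableSet_Iic
      rw [ae_dirac_iff hm0, hN.zero]
      exact zero_le
  -- Hoffmann-Jørgensen is applied to the full sum under the stopped laws, at cost `2 ^ (2 * p /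
  -- ρ)`; passing to the subsum over `J` costs `2 ^ (p / ρ - p)`. Together they give the power `3 /
  -- ρ - 1`.
  have h1 := hN.lintegral_rpow_sum_le hp hsym hD' (hs m hmJ)
  have h2 := hN.lintegral_sum_subset_le hp hsym hJ
  have h3 : ∫⁻ x, (N (∑ i ∈ J, x i) ^ p : ℝ≥0) ∂(Measure.infinitePi (stopLaw m ν)) =
      ∫⁻ x, (N (∑ i ∈ J, x i) ^ p : ℝ≥0) ∂(Measure.infinitePi ν) := by
    rw [infinitePi_stopLaw, lintegral_map
      ((hN.measurable_sum _).pow_const p).coe_nnreal_ennreal (measurable_stop m)]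
    refine lintegral_congr fun x => ?_
    congr 3
    exact Finset.sum_congr rfl fun i hi => if_pos (J.le_max' i hi)
  rw [h3] at h2
  refine h2.trans ((mul_le_mul_right h1 _).trans_eq ?_)
  rw [← ENNReal.coe_mul, ← mul_assoc, ← NNReal.rpow_add two_ne_zero, NNReal.mul_rpow,
    ← NNReal.rpow_mul]
  congr 4
  field_simp
  ring

variable {Ω : Type*} {mΩ : MeasurableSpace Ω} {μ : Measure Ω} [IsProbabilityMeasure μ]
  {ℱ : Filtration ℕ mΩ} {d e : ℕ → Ω → X} {κ : ℕ → Ω → Measure X}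

/-- The sets on which the `j`-th increment is kept in the good-`λ` argument. -/
def keepSet (N : X → ℝ≥0) (d : ℕ → Ω → X) (κ : ℕ → Ω → Measure X) (D : ℕ → Ω → ℝ≥0)
    (L k : ℕ) (s Λ : ℝ≥0) (a : ℝ≥0∞) (j : ℕ) : Set Ω :=
  {ω | k ≤ j ∧ (∀ i ≤ j, N (∑ l ∈ Finset.range i, d l ω) ≤ Λ) ∧ D j ω ≤ s ∧
    Measure.infinitePi (stopLaw j fun i => κ i ω)
      {x | ∃ n ≤ L, s < N (∑ l ∈ Finset.range n, x l)} ≤ a}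

lemma TangentKernel.measurable_sum_left (h : TangentKernel μ ℱ d e κ) {i j : ℕ} (hij : i ≤ j) :
    Measurable[ℱ j] (fun ω => ∑ l ∈ Finset.range i, d l ω) :=
  Finset.measurable_sum _ fun l hl =>
    (h.measurable_left l).mono (ℱ.mono (by have := Finset.mem_range.1 hl; lia)) le_rfl

/-- Predictability of the selection is what makes the kept sequence a predictable transform. The
stopped laws serve this purpose: they involve only `κ i` with `i ≤ j`. -/
lemma TangentKernel.measurableSet_keepSet (h : TangentKernel μ ℱ d e κ) (hN : QuasiNorm ρ N)
    {D : ℕ → Ω → ℝ≥0} (hDm : ∀ j, Measurable[ℱ j] (D j)) (L k : ℕ) (s Λ : ℝ≥0) (a : ℝ≥0∞)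
    (j : ℕ) : MeasurableSet[ℱ j] (keepSet N d κ D L k s Λ a j) := by
  have hp := h.isProb
  have hZ := hN.measurableSet_exists_sum_seq (X := X) L s
  have hK : Measurable[ℱ j] (fun ω => Measure.infinitePi (stopLaw j fun i => κ i ω)) := by
    refine @measurable_infinitePi Ω X (ℱ j) _ (fun i ω => stopLaw j (fun i => κ i ω) i) ?_
      (fun i ω => inferInstance)
    intro i
    unfold stopLaw
    split_ifs with hi
    · exact (h.measurable_kernel i).mono (ℱ.mono hi) le_rfl
    · exact measurable_const
  refine (MeasurableSet.const _).inter (MeasurableSet.inter ?_ (MeasurableSet.inter ?_ ?_))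
  · have : {ω | ∀ i ≤ j, N (∑ l ∈ Finset.range i, d l ω) ≤ Λ} =
        ⋂ i, ⋂ (_ : i ≤ j), {ω | N (∑ l ∈ Finset.range i, d l ω) ≤ Λ} := by
      ext; simp
    change MeasurableSet[ℱ j] {ω | ∀ i ≤ j, N (∑ l ∈ Finset.range i, d l ω) ≤ Λ}
    rw [this]
    exact .iInter fun i => .iInter fun hi =>
      (hN.measurable.comp (h.measurable_sum_left hi)) measurableSet_Iic
  · exact hDm j measurableSet_Iic
  · exact ((Measure.measurable_coe hZ).comp hK) measurableSet_Iic

/-- On the event that nothing stops the sequence, the kept part started at the first time above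
`lam` is large as soon as the sequence exceeds `Λ`. -/
lemma QuasiNorm.lt_sum_keepSet (hN : QuasiNorm ρ N) {D : ℕ → Ω → ℝ≥0}
    (hDmono : ∀ ω, Monotone fun j => D j ω) (hdD : ∀ j ω, N (d j ω) ≤ D j ω) {L k : ℕ}
    {lam Λ s c : ℝ≥0} {a : ℝ≥0∞} (hlam : lam ≤ Λ) (hΛ : lam ^ ρ + s ^ ρ + c ^ ρ ≤ Λ ^ ρ)
    {ω : Ω} (hp : ∀ j, IsProbabilityMeasure (κ j ω))
    (hk : lam < N (∑ j ∈ Finset.range k, d j ω))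
    (hk' : ∀ m < k, N (∑ j ∈ Finset.range m, d j ω) ≤ lam)
    (hDL : D L ω ≤ s) (ha : Measure.infinitePi (fun j => κ j ω)
      {x | ∃ n ≤ L, s < N (∑ l ∈ Finset.range n, x l)} ≤ a)
    {n : ℕ} (hnL : n ≤ L) (hn : Λ < N (∑ j ∈ Finset.range n, d j ω)) :
    c < N (∑ j ∈ Finset.range L, (keepSet N d κ D L k s Λ a j).indicator (d j) ω) := by
  classical
  have hρ := hN.pos
  have hex : ∃ n, Λ < N (∑ j ∈ Finset.range n, d j ω) := ⟨n, hn⟩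
  set τ := Nat.find hex with hτ
  have hτs : Λ < N (∑ j ∈ Finset.range τ, d j ω) := Nat.find_spec hex
  have hτm : ∀ m < τ, N (∑ j ∈ Finset.range m, d j ω) ≤ Λ := fun m hm =>
    not_lt.1 (Nat.find_min hex hm)
  have hτL : τ ≤ L := (Nat.find_min' hex hn).trans hnL
  have hkτ : k ≤ τ := by
    by_contra! hc
    exact absurd (hk' τ hc) (not_le.2 (hlam.trans_lt hτs))
  obtain ⟨k', rfl⟩ : ∃ k', k = k' + 1 := by
    refine Nat.exists_eq_succ_of_ne_zero fun h0 => ?_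
    subst h0
    simp [hN.zero] at hk
  -- Only the passage above `Λ` ends the selection, and the increment that causes this passage, of
  -- index `τ - 1`, is kept if its index is at least the starting time.
  have hmem : ∀ j < L, (ω ∈ keepSet N d κ D L (k' + 1) s Λ a j ↔ k' + 1 ≤ j ∧ j < τ) := by
    intro j hj
    refine ⟨fun hω => ⟨hω.1, ?_⟩, fun hω => ⟨hω.1, fun i hi => hτm i (by lia),
      (hDmono ω hj.le).trans hDL, (hN.measure_stopLaw_le j L s).trans ha⟩⟩
    by_contra! hc
    exact absurd (hω.2.1 τ hc) (not_le.2 hτs)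
  have hsum : ∑ j ∈ Finset.range L, (keepSet N d κ D L (k' + 1) s Λ a j).indicator (d j) ω =
      ∑ j ∈ Finset.Ico (k' + 1) τ, d j ω := by
    have : ∀ j ∈ Finset.range L, (keepSet N d κ D L (k' + 1) s Λ a j).indicator (d j) ω =
        if k' + 1 ≤ j ∧ j < τ then d j ω else 0 := fun j hj => by
      rw [Set.indicator_apply]
      simp only [hmem j (Finset.mem_range.1 hj)]
    rw [Finset.sum_congr rfl this, ← Finset.sum_filter]
    congr 1
    ext j
    simp
    lia
  rw [hsum]
  -- Before the starting time the sum is at most `lam`, and the jump across `lam` is at most `s`;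
  -- what is missing to exceed `Λ` must come from the kept increments.
  have h1 : ∑ j ∈ Finset.range τ, d j ω =
      (∑ j ∈ Finset.range k', d j ω + d k' ω) + ∑ j ∈ Finset.Ico (k' + 1) τ, d j ω := by
    rw [← Finset.sum_range_succ, Finset.sum_range_add_sum_Ico _ hkτ]
  have h2 : Λ ^ ρ < lam ^ ρ + s ^ ρ + N (∑ j ∈ Finset.Ico (k' + 1) τ, d j ω) ^ ρ := by
    calc Λ ^ ρ < N (∑ j ∈ Finset.range τ, d j ω) ^ ρ := NNReal.rpow_lt_rpow hτs hρ
      _ ≤ _ := by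
        rw [h1]
        refine (hN.add_rpow_le _ _).trans (add_le_add_left ?_ _)
        refine (hN.add_rpow_le _ _).trans (add_le_add ?_ ?_)
        · exact NNReal.rpow_le_rpow (hk' k' (by lia)) hρ.le
        · exact NNReal.rpow_le_rpow ((hdD k' ω).trans
            ((hDmono ω (by lia : k' ≤ L)).trans hDL)) hρ.le
  have h3 := lt_of_add_lt_add_left (hΛ.trans_lt h2)
  exact (NNReal.rpow_lt_rpow_iff hρ).1 h3

/-- The good-`λ` inequality. -/
theorem TangentKernel.goodLambda (h : TangentKernel μ ℱ d e κ) (hN : QuasiNorm ρ N) {p : ℝ}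
    (hp : ρ ≤ p) {D : ℕ → Ω → ℝ≥0} (hDm : ∀ j, Measurable[ℱ j] (D j))
    (hDmono : ∀ ω, Monotone fun j => D j ω) (hdD : ∀ j ω, N (d j ω) ≤ D j ω)
    (hκD : ∀ j ω, ∀ᵐ x ∂(κ j ω), N x ≤ D j ω) (L : ℕ) {A : ℝ≥0} {b : ℝ≥0∞}
    (H : ∀ k ≤ L, ∀ V : ℕ → Set Ω, (∀ j, MeasurableSet[ℱ j] (V j)) → (∀ j < k, V j = ∅) →
      ∀ c : ℝ≥0, (∀ ω, ∫⁻ x, (N (∑ j ∈ Finset.range L, (V j).indicator (fun _ => x j) ω) ^ p : ℝ≥0)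
        ∂(Measure.infinitePi fun j => κ j ω) ≤ (c ^ p : ℝ≥0)) →
      ∀ B, MeasurableSet[ℱ k] B →
        μ (B ∩ {ω | A * c < N (∑ j ∈ Finset.range L, (V j).indicator (d j) ω)}) ≤ b * μ B)
    {lam Λ s : ℝ≥0} (hlam : lam ≤ Λ)
    (hΛ : lam ^ ρ + s ^ ρ + (A * ((2 : ℝ≥0) ^ (3 / ρ - 1) * s)) ^ ρ ≤ Λ ^ ρ) :
    μ {ω | ∃ n ≤ L, Λ < N (∑ j ∈ Finset.range n, d j ω)} ≤
      b * μ {ω | ∃ n ≤ L, lam < N (∑ j ∈ Finset.range n, d j ω)} +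
      ((2 : ℝ≥0) ^ (2 * p / ρ - p) : ℝ≥0) *
        μ {ω | ∃ n ≤ L, s < N (∑ j ∈ Finset.range n, e j ω)} +
      μ {ω | s < D L ω} := by
  classical
  have hpr := h.isProb
  set γ : ℝ≥0 := (2 : ℝ≥0) ^ (2 * p / ρ - p) with hγ
  have hγ0 : γ ≠ 0 := (NNReal.rpow_pos two_pos).ne'
  set a : ℝ≥0∞ := ((γ⁻¹ : ℝ≥0) : ℝ≥0∞) with ha
  set c : ℝ≥0 := (2 : ℝ≥0) ^ (3 / ρ - 1) * s with hc
  set Z : Set (ℕ → X) := {x | ∃ n ≤ L, s < N (∑ j ∈ Finset.range n, x j)} with hZ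
  have hZm : MeasurableSet Z := hN.measurableSet_exists_sum_seq L s
  set V : ℕ → ℕ → Set Ω := fun k => keepSet N d κ D L k s Λ a with hV
  have hVm : ∀ k j, MeasurableSet[ℱ j] (V k j) := fun k j =>
    h.measurableSet_keepSet hN hDm L k s Λ a j
  set Bk : ℕ → Set Ω := fun k => {ω | lam < N (∑ j ∈ Finset.range k, d j ω) ∧
    ∀ m < k, N (∑ j ∈ Finset.range m, d j ω) ≤ lam} with hBk
  have hBm : ∀ k, MeasurableSet[ℱ k] (Bk k) := fun k => by
    have h2 : {ω | ∀ m < k, N (∑ j ∈ Finset.range m, d j ω) ≤ lam} =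
        ⋂ m, ⋂ (_ : m < k), {ω | N (∑ l ∈ Finset.range m, d l ω) ≤ lam} := by
      ext; simp
    have h3 : MeasurableSet[ℱ k] {ω | ∀ m < k, N (∑ j ∈ Finset.range m, d j ω) ≤ lam} := by
      rw [h2]
      exact .iInter fun m => .iInter fun hm =>
        (hN.measurable.comp (h.measurable_sum_left hm.le)) measurableSet_Iic
    exact ((hN.measurable.comp (h.measurable_sum_left le_rfl)) measurableSet_Ioi).inter h3
  have hT : ∀ k ω, ∫⁻ x, (N (∑ j ∈ Finset.range L, (V k j).indicator (fun _ => x j) ω) ^ p : ℝ≥0)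
      ∂(Measure.infinitePi fun j => κ j ω) ≤ (c ^ p : ℝ≥0) := fun k ω => by
    have hs : ∀ x : ℕ → X, ∑ j ∈ Finset.range L, (V k j).indicator (fun _ => x j) ω =
        ∑ j ∈ (Finset.range L).filter (fun j => ω ∈ V k j), x j := fun x => by
      rw [Finset.sum_filter]
      exact Finset.sum_congr rfl fun j _ => Set.indicator_apply _ _ _
    simp_rw [hs]
    refine hN.lintegral_rpow_sum_subset_le hp (fun j => h.symm j ω) (Finset.filter_subset _ _)
      ?_ ?_
    · intro m hm j hj
      filter_upwards [hκD j ω] with y hy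
      exact hy.trans ((hDmono ω hj).trans (Finset.mem_filter.1 hm).2.2.2.1)
    · intro m hm
      exact (Finset.mem_filter.1 hm).2.2.2.2
  -- Apart from the two exceptional events nothing stops the sequence prematurely, so the kept
  -- sequence is large on the event `Bk k` of its starting time.
  have hsub : {ω | ∃ n ≤ L, Λ < N (∑ j ∈ Finset.range n, d j ω)} ⊆
      ((⋃ k ∈ Finset.range (L + 1), Bk k ∩
        {ω | A * c < N (∑ j ∈ Finset.range L, (V k j).indicator (d j) ω)}) ∪
      {ω | a < Measure.infinitePi (fun j => κ j ω) Z}) ∪ {ω | s < D L ω} := by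
    rintro ω ⟨n, hn, hω⟩
    by_cases h1 : s < D L ω
    · exact Or.inr h1
    by_cases h2 : a < Measure.infinitePi (fun j => κ j ω) Z
    · exact Or.inl (Or.inr h2)
    refine Or.inl (Or.inl ?_)
    have hex : ∃ k, lam < N (∑ j ∈ Finset.range k, d j ω) := ⟨n, hlam.trans_lt hω⟩
    have hkn : Nat.find hex ≤ n := Nat.find_min' hex (hlam.trans_lt hω)
    have hmin : ∀ m < Nat.find hex, N (∑ j ∈ Finset.range m, d j ω) ≤ lam := fun m hm =>
      not_lt.1 (Nat.find_min hex hm)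
    simp only [Set.mem_iUnion]
    refine ⟨Nat.find hex, Finset.mem_range.2 (by lia), ⟨Nat.find_spec hex, hmin⟩, ?_⟩
    exact hN.lt_sum_keepSet hDmono hdD hlam hΛ (fun j => hpr j ω) (Nat.find_spec hex) hmin
      (not_lt.1 h1) (not_lt.1 h2) hn hω
  have hfirst : μ (⋃ k ∈ Finset.range (L + 1), Bk k ∩
        {ω | A * c < N (∑ j ∈ Finset.range L, (V k j).indicator (d j) ω)}) ≤
      b * μ {ω | ∃ n ≤ L, lam < N (∑ j ∈ Finset.range n, d j ω)} := by
    calc _ ≤ ∑ k ∈ Finset.range (L + 1), μ (Bk k ∩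
        {ω | A * c < N (∑ j ∈ Finset.range L, (V k j).indicator (d j) ω)}) :=
          measure_biUnion_finset_le _ _
      _ ≤ ∑ k ∈ Finset.range (L + 1), b * μ (Bk k) := by
          refine Finset.sum_le_sum fun k hk => ?_
          refine H k (Nat.lt_succ_iff.1 (Finset.mem_range.1 hk)) (V k) (hVm k) (fun j hj => ?_) c
            (hT k) (Bk k) (hBm k)
          ext ω
          simp only [Set.mem_empty_iff_false, iff_false]
          exact fun hω => absurd hω.1 (not_le.2 hj)
      _ = b * μ (⋃ k ∈ Finset.range (L + 1), Bk k) := by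
          rw [measure_biUnion_finset, Finset.mul_sum]
          · intro i _ j _ hij
            refine Set.disjoint_left.2 fun ω hx hx' => ?_
            rcases lt_or_gt_of_ne hij with h | h
            · exact absurd (hx'.2 _ h) (not_le.2 hx.1)
            · exact absurd (hx.2 _ h) (not_le.2 hx'.1)
          · exact fun k _ => ℱ.le k _ (hBm k)
      _ ≤ _ := by
          gcongr
          exact Set.iUnion₂_subset fun k hk ω hω =>
            ⟨k, Nat.lt_succ_iff.1 (Finset.mem_range.1 hk), hω.1⟩
  -- Chebyshev's inequality: the conditional probability of `Z` integrates to the probability that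
  -- some partial sum of `e` exceeds `s`.
  have hsecond : μ {ω | a < Measure.infinitePi (fun j => κ j ω) Z} ≤
      γ * μ {ω | ∃ n ≤ L, s < N (∑ j ∈ Finset.range n, e j ω)} := by
    have h1 := h.measure_seq hZm
    have h2 : μ {ω | ∃ n ≤ L, s < N (∑ j ∈ Finset.range n, e j ω)} =
        ∫⁻ ω, Measure.infinitePi (fun j => κ j ω) Z ∂μ := h1
    have hKm : Measurable fun ω => Measure.infinitePi (fun j => κ j ω) Z :=
      (Measure.measurable_coe hZm).comp (measurable_infinitePi
        (fun j => (h.measurable_kernel j).mono (ℱ.le j) le_rfl) h.isProb)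
    rw [h2]
    have h3 := mul_meas_ge_le_lintegral (μ := μ) hKm a
    calc μ {ω | a < Measure.infinitePi (fun j => κ j ω) Z}
        ≤ μ {ω | a ≤ Measure.infinitePi (fun j => κ j ω) Z} :=
          measure_mono fun ω (hω : a < _) => hω.le
      _ = γ * (a * μ {ω | a ≤ Measure.infinitePi (fun j => κ j ω) Z}) := by
          rw [← mul_assoc, ha, ← ENNReal.coe_mul, mul_inv_cancel₀ hγ0, ENNReal.coe_one, one_mul]
      _ ≤ _ := by gcongr
  calc _ ≤ _ := measure_mono hsub
    _ ≤ _ := measure_union_le _ _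
    _ ≤ _ := by
      gcongr
      exact (measure_union_le _ _).trans (add_le_add hfirst hsecond)

end GoodLambda
end Decoupling

namespace Decoupling

/-! ### From tails to moments, and Davis' decomposition -/

section Tail

variable {Φ : ℝ≥0 → ℝ≥0}

/-- Sublevel sets of `Φ` are closed initial segments containing `0`. Superlevel sets are thus empty
or open half-lines, so strict tail inequalities for a variable pass to its image under `Φ`. -/
lemma superlevel_eq_empty_or_Ioi (hmono : Monotone Φ) (hcont : Continuous Φ) (h0 : Φ 0 = 0)
    (t : ℝ≥0) : (∀ x, Φ x ≤ t) ∨ ∃ t₀, ∀ x, t < Φ x ↔ t₀ < x := by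
  by_cases h : ∀ x, Φ x ≤ t
  · exact Or.inl h
  right
  push Not at h
  obtain ⟨x₀, hx₀⟩ := h
  have hcl : IsClosed {x | Φ x ≤ t} := isClosed_le hcont continuous_const
  have hne : {x | Φ x ≤ t}.Nonempty := ⟨0, by simp [h0]⟩
  have hbdd : BddAbove {x | Φ x ≤ t} := ⟨x₀, fun x hx => by
    by_contra! hc
    exact absurd (hx₀.trans_le (hmono hc.le)) (not_lt.2 hx)⟩
  refine ⟨sSup {x | Φ x ≤ t}, fun x => ⟨fun hx => ?_, fun hx => ?_⟩⟩
  · by_contra! hc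
    exact absurd ((hmono hc).trans (hcl.csSup_mem hne hbdd)) (not_le.2 hx)
  · by_contra! hc
    exact absurd (le_csSup hbdd hc) (not_le.2 hx)

variable {Ω : Type*} {mΩ : MeasurableSpace Ω} {μ : Measure Ω}

lemma lintegral_eq_lintegral_measure_lt (hcont : Continuous Φ) {U : Ω → ℝ≥0}
    (hU : Measurable U) :
    ∫⁻ ω, (Φ (U ω) : ℝ≥0∞) ∂μ = ∫⁻ t in Set.Ioi (0 : ℝ), μ {ω | t < (Φ (U ω) : ℝ)} := by
  rw [← lintegral_eq_lintegral_meas_lt μ (f := fun ω => (Φ (U ω) : ℝ))]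
  · simp
  · exact Eventually.of_forall fun ω => NNReal.coe_nonneg _
  · exact (hcont.measurable.comp hU).coe_nnreal_real.aemeasurable

/-- Comparison of tails implies comparison of `Φ`-moments. -/
lemma lintegral_le_of_tail_le (hmono : Monotone Φ) (hcont : Continuous Φ) (h0 : Φ 0 = 0)
    {ι : Type*} (s : Finset ι) (c : ι → ℝ≥0) {U : Ω → ℝ≥0} (hU : Measurable U)
    {W : ι → Ω → ℝ≥0} (hW : ∀ i, Measurable (W i))
    (h : ∀ t, μ {ω | t < U ω} ≤ ∑ i ∈ s, c i * μ {ω | t < W i ω}) :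
    ∫⁻ ω, (Φ (U ω) : ℝ≥0∞) ∂μ ≤ ∑ i ∈ s, c i * ∫⁻ ω, (Φ (W i ω) : ℝ≥0∞) ∂μ := by
  have hanti : ∀ i, Measurable fun t : ℝ => μ {ω | t < (Φ (W i ω) : ℝ)} := fun i =>
    Antitone.measurable fun t t' htt' => measure_mono fun ω (hω : t' < _) => htt'.trans_lt hω
  simp_rw [lintegral_eq_lintegral_measure_lt hcont hU,
    fun i => lintegral_eq_lintegral_measure_lt (μ := μ) hcont (hW i),
    ← fun i => lintegral_const_mul' (μ := volume.restrict (Set.Ioi (0 : ℝ))) (c i : ℝ≥0∞)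
      (fun t : ℝ => μ {ω | t < (Φ (W i ω) : ℝ)}) ENNReal.coe_ne_top]
  rw [← lintegral_finsetSum _ fun i _ => (hanti i).const_mul _]
  refine lintegral_mono_ae ?_
  filter_upwards [ae_restrict_mem measurableSet_Ioi] with t ht
  lift t to ℝ≥0 using (Set.mem_Ioi.1 ht).le
  simp only [NNReal.coe_lt_coe]
  rcases superlevel_eq_empty_or_Ioi hmono hcont h0 t with h1 | ⟨t₀, ht₀⟩
  · simp [fun ω => not_lt.2 (h1 (U ω))]
  · simp only [ht₀]
    exact h t₀

lemma lintegral_mul_le {q : ℝ} (hΦq : ∀ s t : ℝ≥0, 1 ≤ s → Φ (s * t) ≤ s ^ q * Φ t) {k : ℝ≥0}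
    (hk : 1 ≤ k) (W : Ω → ℝ≥0) :
    ∫⁻ ω, (Φ (k * W ω) : ℝ≥0∞) ∂μ ≤ (k ^ q : ℝ≥0) * ∫⁻ ω, (Φ (W ω) : ℝ≥0∞) ∂μ := by
  rw [← lintegral_const_mul' _ _ ENNReal.coe_ne_top]
  refine lintegral_mono fun ω => ?_
  rw [← ENNReal.coe_mul]
  exact ENNReal.coe_le_coe.2 (hΦq k _ hk)

end Tail

section Davis

variable {X : Type*} [AddCommGroup X] [MeasurableSpace X] {ρ : ℝ} {N : X → ℝ≥0}

/-- The maximum of the quasi-norms of the first `n` terms. -/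
def maxNorm (N : X → ℝ≥0) (y : ℕ → X) (n : ℕ) : ℝ≥0 := (Finset.range n).sup fun j => N (y j)

lemma maxNorm_mono (N : X → ℝ≥0) (y : ℕ → X) : Monotone (maxNorm N y) := fun _ _ h =>
  Finset.sup_mono (Finset.range_subset_range.2 h)

lemma le_maxNorm (N : X → ℝ≥0) (y : ℕ → X) {j n : ℕ} (h : j < n) : N (y j) ≤ maxNorm N y n :=
  Finset.le_sup (f := fun j => N (y j)) (Finset.mem_range.2 h)

lemma lt_maxNorm_iff {y : ℕ → X} {n : ℕ} {t : ℝ≥0} :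
    t < maxNorm N y n ↔ ∃ j < n, t < N (y j) := by
  simp [maxNorm, Finset.lt_sup_iff]

/-- The part of a sequence consisting of its large jumps is controlled by its largest term. -/
lemma QuasiNorm.sum_large_jumps_le (hN : QuasiNorm ρ N) (y : ℕ → X) (n : ℕ) :
    (1 - (2 : ℝ≥0) ^ (-ρ)) *
      ∑ j ∈ Finset.range n, N (y j - trunc N (2 * maxNorm N y j) (y j)) ^ ρ ≤
      maxNorm N y n ^ ρ := by
  have hρ := hN.pos
  have h1 : (2 : ℝ≥0) ^ (-ρ) ≤ 1 := NNReal.rpow_le_one_of_one_le_of_nonpos one_le_two (by linarith)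
  induction n with
  | zero => simp
  | succ n ih =>
    rw [Finset.sum_range_succ, mul_add]
    by_cases hy : N (y n) ≤ 2 * maxNorm N y n
    · rw [trunc, if_pos hy, sub_self, hN.zero, NNReal.zero_rpow hρ.ne', mul_zero, add_zero]
      exact ih.trans (NNReal.rpow_le_rpow (maxNorm_mono N y (Nat.le_succ n)) hρ.le)
    · rw [trunc, if_neg hy, sub_zero]
      -- A large jump at least doubles the running maximum, so the bound for the earlier jumps takes
      -- up only the fraction `2 ^ (-ρ)` of the new maximum.
      have h2 : maxNorm N y n ^ ρ ≤ (2 : ℝ≥0) ^ (-ρ) * N (y n) ^ ρ := by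
        rw [NNReal.rpow_neg, ← NNReal.inv_rpow, ← NNReal.mul_rpow]
        refine NNReal.rpow_le_rpow ?_ hρ.le
        rw [← div_eq_inv_mul, le_div_iff₀ two_pos, mul_comm]
        exact (not_le.1 hy).le
      calc _ ≤ (2 : ℝ≥0) ^ (-ρ) * N (y n) ^ ρ + (1 - (2 : ℝ≥0) ^ (-ρ)) * N (y n) ^ ρ :=
            add_le_add_left (ih.trans h2) _
        _ = N (y n) ^ ρ := by rw [← add_mul, add_tsub_cancel_of_le h1, one_mul]
        _ ≤ _ := NNReal.rpow_le_rpow (le_maxNorm N y (Nat.lt_succ_self n)) hρ.le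

/-- The constant that bounds the large jumps. -/
noncomputable def jumpConst (ρ : ℝ) : ℝ≥0 := (1 - (2 : ℝ≥0) ^ (-ρ)) ^ (-(1 / ρ))

lemma one_sub_two_rpow_pos (hρ : 0 < ρ) : 0 < 1 - (2 : ℝ≥0) ^ (-ρ) :=
  tsub_pos_of_lt (NNReal.rpow_lt_one_of_one_lt_of_neg one_lt_two (by linarith))

lemma one_le_jumpConst (hρ : 0 < ρ) : 1 ≤ jumpConst ρ :=
  NNReal.one_le_rpow_of_pos_of_le_one_of_nonpos (one_sub_two_rpow_pos hρ) tsub_le_self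
    (by rw [neg_nonpos]; positivity)

/-- Davis' decomposition. -/
lemma QuasiNorm.lt_or_lt_of_lt_sum (hN : QuasiNorm ρ N) {y : ℕ → X} {n L : ℕ} (hn : n ≤ L)
    {t : ℝ≥0} (ht : t < N (∑ j ∈ Finset.range n, y j)) :
    t < (2 : ℝ≥0) ^ (1 / ρ) *
        N (∑ j ∈ Finset.range n, trunc N (2 * maxNorm N y j) (y j)) ∨
      t < (2 : ℝ≥0) ^ (1 / ρ) * jumpConst ρ * maxNorm N y L := by
  have hρ := hN.pos
  by_contra! hc
  have h2 : ((2 : ℝ≥0) ^ (1 / ρ)) ^ ρ = 2 := by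
    rw [← NNReal.rpow_mul, one_div, inv_mul_cancel₀ hρ.ne', NNReal.rpow_one]
  have e1 := NNReal.rpow_le_rpow hc.1 hρ.le
  have e2 := NNReal.rpow_le_rpow hc.2 hρ.le
  rw [NNReal.mul_rpow, h2] at e1
  rw [NNReal.mul_rpow, NNReal.mul_rpow, h2] at e2
  have hθ := one_sub_two_rpow_pos hρ
  have h3 : jumpConst ρ ^ ρ = (1 - (2 : ℝ≥0) ^ (-ρ))⁻¹ := by
    rw [jumpConst, ← NNReal.rpow_mul, neg_mul, one_div, inv_mul_cancel₀ hρ.ne',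
      NNReal.rpow_neg_one]
  have h4 : ∑ j ∈ Finset.range n, N (y j - trunc N (2 * maxNorm N y j) (y j)) ^ ρ ≤
      jumpConst ρ ^ ρ * maxNorm N y L ^ ρ := by
    rw [h3, ← div_eq_inv_mul, le_div_iff₀ hθ, mul_comm]
    exact (hN.sum_large_jumps_le y n).trans (NNReal.rpow_le_rpow (maxNorm_mono N y hn) hρ.le)
  have h5 : ∑ j ∈ Finset.range n, y j = ∑ j ∈ Finset.range n, trunc N (2 * maxNorm N y j) (y j) +
      ∑ j ∈ Finset.range n, (y j - trunc N (2 * maxNorm N y j) (y j)) := by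
    rw [← Finset.sum_add_distrib]
    exact Finset.sum_congr rfl fun j _ => by abel
  have h6 : N (∑ j ∈ Finset.range n, y j) ^ ρ ≤
      N (∑ j ∈ Finset.range n, trunc N (2 * maxNorm N y j) (y j)) ^ ρ +
        jumpConst ρ ^ ρ * maxNorm N y L ^ ρ := by
    rw [h5]
    exact (hN.add_rpow_le _ _).trans (by gcongr; exact (hN.sum_rpow_le _ _).trans h4)
  have h7 := NNReal.rpow_lt_rpow ht hρ
  have h8 : 2 * t ^ ρ < 2 * t ^ ρ := by
    calc 2 * t ^ ρ < 2 * N (∑ j ∈ Finset.range n, y j) ^ ρ := by gcongr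
      _ ≤ 2 * (N (∑ j ∈ Finset.range n, trunc N (2 * maxNorm N y j) (y j)) ^ ρ +
        jumpConst ρ ^ ρ * maxNorm N y L ^ ρ) := by gcongr
      _ = 2 * N (∑ j ∈ Finset.range n, trunc N (2 * maxNorm N y j) (y j)) ^ ρ +
        2 * jumpConst ρ ^ ρ * maxNorm N y L ^ ρ := by ring
      _ ≤ t ^ ρ + t ^ ρ := add_le_add e1 e2
      _ = 2 * t ^ ρ := (two_mul _).symm
  exact lt_irrefl _ h8

end Davis
end Decoupling

namespace Decoupling

/-! ### Tail and moment inequalities for bounded tangent sequences -/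

section Core

variable {Ω X : Type*} {mΩ : MeasurableSpace Ω} [AddCommGroup X] [MeasurableSpace X]
  [MeasurableAdd₂ X] [MeasurableNeg X] {μ : Measure Ω} [IsProbabilityMeasure μ]
  {ℱ : Filtration ℕ mΩ} {d e : ℕ → Ω → X} {κ : ℕ → Ω → Measure X} {ρ : ℝ} {N : X → ℝ≥0}

/-- The tail estimate behind the extrapolation, for bounded sequences of length `L` that vanish up
to `k`. -/
def TailBound (μ : Measure Ω) (ℱ : Filtration ℕ mΩ) (N : X → ℝ≥0) (p : ℝ) (A : ℝ≥0) (b : ℝ≥0∞)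
    (L : ℕ) : Prop :=
  ∀ (d e : ℕ → Ω → X) (κ : ℕ → Ω → Measure X), TangentKernel μ ℱ d e κ →
    (∃ M : ℝ≥0, ∀ j, ∀ᵐ ω ∂μ, N (d j ω) ≤ M) → (∀ j, L ≤ j → d j =ᵐ[μ] 0) →
    ∀ k ≤ L, (∀ j < k, d j = 0) → (∀ j < k, e j = 0) → ∀ c : ℝ≥0,
    (∀ ω, ∫⁻ x, (N (∑ j ∈ Finset.range L, x j) ^ p : ℝ≥0)
      ∂(Measure.infinitePi fun j => κ j ω) ≤ (c ^ p : ℝ≥0)) →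
    ∀ B, MeasurableSet[ℱ k] B →
      μ (B ∩ {ω | A * c < N (∑ j ∈ Finset.range L, d j ω)}) ≤ b * μ B

lemma QuasiNorm.trunc_le (hN : QuasiNorm ρ N) (D : ℝ≥0) (x : X) : N (trunc N D x) ≤ D := by
  unfold trunc
  split_ifs with h
  · exact h
  · simp [hN.zero]

lemma QuasiNorm.trunc_le_self (hN : QuasiNorm ρ N) (D : ℝ≥0) (x : X) :
    N (trunc N D x) ≤ N x := by
  unfold trunc
  split_ifs with h
  · exact le_rfl
  · simp [hN.zero]

lemma measurable_maxNorm {S : Type*} [MeasurableSpace S] (hN : Measurable N) {y : ℕ → S → X}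
    {n : ℕ} (hy : ∀ i < n, Measurable (y i)) :
    Measurable (fun ω => maxNorm N (fun i => y i ω) n) := by
  unfold maxNorm
  induction n with
  | zero => simp
  | succ n ih =>
    simp only [Finset.range_add_one, Finset.sup_insert]
    exact (hN.comp (hy n (by lia))).sup (ih fun i hi => hy i (by lia))

lemma TangentKernel.measurable_maxNorm_left (h : TangentKernel μ ℱ d e κ) (hN : QuasiNorm ρ N)
    (j : ℕ) : Measurable[ℱ j] (fun ω => maxNorm N (fun i => d i ω) j) :=
  @measurable_maxNorm X _ _ _ _ N Ω (ℱ j) hN.measurable d j fun i hi =>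
    (h.measurable_left i).mono (ℱ.mono (by lia)) le_rfl

lemma measurable_indicator_prod {S : Type*} [MeasurableSpace S] {V : Set S}
    (hV : MeasurableSet V) : Measurable (fun z : S × X => V.indicator (fun _ => z.2) z.1) := by
  classical
  simp_rw [Set.indicator_apply]
  exact Measurable.ite (measurable_fst hV) measurable_snd measurable_const

/-- The tail form of the good-`λ` inequality for the part with small jumps. -/
lemma TangentKernel.measure_trunc_tail_le (h : TangentKernel μ ℱ d e κ) (hN : QuasiNorm ρ N)
    {p : ℝ} (hp : ρ ≤ p) {L : ℕ} {A b : ℝ≥0} (H : TailBound μ ℱ N p A b L)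
    (hbdd : ∃ M : ℝ≥0, ∀ j, ∀ᵐ ω ∂μ, N (d j ω) ≤ M) (hL : ∀ j, L ≤ j → d j =ᵐ[μ] 0)
    {β R : ℝ≥0} (hβ : 1 ≤ β) (hR : 1 ≤ R) (hβR : (β⁻¹) ^ ρ + (1 + 2 * A ^ ρ) * R⁻¹ ^ ρ ≤ 1)
    (t : ℝ≥0) :
    μ {ω | t < maxNorm N (fun n => ∑ j ∈ Finset.range n,
        trunc N (2 * maxNorm N (fun i => d i ω) j) (d j ω)) (L + 1)} ≤
      b * μ {ω | t < β * maxNorm N (fun n => ∑ j ∈ Finset.range n,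
        trunc N (2 * maxNorm N (fun i => d i ω) j) (d j ω)) (L + 1)} +
      (2 * (2 : ℝ≥0) ^ (2 * p / ρ - p) : ℝ≥0) *
        μ {ω | t < (2 : ℝ≥0) ^ (3 / ρ - 2) * R * N (∑ j ∈ Finset.range L, e j ω)} +
      (4 : ℝ≥0) * μ {ω | t < (2 : ℝ≥0) ^ (3 / ρ - 1) * R * N (∑ j ∈ Finset.range L, e j ω)} := by
  have hρ := hN.pos
  have hpr := h.isProb
  set D : ℕ → Ω → ℝ≥0 := fun j ω => 2 * maxNorm N (fun i => d i ω) j with hD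
  have hDm : ∀ j, Measurable[ℱ j] (D j) := fun j =>
    (h.measurable_maxNorm_left hN j).const_mul 2
  have hDmono : ∀ ω, Monotone fun j => D j ω := fun ω i j hij =>
    mul_le_mul_right (maxNorm_mono N _ hij) 2
  have htr : ∀ j, Measurable[(ℱ j).prod inferInstance] (fun z : Ω × X => trunc N (D j z.1) z.2) :=
    fun j => @QuasiNorm.measurable_trunc_prod X _ _ _ _ ρ N hN Ω (ℱ j) (D j) (hDm j)
  have h' := h.transform htr fun j ω x => hN.trunc_neg _ _
  have hpr' := h'.isProb
  have hκD : ∀ j ω, ∀ᵐ x ∂((κ j ω).map (trunc N (D j ω))), N x ≤ D j ω := fun j ω => by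
    have hm : MeasurableSet {x : X | N x ≤ D j ω} := hN.measurable measurableSet_Iic
    rw [ae_map_iff (hN.measurable_trunc _).aemeasurable hm]
    exact Eventually.of_forall fun x => hN.trunc_le _ _
  have hR0 : R ≠ 0 := (one_pos.trans_le hR).ne'
  have hβ0 : β ≠ 0 := (one_pos.trans_le hβ).ne'
  -- With this choice `s ≤ t / R`, while the bound `2 ^ (3 / ρ - 1) * s` for `T_p` equals `2 ^ (1 /
  -- ρ) * t / R`. The condition relating `lam`, `s` and `Λ` then follows from `hβR`.
  set s : ℝ≥0 := (2 : ℝ≥0) ^ (1 - 2 / ρ) * (R⁻¹ * t) with hs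
  have hgl := h'.goodLambda hN hp hDm hDmono (fun j ω => hN.trunc_le _ _) hκD L (A := A)
    (b := b) ?_ (lam := β⁻¹ * t) (Λ := t) (s := s) ?_ ?_
  · refine (le_of_eq_of_le ?_ hgl).trans ?_
    · congr 1
      ext ω
      simp [lt_maxNorm_iff, hD]
    · refine add_le_add (add_le_add ?_ ?_) ?_
      · refine mul_le_mul_right (measure_mono ?_) _
        rintro ω ⟨n, hn, hω⟩
        rw [← div_eq_inv_mul, div_lt_iff₀' (one_pos.trans_le hβ)] at hω
        refine hω.trans_le ?_
        gcongr
        exact le_maxNorm N (fun n => ∑ j ∈ Finset.range n,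
          trunc N (2 * maxNorm N (fun i => d i ω) j) (d j ω)) (Nat.lt_succ_iff.2 hn)
      · have h1 := h.measure_exists_sum_trunc_le hN hDm L s
        calc _ ≤ _ := mul_le_mul_right h1 _
          _ = _ := by
            rw [← mul_assoc, mul_comm (2 : ℝ≥0)]
            congr 2
            ext ω
            simp only [Set.mem_ofPred_eq]
            rw [hs, ← mul_assoc, ← mul_assoc, ← NNReal.rpow_add two_ne_zero]
            have : 1 - 1 / ρ + (1 - 2 / ρ) = -(3 / ρ - 2) := by field_simp; ring
            rw [this, NNReal.rpow_neg, ← mul_inv, ← div_eq_inv_mul, div_lt_iff₀' (by positivity)]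
      -- The bound `D L` is twice the largest jump, which passes to `e` and then to the sum, each
      -- time with a factor `2` in probability.
      · have h1 : {ω | s < D L ω} = {ω | ∃ j < L, s / 2 < N (d j ω)} := by
          ext ω
          change s < 2 * maxNorm N (fun i => d i ω) L ↔ _
          rw [← div_lt_iff₀' two_pos, lt_maxNorm_iff]
          rfl
        rw [h1]
        calc _ ≤ _ := h.measure_exists_left_le hN L (s / 2)
          _ ≤ 2 * (2 * _) := mul_le_mul_right (h.measure_exists_right_le hN L (s / 2)) 2
          _ = _ := by
            rw [← mul_assoc]
            congr 2
            · norm_num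
            ext ω
            simp only [Set.mem_ofPred_eq]
            have e1 : (2 : ℝ≥0) ^ (1 - 1 / ρ) * (s / 2) =
                ((2 : ℝ≥0) ^ (3 / ρ - 1))⁻¹ * R⁻¹ * t := by
              have : (2 : ℝ≥0)⁻¹ = 2 ^ (-1 : ℝ) := (NNReal.rpow_neg_one 2).symm
              rw [hs, div_eq_mul_inv _ (2 : ℝ≥0), this, ← NNReal.rpow_neg]
              calc _ = (2 : ℝ≥0) ^ (1 - 1 / ρ) * (2 : ℝ≥0) ^ (1 - 2 / ρ) * (2 : ℝ≥0) ^ (-1 : ℝ) *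
                    R⁻¹ * t := by ring
                _ = _ := by
                  rw [← NNReal.rpow_add two_ne_zero, ← NNReal.rpow_add two_ne_zero]
                  congr 3
                  field_simp
                  ring
            rw [e1, ← mul_inv, ← div_eq_inv_mul, div_lt_iff₀' (by positivity)]
  -- The kept sequence arises from `d` by two predictable odd transforms, truncation and selection
  -- by `V`, so `H` applies to its tangent kernel.
  · intro k hk V hVm hVe c hc B hB
    have hφ : ∀ j, Measurable[(ℱ j).prod inferInstance]
        (fun z : Ω × X => (V j).indicator (fun _ => z.2) z.1) := fun j =>
      @measurable_indicator_prod X _ _ _ _ Ω (ℱ j) (V j) (hVm j)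
    have h'' := h'.transform (φ := fun j ω x => (V j).indicator (fun _ => x) ω) hφ
      fun j ω x => by
        by_cases hω : ω ∈ V j <;> simp [hω]
    have hle : ∀ j ω, N ((V j).indicator (fun _ => trunc N (D j ω) (d j ω)) ω) ≤ N (d j ω) :=
      fun j ω => by
        by_cases hω : ω ∈ V j
        · simpa [hω] using hN.trunc_le_self _ _
        · simp [hω, hN.zero]
    have heq : ∀ ω, ∑ j ∈ Finset.range L, (V j).indicator (fun ω => trunc N (D j ω) (d j ω)) ω =
        ∑ j ∈ Finset.range L, (V j).indicator (fun _ => trunc N (D j ω) (d j ω)) ω := fun ω => rfl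
    simp only [heq]
    refine H _ _ _ h'' ?_ ?_ k hk ?_ ?_ c ?_ B hB
    · obtain ⟨M, hM⟩ := hbdd
      exact ⟨M, fun j => (hM j).mono fun ω hω => (hle j ω).trans hω⟩
    · intro j hj
      filter_upwards [hL j hj] with ω hω
      by_cases hωV : ω ∈ V j <;> simp [hωV, hω, trunc]
    · intro j hj
      funext ω
      simp [hVe j hj]
    · intro j hj
      funext ω
      simp [hVe j hj]
    · intro ω
      have hφω : ∀ j, Measurable (fun x : X => (V j).indicator (fun _ => x) ω) := fun j =>
        measurable_of_prod (φ := fun ω x => (V j).indicator (fun _ => x) ω) (hφ j) ω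
      rw [← Measure.infinitePi_map_pi (μ := fun j => (κ j ω).map (trunc N (D j ω)))
        (f := fun j x => (V j).indicator (fun _ => x) ω) hφω, lintegral_map]
      · exact hc ω
      · exact ((hN.measurable_sum _).pow_const p).coe_nnreal_ennreal
      · exact measurable_pi_iff.2 fun j => (hφω j).comp (measurable_pi_apply j)
  · rw [← div_eq_inv_mul]
    exact div_le_self zero_le hβ
  · have e1 : (2 : ℝ≥0) ^ (3 / ρ - 1) * s = (2 : ℝ≥0) ^ (1 / ρ) * (R⁻¹ * t) := by
      rw [hs, ← mul_assoc, ← NNReal.rpow_add two_ne_zero]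
      congr 2
      field_simp
      ring
    have e2 : s ≤ R⁻¹ * t := by
      rw [hs]
      refine mul_le_of_le_one_left zero_le ?_
      refine NNReal.rpow_le_one_of_one_le_of_nonpos one_le_two ?_
      rw [sub_nonpos, le_div_iff₀ hρ]
      linarith [hN.le_one]
    rw [e1]
    calc _ ≤ (β⁻¹ * t) ^ ρ + (R⁻¹ * t) ^ ρ + (A * ((2 : ℝ≥0) ^ (1 / ρ) * (R⁻¹ * t))) ^ ρ := by
          gcongr
      _ = (β⁻¹ ^ ρ + (1 + 2 * A ^ ρ) * R⁻¹ ^ ρ) * t ^ ρ := by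
          simp only [NNReal.mul_rpow]
          rw [← NNReal.rpow_mul, one_div, inv_mul_cancel₀ hρ.ne', NNReal.rpow_one]
          ring
      _ ≤ 1 * t ^ ρ := by gcongr
      _ = _ := one_mul _

end Core
end Decoupling

namespace Decoupling

section Moments

variable {Ω X : Type*} {mΩ : MeasurableSpace Ω} [AddCommGroup X] [MeasurableSpace X]
  [MeasurableAdd₂ X] [MeasurableNeg X] {μ : Measure Ω} [IsProbabilityMeasure μ]
  {ℱ : Filtration ℕ mΩ} {d e : ℕ → Ω → X} {κ : ℕ → Ω → Measure X} {ρ : ℝ} {N : X → ℝ≥0}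
  {Φ : ℝ≥0 → ℝ≥0}

lemma TangentKernel.lintegral_maxNorm_left_le (h : TangentKernel μ ℱ d e κ)
    (hN : QuasiNorm ρ N) (hmono : Monotone Φ) (hcont : Continuous Φ) (h0 : Φ 0 = 0) {q : ℝ}
    (hΦq : ∀ s t : ℝ≥0, 1 ≤ s → Φ (s * t) ≤ s ^ q * Φ t) (L : ℕ) :
    ∫⁻ ω, (Φ (maxNorm N (fun i => d i ω) L) : ℝ≥0∞) ∂μ ≤
      (4 * ((2 : ℝ≥0) ^ (1 / ρ - 1)) ^ q : ℝ≥0) *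
        ∫⁻ ω, (Φ (N (∑ j ∈ Finset.range L, e j ω)) : ℝ≥0∞) ∂μ := by
  have hρ := hN.pos
  have hk : (1 : ℝ≥0) ≤ 2 ^ (1 / ρ - 1) := by
    refine NNReal.one_le_rpow one_le_two ?_
    rw [sub_nonneg, le_div_iff₀ hρ, one_mul]
    exact hN.le_one
  have hGm : Measurable fun ω => N (∑ j ∈ Finset.range L, e j ω) :=
    hN.measurable.comp (Finset.measurable_sum _ fun j _ => h.measurable_right j)
  have h1 := lintegral_le_of_tail_le (μ := μ) hmono hcont h0 ({()} : Finset Unit) (fun _ => 4)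
    ((h.measurable_maxNorm_left hN L).mono (ℱ.le L) le_rfl)
    (W := fun _ ω => 2 ^ (1 / ρ - 1) * N (∑ j ∈ Finset.range L, e j ω))
    (fun _ => hGm.const_mul _) ?_
  · rw [Finset.sum_singleton] at h1
    refine h1.trans ?_
    rw [ENNReal.coe_mul, mul_assoc]
    exact mul_le_mul_right (lintegral_mul_le hΦq hk _) _
  · intro t
    rw [Finset.sum_singleton]
    simp only [lt_maxNorm_iff]
    calc _ ≤ _ := h.measure_exists_left_le hN L t
      _ ≤ 2 * (2 * _) := mul_le_mul_right (h.measure_exists_right_le hN L t) 2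
      _ = _ := by
        rw [← mul_assoc]
        congr 2
        · norm_num
        · ext ω
          simp only [Set.mem_ofPred_eq]
          have : 1 - 1 / ρ = -(1 / ρ - 1) := by ring
          rw [this, NNReal.rpow_neg, ← div_eq_inv_mul, div_lt_iff₀' (by positivity)]

lemma TangentKernel.lintegral_maxNorm_trunc_le (h : TangentKernel μ ℱ d e κ)
    (hN : QuasiNorm ρ N) (hmono : Monotone Φ) (hcont : Continuous Φ) (h0 : Φ 0 = 0) {q : ℝ}
    (hΦq : ∀ s t : ℝ≥0, 1 ≤ s → Φ (s * t) ≤ s ^ q * Φ t)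
    {p : ℝ} (hp : ρ ≤ p) {L : ℕ} {A b : ℝ≥0} (H : TailBound μ ℱ N p A b L)
    (hbdd : ∃ M : ℝ≥0, ∀ j, ∀ᵐ ω ∂μ, N (d j ω) ≤ M) (hL : ∀ j, L ≤ j → d j =ᵐ[μ] 0)
    {β R : ℝ≥0} (hβ : 1 ≤ β) (hR : 1 ≤ R) (hβR : (β⁻¹) ^ ρ + (1 + 2 * A ^ ρ) * R⁻¹ ^ ρ ≤ 1)
    (hb : b * β ^ q ≤ 2⁻¹) :
    ∫⁻ ω, (Φ (maxNorm N (fun n => ∑ j ∈ Finset.range n,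
        trunc N (2 * maxNorm N (fun i => d i ω) j) (d j ω)) (L + 1)) : ℝ≥0∞) ∂μ ≤
      (2 * (2 * (2 : ℝ≥0) ^ (2 * p / ρ - p) * ((2 : ℝ≥0) ^ (3 / ρ - 2)) ^ q +
        4 * ((2 : ℝ≥0) ^ (3 / ρ - 1)) ^ q) * R ^ q : ℝ≥0) *
        ∫⁻ ω, (Φ (N (∑ j ∈ Finset.range L, e j ω)) : ℝ≥0∞) ∂μ := by
  have hρ := hN.pos
  set U : Ω → ℝ≥0 := fun ω => maxNorm N (fun n => ∑ j ∈ Finset.range n,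
        trunc N (2 * maxNorm N (fun i => d i ω) j) (d j ω)) (L + 1) with hU
  set G : Ω → ℝ≥0 := fun ω => N (∑ j ∈ Finset.range L, e j ω) with hG
  have hGm : Measurable G :=
    hN.measurable.comp (Finset.measurable_sum _ fun j _ => h.measurable_right j)
  have hdm : ∀ j, Measurable (d j) := fun j => (h.measurable_left j).mono (ℱ.le _) le_rfl
  have hUm : Measurable U := by
    refine measurable_maxNorm hN.measurable fun n _ => Finset.measurable_sum _ fun j _ => ?_
    exact (hN.measurable_trunc_prod (measurable_id)).comp
      (((measurable_maxNorm hN.measurable fun i _ => hdm i).const_mul 2).prodMk (hdm j))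
  -- Finitely many bounded terms give a bounded maximal function; finiteness permits the absorption
  -- below.
  have hUtop : ∫⁻ ω, (Φ (U ω) : ℝ≥0∞) ∂μ ≠ ∞ := by
    obtain ⟨M, hM⟩ := hbdd
    have hle : ∀ᵐ ω ∂μ, U ω ≤ (∑ _j ∈ Finset.range L, M ^ ρ) ^ (1 / ρ) := by
      filter_upwards [ae_all_iff.2 hM] with ω hω
      refine Finset.sup_le fun n hn => ?_
      rw [one_div, NNReal.le_rpow_inv_iff hρ]
      refine (hN.sum_rpow_le _ _).trans ?_
      refine (Finset.sum_le_sum fun j _ => NNReal.rpow_le_rpow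
        ((hN.trunc_le_self _ _).trans (hω j)) hρ.le).trans ?_
      exact Finset.sum_le_sum_of_subset
        (Finset.range_subset_range.2 (Nat.lt_succ_iff.1 (Finset.mem_range.1 hn)))
    refine ne_top_of_le_ne_top (b := (Φ ((∑ _j ∈ Finset.range L, M ^ ρ) ^ (1 / ρ)) : ℝ≥0∞))
      ENNReal.coe_ne_top ?_
    calc _ ≤ ∫⁻ _, (Φ ((∑ _j ∈ Finset.range L, M ^ ρ) ^ (1 / ρ)) : ℝ≥0∞) ∂μ :=
          lintegral_mono_ae (hle.mono fun ω hω => ENNReal.coe_le_coe.2 (hmono hω))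
      _ = _ := by simp
  have h1ρ : 1 ≤ 1 / ρ := by
    rw [le_div_iff₀ hρ, one_mul]
    exact hN.le_one
  have hk1 : (1 : ℝ≥0) ≤ 2 ^ (3 / ρ - 2) := by
    refine NNReal.one_le_rpow one_le_two ?_
    rw [show 3 / ρ = 3 * (1 / ρ) by ring]
    linarith
  have hk2 : (1 : ℝ≥0) ≤ 2 ^ (3 / ρ - 1) := by
    refine NNReal.one_le_rpow one_le_two ?_
    rw [show 3 / ρ = 3 * (1 / ρ) by ring]
    linarith
  set γ : ℝ≥0 := (2 : ℝ≥0) ^ (2 * p / ρ - p) with hγ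
  set k1 : ℝ≥0 := (2 : ℝ≥0) ^ (3 / ρ - 2) with hk1'
  set k2 : ℝ≥0 := (2 : ℝ≥0) ^ (3 / ρ - 1) with hk2'
  have h1 := lintegral_le_of_tail_le (μ := μ) hmono hcont h0 (Finset.univ : Finset (Fin 3))
    ![b, 2 * γ, 4] hUm
    (W := ![fun ω => β * U ω, fun ω => k1 * R * G ω, fun ω => k2 * R * G ω])
    (fun i => by fin_cases i; exacts [hUm.const_mul _, hGm.const_mul _, hGm.const_mul _])
    (fun t => by
      rw [Fin.sum_univ_three]
      exact h.measure_trunc_tail_le hN hp H hbdd hL hβ hR hβR t)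
  rw [Fin.sum_univ_three] at h1
  simp only [Matrix.cons_val_zero, Matrix.cons_val_one, Matrix.cons_val] at h1
  have h2 := (add_le_add (add_le_add
    (mul_le_mul_right (lintegral_mul_le (μ := μ) hΦq hβ U) (b : ℝ≥0∞))
    (mul_le_mul_right (lintegral_mul_le (μ := μ) hΦq (one_le_mul hk1 hR) G)
      ((2 * γ : ℝ≥0) : ℝ≥0∞)))
    (mul_le_mul_right (lintegral_mul_le (μ := μ) hΦq (one_le_mul hk2 hR) G)
      ((4 : ℝ≥0) : ℝ≥0∞)))
  have h3 := h1.trans h2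
  set IU := ∫⁻ ω, (Φ (U ω) : ℝ≥0∞) ∂μ with hIU
  set IG := ∫⁻ ω, (Φ (G ω) : ℝ≥0∞) ∂μ with hIG
  by_cases hGtop : IG = ∞
  · rw [hGtop, ENNReal.mul_top]
    · exact le_top
    · have : 0 < R ^ q := NNReal.rpow_pos (one_pos.trans_le hR)
      exact_mod_cast (by positivity : 2 * (2 * γ * k1 ^ q + 4 * k2 ^ q) * R ^ q ≠ 0)
  lift IU to ℝ≥0 using hUtop with IU'
  lift IG to ℝ≥0 using hGtop with IG'
  rw [NNReal.mul_rpow, NNReal.mul_rpow] at h3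
  norm_cast at h3 ⊢
  -- This half of the left side is absorbed, which doubles the remaining constants.
  have h4 : b * (β ^ q * IU') ≤ 2⁻¹ * IU' := by
    rw [← mul_assoc]
    gcongr
  have h5 := h3.trans (add_le_add_left (add_le_add_left h4 _) _)
  rw [← NNReal.coe_le_coe] at h5 ⊢
  push_cast at h5 ⊢
  linarith

/-- The extrapolation inequality with unspecified parameters `β` and `R`. -/
theorem TangentKernel.lintegral_maxNorm_sum_le (h : TangentKernel μ ℱ d e κ)
    (hN : QuasiNorm ρ N) (hmono : Monotone Φ) (hcont : Continuous Φ) (h0 : Φ 0 = 0) {q : ℝ}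
    (hΦq : ∀ s t : ℝ≥0, 1 ≤ s → Φ (s * t) ≤ s ^ q * Φ t)
    {p : ℝ} (hp : ρ ≤ p) {L : ℕ} {A b : ℝ≥0} (H : TailBound μ ℱ N p A b L)
    (hbdd : ∃ M : ℝ≥0, ∀ j, ∀ᵐ ω ∂μ, N (d j ω) ≤ M) (hL : ∀ j, L ≤ j → d j =ᵐ[μ] 0)
    {β R : ℝ≥0} (hβ : 1 ≤ β) (hR : 1 ≤ R) (hβR : (β⁻¹) ^ ρ + (1 + 2 * A ^ ρ) * R⁻¹ ^ ρ ≤ 1)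
    (hb : b * β ^ q ≤ 2⁻¹) :
    ∫⁻ ω, (Φ (maxNorm N (fun n => ∑ j ∈ Finset.range n, d j ω) (L + 1)) : ℝ≥0∞) ∂μ ≤
      (((2 : ℝ≥0) ^ (1 / ρ)) ^ q *
        (2 * (2 * (2 : ℝ≥0) ^ (2 * p / ρ - p) * ((2 : ℝ≥0) ^ (3 / ρ - 2)) ^ q +
          4 * ((2 : ℝ≥0) ^ (3 / ρ - 1)) ^ q) * R ^ q) +
        ((2 : ℝ≥0) ^ (1 / ρ) * jumpConst ρ) ^ q * (4 * ((2 : ℝ≥0) ^ (1 / ρ - 1)) ^ q) : ℝ≥0) *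
        ∫⁻ ω, (Φ (N (∑ j ∈ Finset.range L, e j ω)) : ℝ≥0∞) ∂μ := by
  have hρ := hN.pos
  have hdm : ∀ j, Measurable (d j) := fun j => (h.measurable_left j).mono (ℱ.le _) le_rfl
  have hk : (1 : ℝ≥0) ≤ 2 ^ (1 / ρ) := NNReal.one_le_rpow one_le_two (by positivity)
  have hm1 : Measurable fun ω => maxNorm N (fun n => ∑ j ∈ Finset.range n, d j ω) (L + 1) :=
    measurable_maxNorm hN.measurable fun n _ => Finset.measurable_sum _ fun j _ => hdm j
  have hm2 : Measurable fun ω => maxNorm N (fun n => ∑ j ∈ Finset.range n,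
        trunc N (2 * maxNorm N (fun i => d i ω) j) (d j ω)) (L + 1) := by
    refine measurable_maxNorm hN.measurable fun n _ => Finset.measurable_sum _ fun j _ => ?_
    exact (hN.measurable_trunc_prod (measurable_id)).comp
      (((measurable_maxNorm hN.measurable fun i _ => hdm i).const_mul 2).prodMk (hdm j))
  have hm3 : Measurable fun ω => maxNorm N (fun i => d i ω) L :=
    measurable_maxNorm hN.measurable fun i _ => hdm i
  have h1 := lintegral_le_of_tail_le (μ := μ) hmono hcont h0 (Finset.univ : Finset (Fin 2))
    ![1, 1] hm1
    (W := ![fun ω => 2 ^ (1 / ρ) * maxNorm N (fun n => ∑ j ∈ Finset.range n,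
        trunc N (2 * maxNorm N (fun i => d i ω) j) (d j ω)) (L + 1),
      fun ω => 2 ^ (1 / ρ) * jumpConst ρ * maxNorm N (fun i => d i ω) L])
    (fun i => by fin_cases i; exacts [hm2.const_mul _, hm3.const_mul _])
    (fun t => by
      rw [Fin.sum_univ_two]
      simp only [Matrix.cons_val_zero, Matrix.cons_val_one, ENNReal.coe_one, one_mul]
      refine (measure_mono ?_).trans (measure_union_le _ _)
      intro ω hω
      obtain ⟨n, hn, hω⟩ := lt_maxNorm_iff.1 hω
      rcases hN.lt_or_lt_of_lt_sum (Nat.lt_succ_iff.1 hn) hω with h2 | h2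
      · refine Or.inl (h2.trans_le (mul_le_mul_right ?_ _))
        exact le_maxNorm N (fun n => ∑ j ∈ Finset.range n,
          trunc N (2 * maxNorm N (fun i => d i ω) j) (d j ω)) hn
      · exact Or.inr h2)
  rw [Fin.sum_univ_two] at h1
  simp only [Matrix.cons_val_zero, Matrix.cons_val_one, ENNReal.coe_one, one_mul] at h1
  refine h1.trans ?_
  rw [ENNReal.coe_add, add_mul]
  refine add_le_add ?_ ?_
  · rw [ENNReal.coe_mul, mul_assoc]
    refine (lintegral_mul_le hΦq hk _).trans (mul_le_mul_right ?_ _)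
    exact h.lintegral_maxNorm_trunc_le hN hmono hcont h0 hΦq hp H hbdd hL hβ hR hβR hb
  · rw [ENNReal.coe_mul (_ ^ q), mul_assoc]
    refine (lintegral_mul_le hΦq (one_le_mul hk (one_le_jumpConst hρ)) _).trans
      (mul_le_mul_right ?_ _)
    exact h.lintegral_maxNorm_left_le hN hmono hcont h0 hΦq L

end Moments
end Decoupling

namespace Decoupling

/-! ### Choice of parameters and computation of the constants -/

section Constants

/-- The restriction on `b` says that `x = 2 ^ (2 * p / ρ - p + 1) * b` is less than `1`. Take `β = x
^ (-(1 / q))`, so that `b * β ^ q` is `b / x`, and let `R` solve the third condition with equality.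
-/
lemma exists_parameters {ρ p q : ℝ} (hρ : 0 < ρ) (hρ1 : ρ ≤ 1) (hp : ρ ≤ p) (hq : 0 < q)
    {A b : ℝ≥0} (hb : 0 < b) (hb1 : (b : ℝ) < (2 : ℝ) ^ (-(2 * p / ρ) + p - 1)) :
    ∃ β R : ℝ≥0, 1 ≤ β ∧ 1 ≤ R ∧ (β⁻¹) ^ ρ + (1 + 2 * A ^ ρ) * R⁻¹ ^ ρ ≤ 1 ∧
      b * β ^ q ≤ 2⁻¹ ∧ (R : ℝ) = ratio ρ p q A b := by
  have hp0 : 0 < p := hρ.trans_le hp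
  have hb0 : (0 : ℝ) < b := hb
  set x : ℝ := (2 : ℝ) ^ (2 * p / ρ - p + 1) * b with hx
  have hx0 : 0 < x := by positivity
  have hx1 : x < 1 := by
    calc x < (2 : ℝ) ^ (2 * p / ρ - p + 1) * (2 : ℝ) ^ (-(2 * p / ρ) + p - 1) := by
          rw [hx]; gcongr
      _ = 1 := by
          rw [← Real.rpow_add two_pos]
          ring_nf
          exact Real.rpow_zero 2
  have hy0 : 0 < x ^ (ρ / q) := by positivity
  have hy1 : x ^ (ρ / q) < 1 := Real.rpow_lt_one hx0.le hx1 (by positivity)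
  have hθ : 0 < 1 - x ^ (ρ / q) := by linarith
  have hA0 : (0 : ℝ) ≤ (A : ℝ) ^ ρ := by positivity
  have hR0 : 0 ≤ ratio ρ p q A b := by
    unfold ratio
    positivity
  have hRρ : ratio ρ p q A b ^ ρ = (2 * (A : ℝ) ^ ρ + 1) * (1 - x ^ (ρ / q))⁻¹ := by
    unfold ratio
    rw [Real.mul_rpow (by positivity) (by positivity), ← Real.rpow_mul (by positivity),
      ← Real.rpow_mul hθ.le, neg_mul, one_div, inv_mul_cancel₀ hρ.ne', Real.rpow_one,
      Real.rpow_neg_one]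
  have hβR : (x ^ (-(1 / q)))⁻¹ ^ ρ + (1 + 2 * (A : ℝ) ^ ρ) * (ratio ρ p q A b)⁻¹ ^ ρ ≤ 1 := by
    have e1 : (x ^ (-(1 / q)))⁻¹ ^ ρ = x ^ (ρ / q) := by
      rw [← Real.rpow_neg hx0.le, neg_neg, ← Real.rpow_mul hx0.le]
      ring_nf
    have e2 : (ratio ρ p q A b)⁻¹ ^ ρ = (2 * (A : ℝ) ^ ρ + 1)⁻¹ * (1 - x ^ (ρ / q)) := by
      rw [Real.inv_rpow hR0, hRρ, mul_inv, inv_inv]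
    rw [e1, e2, ← mul_assoc, add_comm (1 : ℝ) (2 * (A : ℝ) ^ ρ), mul_inv_cancel₀ (by positivity)]
    linarith
  obtain ⟨β, hβ⟩ : ∃ β : ℝ≥0, (β : ℝ) = x ^ (-(1 / q)) := ⟨⟨_, by positivity⟩, rfl⟩
  obtain ⟨R, hR⟩ : ∃ R : ℝ≥0, (R : ℝ) = ratio ρ p q A b := ⟨⟨_, hR0⟩, rfl⟩
  refine ⟨β, R, ?_, ?_, ?_, ?_, hR⟩
  · rw [← NNReal.coe_le_coe, hβ]
    exact Real.one_le_rpow_of_pos_of_le_one_of_nonpos hx0 hx1.le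
      (by rw [neg_nonpos]; positivity)
  · rw [← NNReal.coe_le_coe, hR, NNReal.coe_one]
    by_contra! hc
    have h1 : ratio ρ p q A b ^ ρ < 1 := Real.rpow_lt_one hR0 hc hρ
    rw [hRρ] at h1
    have h2 : 1 ≤ (1 - x ^ (ρ / q))⁻¹ := (one_le_inv₀ hθ).2 (by linarith)
    nlinarith
  · rw [← NNReal.coe_le_coe]
    push_cast
    rwa [hβ, hR]
  · rw [← NNReal.coe_le_coe]
    push_cast
    have e1 : (x ^ (-(1 / q))) ^ q = x⁻¹ := by
      rw [← Real.rpow_mul hx0.le, neg_mul, one_div, inv_mul_cancel₀ hq.ne', Real.rpow_neg_one]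
    rw [hβ, e1, hx, mul_inv, mul_comm, mul_assoc, inv_mul_cancel₀ hb0.ne', mul_one]
    refine inv_anti₀ two_pos ?_
    refine le_of_eq_of_le (Real.rpow_one 2).symm
      (Real.rpow_le_rpow_of_exponent_le one_le_two ?_)
    have : p ≤ 2 * p / ρ := by
      rw [le_div_iff₀ hρ]
      nlinarith
    linarith

/-- The contributions of the large jumps coincide on both sides. In the small-jump part the stated
constant has room, because `R` is at least `1` and occurs there with the larger exponent `q / ρ`. -/
lemma le_const {ρ p q : ℝ} (hρ : 0 < ρ) (hρ1 : ρ ≤ 1) (hp : ρ ≤ p) (hq : 0 < q)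
    {A b : ℝ} {R : ℝ≥0} (hR : 1 ≤ R) (hRr : (R : ℝ) = ratio ρ p q A b) :
    ((((2 : ℝ≥0) ^ (1 / ρ)) ^ q *
        (2 * (2 * (2 : ℝ≥0) ^ (2 * p / ρ - p) * ((2 : ℝ≥0) ^ (3 / ρ - 2)) ^ q +
          4 * ((2 : ℝ≥0) ^ (3 / ρ - 1)) ^ q) * R ^ q) +
        ((2 : ℝ≥0) ^ (1 / ρ) * jumpConst ρ) ^ q * (4 * ((2 : ℝ≥0) ^ (1 / ρ - 1)) ^ q) : ℝ≥0) : ℝ)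
      ≤ const ρ p q A b := by
  have hp0 : 0 < p := hρ.trans_le hp
  have h2 : (0 : ℝ) ≤ 2 := zero_le_two
  have h2ρ : (2 : ℝ≥0) ^ (-ρ) ≤ 1 :=
    NNReal.rpow_le_one_of_one_le_of_nonpos one_le_two (by linarith)
  have hθ : (0 : ℝ) ≤ 1 - (2 : ℝ) ^ (-ρ) := by
    have : ((2 : ℝ≥0) ^ (-ρ) : ℝ) ≤ 1 := by exact_mod_cast h2ρ
    simpa using this
  have hJ : ((jumpConst ρ : ℝ≥0) : ℝ) = (1 - (2 : ℝ) ^ (-ρ)) ^ (-(1 / ρ)) := by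
    unfold jumpConst
    rw [NNReal.coe_rpow, NNReal.coe_sub h2ρ]
    simp
  unfold const
  rw [← hRr]
  push_cast
  rw [Real.mul_rpow (by positivity) (by positivity), hJ, ← Real.rpow_mul hθ, ← Real.rpow_mul h2,
    ← Real.rpow_mul h2, ← Real.rpow_mul h2, ← Real.rpow_mul h2]
  have e0 : -(1 / ρ) * q = -(q / ρ) := by ring
  have e1 : 1 / ρ * q = q / ρ := by ring
  have e2 : (3 / ρ - 2) * q = q / ρ + q / ρ + q / ρ - q - q := by ring
  have e3 : (3 / ρ - 1) * q = q / ρ + q / ρ + q / ρ - q := by ring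
  have e4 : (1 / ρ - 1) * q = q / ρ - q := by ring
  have e5 : 2 * q / ρ - q + 2 = q / ρ + q / ρ - q + 2 := by ring
  have e6 : 2 * p / ρ - p + 2 * q / ρ - q + 1 = (2 * p / ρ - p) + (q / ρ + q / ρ - q) + 1 := by
    ring
  have e7 : 2 * q = q + q := by ring
  rw [e0, e1, e2, e3, e4, e5, e6, e7]
  simp only [Real.rpow_add two_pos, Real.rpow_sub two_pos, Real.rpow_one]
  have hγ1 : (1 : ℝ) ≤ 2 ^ (2 * p / ρ) / 2 ^ p := by
    rw [← Real.rpow_sub two_pos]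
    refine Real.one_le_rpow one_le_two ?_
    have : p ≤ 2 * p / ρ := by
      rw [le_div_iff₀ hρ]
      nlinarith
    linarith
  have ha1 : (1 : ℝ) ≤ 2 ^ (q / ρ) := Real.one_le_rpow one_le_two (by positivity)
  have hu1 : (1 : ℝ) ≤ 2 ^ q := Real.one_le_rpow one_le_two hq.le
  have hTS : (R : ℝ) ^ q ≤ (R : ℝ) ^ (q / ρ) := by
    refine Real.rpow_le_rpow_of_exponent_le (by exact_mod_cast hR) ?_
    rw [le_div_iff₀ hρ]
    nlinarith
  have hT0 : (0 : ℝ) ≤ (R : ℝ) ^ q := by positivity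
  have h22 : (2 : ℝ) ^ (2 : ℝ) = 4 := by norm_num
  rw [h22]
  generalize (2 : ℝ) ^ (2 * p / ρ) / 2 ^ p = γ at *
  generalize (2 : ℝ) ^ (q / ρ) = a at *
  generalize (2 : ℝ) ^ q = u at *
  generalize (R : ℝ) ^ q = T at *
  generalize (R : ℝ) ^ (q / ρ) = S at *
  generalize (1 - (2 : ℝ) ^ (-ρ)) ^ (-(q / ρ)) = Y at *
  have hu0 : 0 < u := by linarith
  have ha0 : 0 < a := by linarith
  have hS0 : 0 ≤ S := hT0.trans hTS
  -- Here `a` is `2 ^ (q / ρ)`, `u` is `2 ^ q`, and `T ≤ S` are the two powers of `R`. This is the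
  -- required inequality after division by the common factor `a ^ 4 / u ^ 2`.
  have key : 4 * γ * T + 8 * u * T ≤ 8 * γ * (u * u + a) * S := by
    have h3 : 4 * γ * T ≤ 8 * γ * a * S := by
      calc 4 * γ * T ≤ 8 * γ * 1 * S := by nlinarith [mul_nonneg (by linarith : 0 ≤ γ) hS0]
        _ ≤ 8 * γ * a * S := by gcongr
    have h4 : 8 * u * T ≤ 8 * γ * (u * u) * S := by
      calc 8 * u * T ≤ 8 * 1 * (u * 1) * S := by nlinarith
        _ ≤ 8 * γ * (u * u) * S := by gcongr
    linarith
  have hfin : a * (2 * (2 * γ * (a * a * a / u / u) + 4 * (a * a * a / u)) * T) =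
      a ^ 4 / u ^ 2 * (4 * γ * T + 8 * u * T) := by
    field_simp
    ring
  have hfin' : a * a / u * 4 * (γ * (a * a / u) * 2 * (u * u + a) * S + Y) =
      a ^ 4 / u ^ 2 * (8 * γ * (u * u + a) * S) + a * Y * (4 * (a / u)) := by
    field_simp
    ring
  rw [hfin, hfin']
  gcongr

lemma const_one_eq {p q A b : ℝ} (hA : 0 < A)
    (hb : 0 ≤ 1 - ((2 : ℝ) ^ (p + 1) * b) ^ (1 / q)) : const 1 p q A b = constOne p q A b := by
  have h2 : (0 : ℝ) < 2 := two_pos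
  unfold const constOne ratio
  have e4 : (1 - (2 : ℝ) ^ (-1 : ℝ)) ^ (-q) = 2 ^ q := by
    rw [Real.rpow_neg_one, show (1 : ℝ) - 2⁻¹ = 2⁻¹ by norm_num, Real.rpow_neg (by norm_num),
      Real.inv_rpow h2.le, inv_inv]
  simp only [Real.rpow_one, div_one, e4]
  rw [show 2 * p - p + 1 = p + 1 by ring,
    show 2 * p - p + 2 * q - q + 1 = p + q + 1 by ring, show 2 * q - q + 2 = q + 2 by ring,
    show 2 * q = q + q by ring, show q + q + 2 = q + (q + 2) by ring,
    Real.mul_rpow (by positivity) (by positivity), ← Real.rpow_mul hb, neg_one_mul,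
    Real.rpow_add h2 q q, Real.rpow_add h2 q (q + 2)]
  ring

end Constants
end Decoupling

namespace Decoupling

/-! ### Quasi-Banach spaces and reduction to a separable subgroup -/

namespace IsQuasiBanach

variable {X : Type*} [AddCommGroup X] [Module ℝ X] [MetricSpace X] {r : ℝ} {N : X → ℝ≥0}

lemma map_zero (hN : IsQuasiBanach r N) : N 0 = 0 := by
  simpa using hN.smul 0 0

lemma map_neg (hN : IsQuasiBanach r N) (x : X) : N (-x) = N x := by
  simpa using hN.smul (-1) x

lemma map_add_self (hN : IsQuasiBanach r N) (x : X) : N (x + x) = 2 * N x := by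
  simpa [two_smul] using hN.smul 2 x

/-- The metric `N (x - y) ^ r` is translation invariant and subadditive, so addition and negation
are Lipschitz. -/
lemma isTopologicalAddGroup (hN : IsQuasiBanach r N) : IsTopologicalAddGroup X := by
  have hadd : LipschitzWith 2 fun z : X × X => z.1 + z.2 := by
    refine LipschitzWith.of_dist_le_mul fun z w => ?_
    have h1 : dist (z.1 + z.2) (w.1 + w.2) ≤ dist z.1 w.1 + dist z.2 w.2 := by
      simp only [hN.dist_eq]
      have h2 := hN.add_rpow_le (z.1 - w.1) (z.2 - w.2)
      rw [← add_sub_add_comm] at h2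
      exact_mod_cast h2
    have h2 : dist z.1 w.1 ≤ dist z w := le_max_left _ _
    have h3 : dist z.2 w.2 ≤ dist z w := le_max_right _ _
    push_cast
    linarith
  have hneg : LipschitzWith 1 fun x : X => -x := by
    refine LipschitzWith.of_dist_le_mul fun x y => ?_
    rw [hN.dist_eq, hN.dist_eq, ← hN.map_neg, NNReal.coe_one, one_mul]
    simp [sub_eq_add_neg, add_comm]
  exact { continuous_add := hadd.continuous, continuous_neg := hneg.continuous }

lemma continuous (hN : IsQuasiBanach r N) (hr : 0 < r) : Continuous N := by
  have h : N = fun x => nndist x 0 ^ (1 / r) := by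
    ext x
    rw [NNReal.coe_rpow, coe_nndist, hN.dist_eq, sub_zero, ← Real.rpow_mul (by positivity),
      mul_one_div_cancel hr.ne', Real.rpow_one]
  rw [h]
  exact (NNReal.continuous_rpow_const (by positivity)).comp (continuous_id.nndist continuous_const)

lemma quasiNorm [MeasurableSpace X] [BorelSpace X] (hN : IsQuasiBanach r N) (hr : 0 < r)
    (hr1 : r ≤ 1) {ρ : ℝ} (hρ : 0 < ρ) (hρr : ρ ≤ r) : QuasiNorm ρ N where
  pos := hρ
  le_one := hρr.trans hr1
  zero := hN.map_zero
  neg := hN.map_neg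
  double := hN.map_add_self
  add_rpow_le x y := by
    have h1 : ∀ a : ℝ≥0, a ^ ρ = (a ^ r) ^ (ρ / r) := fun a => by
      rw [← NNReal.rpow_mul, mul_div_cancel₀ _ hr.ne']
    -- Subadditivity for the exponent `r` implies it for `ρ ≤ r`, since `t ↦ t ^ (ρ / r)` is
    -- subadditive.
    rw [h1, h1 (N x), h1 (N y)]
    exact (NNReal.rpow_le_rpow (hN.add_rpow_le x y) (by positivity)).trans
      (NNReal.rpow_add_le_add_rpow _ _ (by positivity) ((div_le_one hr).2 hρr))
  measurable := (hN.continuous hr).measurable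

end IsQuasiBanach

lemma QuasiNorm.restrict {X : Type*} [AddCommGroup X] [MeasurableSpace X] {ρ : ℝ} {N : X → ℝ≥0}
    (hN : QuasiNorm ρ N) (S : AddSubgroup X) : QuasiNorm ρ (fun x : S => N x) where
  pos := hN.pos
  le_one := hN.le_one
  zero := hN.zero
  neg x := hN.neg x
  double x := hN.double x
  add_rpow_le x y := hN.add_rpow_le x y
  measurable := hN.measurable.comp measurable_subtype_coe

/-- A separable set lies in a closed separable subgroup. -/
lemma exists_isClosed_isSeparable_addSubgroup {X : Type*} [AddCommGroup X] [MetricSpace X]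
    [IsTopologicalAddGroup X] {D : Set X} (hD : TopologicalSpace.IsSeparable D) :
    ∃ S : AddSubgroup X, IsClosed (S : Set X) ∧ TopologicalSpace.IsSeparable (S : Set X) ∧
      D ⊆ S := by
  have h := (hD.span (R := ℤ)).closure
  refine ⟨(Submodule.span ℤ D).toAddSubgroup.topologicalClosure, isClosed_closure, h, ?_⟩
  exact Submodule.subset_span.trans subset_closure

section Restriction

variable {Ω X : Type*} {mΩ : MeasurableSpace Ω} [AddCommGroup X] [MetricSpace X]
  [MeasurableSpace X] [BorelSpace X] {μ : Measure Ω} [IsProbabilityMeasure μ]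
  {ℱ : Filtration ℕ mΩ}

lemma condExp_preimage_congr {Y : Type*} {m : MeasurableSpace Ω} {ξ η : Ω → Y} (h : ξ =ᵐ[μ] η)
    (B : Set Y) : μ⟦ξ ⁻¹' B|m⟧ =ᵐ[μ] μ⟦η ⁻¹' B|m⟧ := by
  refine condExp_congr_ae ?_
  filter_upwards [h] with ω hω
  exact Set.indicator_eq_indicator (by simp only [Set.mem_preimage, hω]) rfl

/-- Tangent variables have the same law, as integrating the two conditional probabilities shows;
here this is used for the complement of `B`. -/
lemma IsDecoupledTangent.ae_mem {d e : ℕ → Ω → X} (h : IsDecoupledTangent μ ℱ d e) {n : ℕ}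
    (hn : 1 ≤ n) {B : Set X} (hB : MeasurableSet B) (hd : ∀ᵐ ω ∂μ, d n ω ∈ B) :
    ∀ᵐ ω ∂μ, e n ω ∈ B := by
  have h1 := h.tangent n hn _ hB.compl
  have h2 : μ⟦d n ⁻¹' Bᶜ|ℱ (n - 1)⟧ =ᵐ[μ] 0 := by
    refine (condExp_congr_ae (g := 0) ?_).trans (by rw [condExp_zero])
    filter_upwards [hd] with ω hω
    simp [hω]
  have hm : MeasurableSet (e n ⁻¹' Bᶜ) := (h.stronglyMeasurable n hn).measurable hB.compl
  have h3 := integral_condExp (μ := μ) (iSup_filtration_le ℱ)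
    (f := (e n ⁻¹' Bᶜ).indicator fun _ => (1 : ℝ))
  rw [integral_congr_ae (h1.symm.trans h2), integral_indicator hm] at h3
  simp only [Pi.zero_apply, integral_zero, integral_const, smul_eq_mul, mul_one,
    measureReal_restrict_apply_univ] at h3
  have h4 : μ (e n ⁻¹' Bᶜ) = 0 := by
    simpa [Measure.real, ENNReal.toReal_eq_zero_iff] using h3.symm
  exact h4

lemma IsDecoupledTangent.subtype_val {S : AddSubgroup X} {d e : ℕ → Ω → S}
    (h : IsDecoupledTangent μ ℱ d e) :
    IsDecoupledTangent μ ℱ (fun n ω => (d n ω : X)) (fun n ω => (e n ω : X)) where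
  stronglyMeasurable n hn :=
    continuous_subtype_val.comp_stronglyMeasurable (h.stronglyMeasurable n hn)
  tangent n hn B hB := by
    have hpre : ∀ ξ : Ω → S, (fun ω => (ξ ω : X)) ⁻¹' B = ξ ⁻¹' (Subtype.val ⁻¹' B) :=
      fun _ => rfl
    rw [hpre, hpre]
    exact h.tangent n hn _ (measurable_subtype_coe hB)
  condIndep n hn B hB := by
    have hpre : ∀ j, (fun ω => (e j ω : X)) ⁻¹' B j = e j ⁻¹' (Subtype.val ⁻¹' B j) :=
      fun _ => rfl
    simp only [hpre]
    exact h.condIndep n hn (fun j => Subtype.val ⁻¹' B j) fun j => measurable_subtype_coe (hB j)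

lemma exists_measurable_retraction {S : AddSubgroup X} (hS : MeasurableSet (S : Set X)) :
    ∃ π : X → S, Measurable π ∧ ∀ x ∈ S, (π x : X) = x := by
  classical
  refine ⟨fun x => if hx : x ∈ (S : Set X) then ⟨x, hx⟩ else 0,
    Measurable.dite (f := fun x : (S : Set X) => (⟨x, x.2⟩ : S)) (g := fun _ => (0 : S))
      measurable_id measurable_const hS, fun x hx => ?_⟩
  simp [hx]

/-- A decoupled tangent sequence of a sequence with values in a closed separable subgroup takes
its values there almost surely. -/
lemma IsDecoupledTangent.exists_restrict {S : AddSubgroup X} (hS : MeasurableSet (S : Set X))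
    [SecondCountableTopology S] {d : ℕ → Ω → S} {d' e' : ℕ → Ω → X}
    (hd : ∀ n, 1 ≤ n → (fun ω => (d n ω : X)) =ᵐ[μ] d' n) (h : IsDecoupledTangent μ ℱ d' e') :
    ∃ e : ℕ → Ω → S, (∀ n, 1 ≤ n → (fun ω => (e n ω : X)) =ᵐ[μ] e' n) ∧
      IsDecoupledTangent μ ℱ d e := by
  obtain ⟨π, hπm, hπ⟩ := exists_measurable_retraction hS
  have he : ∀ n, 1 ≤ n → (fun ω => (π (e' n ω) : X)) =ᵐ[μ] e' n := fun n hn => by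
    have h1 := h.ae_mem hn hS ((hd n hn).mono fun ω hω => hω ▸ (d n ω).2)
    filter_upwards [h1] with ω hω using hπ _ hω
  have himage : ∀ (ξ : Ω → S) (B : Set S),
      (fun ω => (ξ ω : X)) ⁻¹' (Subtype.val '' B) = ξ ⁻¹' B := fun ξ B => by
    ext ω
    simp
  have hemb : ∀ B : Set S, MeasurableSet B → MeasurableSet (Subtype.val '' B : Set X) :=
    fun B hB => (MeasurableEmbedding.subtype_coe hS).measurableSet_image.2 hB
  refine ⟨fun n ω => π (e' n ω), he, ⟨fun n hn => ?_, fun n hn B hB => ?_, fun n hn B hB => ?_⟩⟩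
  · exact (hπm.comp (h.stronglyMeasurable n hn).measurable).stronglyMeasurable
  · rw [← himage, ← himage]
    exact (condExp_preimage_congr (hd n hn) _).trans
      ((h.tangent n hn _ (hemb B hB)).trans (condExp_preimage_congr (he n hn) _).symm)
  · have h1 := h.condIndep n hn (fun j => Subtype.val '' B j) fun j => hemb _ (hB j)
    have h2 : ∀ᵐ ω ∂μ, ∀ j, 1 ≤ j → (π (e' j ω) : X) = e' j ω :=
      ae_all_iff.2 fun j => Filter.eventually_imp_distrib_left.2 (he j)
    have h3 : μ⟦⋂ j ∈ Finset.Icc 1 n, (fun ω => π (e' j ω)) ⁻¹' B j|⨆ i, ℱ i⟧ =ᵐ[μ]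
        μ⟦⋂ j ∈ Finset.Icc 1 n, e' j ⁻¹' (Subtype.val '' B j)|⨆ i, ℱ i⟧ := by
      refine condExp_congr_ae ?_
      filter_upwards [h2] with ω hω
      refine Set.indicator_eq_indicator ?_ rfl
      simp only [← himage, Set.mem_iInter, Set.mem_preimage, Finset.mem_Icc]
      exact forall₂_congr fun j hj => by rw [hω j hj.1]
    have h4 : ∀ᵐ ω ∂μ, ∀ j, 1 ≤ j → (μ⟦(fun ω => π (e' j ω)) ⁻¹' B j|⨆ i, ℱ i⟧) ω =
        (μ⟦e' j ⁻¹' (Subtype.val '' B j)|⨆ i, ℱ i⟧) ω :=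
      ae_all_iff.2 fun j => Filter.eventually_imp_distrib_left.2 fun hj => by
        rw [← himage]
        exact condExp_preimage_congr (he j hj) _
    filter_upwards [h1, h3, h4] with ω h1 h3 h4
    rw [h3, h1, Finset.prod_apply, Finset.prod_apply]
    exact Finset.prod_congr rfl fun j hj => (h4 j (Finset.mem_Icc.1 hj).1).symm

end Restriction

end Decoupling

namespace Decoupling

/-! ### Translation of the hypothesis into `TailBound` -/

section Stopping

variable {Ω X : Type*} [AddCommGroup X]

lemma stopped_eq_of_le {f : ℕ → Ω → X} (h0 : f 0 = 0) {k n : ℕ} (hkn : k ≤ n) :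
    stopped k f n = f k := by
  have h1 : (Finset.Icc 1 n).filter (· ≤ k) = Finset.Icc 1 k := by
    ext j
    simp only [Finset.mem_filter, Finset.mem_Icc]
    lia
  rw [stopped, ← Finset.sum_filter, h1, ← sum_range_diff h0 k]
  exact (Finset.sum_Ico_add' (diff f) 0 k 1).symm.trans (by rw [Finset.range_eq_Ico])

lemma diff_stopped (f : ℕ → Ω → X) (k j : ℕ) :
    diff (stopped k f) (j + 1) = if j + 1 ≤ k then diff f (j + 1) else 0 := by
  rw [diff, Nat.add_sub_cancel, stopped, stopped, Finset.sum_Icc_succ_top (by lia),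
    add_sub_cancel_left]

lemma diff_startedStopped (f : ℕ → Ω → X) (k l j : ℕ) :
    diff (startedStopped k l f) (j + 1) =
      diff (stopped l f) (j + 1) - diff (stopped k f) (j + 1) := by
  simp only [diff, startedStopped]
  abel

lemma limNorm_startedStopped (N : X → ℝ≥0) {f : ℕ → Ω → X} (h0 : f 0 = 0) {k l : ℕ} (hkl : k ≤ l)
    (ω : Ω) : limNorm N (startedStopped k l f) ω = N (f l ω - f k ω) := by
  refine (tendsto_const_nhds.congr' ?_).limUnder_eq
  filter_upwards [eventually_ge_atTop l] with n hn
  rw [startedStopped, stopped_eq_of_le h0 hn, stopped_eq_of_le h0 (hkl.trans hn)]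
  rfl

end Stopping

section CondExp

variable {Ω : Type*} {m mΩ : MeasurableSpace Ω} {μ : Measure Ω} [IsProbabilityMeasure μ]

/-- The bound for the whole space already gives integrability, so the conditional expectation does
not take its default value. -/
lemma condExp_le_of_setLIntegral_le (hm : m ≤ mΩ) {Y : Ω → ℝ≥0} (hY : AEMeasurable Y μ) {c : ℝ≥0}
    (h : ∀ G, MeasurableSet[m] G → ∫⁻ ω in G, Y ω ∂μ ≤ c * μ G) :
    ∀ᵐ ω ∂μ, 0 ≤ (μ[fun ω => (Y ω : ℝ)|m]) ω ∧ (μ[fun ω => (Y ω : ℝ)|m]) ω ≤ c := by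
  have hint : Integrable (fun ω => (Y ω : ℝ)) μ := by
    refine ⟨hY.coe_nnreal_real.aestronglyMeasurable, ?_⟩
    rw [hasFiniteIntegral_iff_enorm]
    have h1 := h Set.univ MeasurableSet.univ
    rw [setLIntegral_univ, measure_univ, mul_one] at h1
    refine lt_of_le_of_lt (le_of_eq ?_) (h1.trans_lt ENNReal.coe_lt_top)
    exact lintegral_congr fun ω => by simp [enorm]
  have hnonneg : 0 ≤ᵐ[μ] μ[fun ω => (Y ω : ℝ)|m] :=
    condExp_nonneg (Eventually.of_forall fun ω => (Y ω).2)
  have hle : μ[fun ω => (Y ω : ℝ)|m] ≤ᵐ[μ] fun _ => (c : ℝ) := by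
    refine ae_le_of_ae_le_trim (hm := hm) ?_
    refine ae_le_of_forall_setIntegral_le (integrable_condExp.trim hm stronglyMeasurable_condExp)
      (integrable_const _) fun G hG _ => ?_
    rw [← setIntegral_trim hm stronglyMeasurable_condExp hG, setIntegral_condExp hm hint hG,
      ← setIntegral_trim hm stronglyMeasurable_const hG, setIntegral_const]
    have h1 := h G hG
    rw [lintegral_coe_eq_integral _ hint.integrableOn] at h1
    have h2 := ENNReal.toReal_mono (ENNReal.mul_ne_top ENNReal.coe_ne_top (measure_ne_top _ _)) h1
    rw [ENNReal.toReal_ofReal (integral_nonneg fun ω => NNReal.coe_nonneg _), ENNReal.toReal_mul] at h2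
    simpa [Measure.real, mul_comm] using h2
  filter_upwards [hnonneg, hle] with ω h1 h2 using ⟨h1, h2⟩

end CondExp

section Transfer

variable {Ω X : Type*} {mΩ : MeasurableSpace Ω} [AddCommGroup X] [MetricSpace X]
  [MeasurableSpace X] [BorelSpace X] [IsTopologicalAddGroup X] {μ : Measure Ω}
  [IsProbabilityMeasure μ] {ℱ : Filtration ℕ mΩ} {S : AddSubgroup X} [SecondCountableTopology S]
  {d e : ℕ → Ω → S} {κ : ℕ → Ω → Measure S} {ρ p : ℝ} {N : X → ℝ≥0} {L : ℕ}

lemma IsDecoupledTangent.ae_eq_zero {d e : ℕ → Ω → X} (h : IsDecoupledTangent μ ℱ d e) {n : ℕ}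
    (hn : 1 ≤ n) (hd : d n =ᵐ[μ] 0) : e n =ᵐ[μ] 0 :=
  h.ae_mem hn (measurableSet_singleton (0 : X)) hd

lemma TangentKernel.setLIntegral_right_le (h : TangentKernel μ ℱ d e κ) (hN : QuasiNorm ρ N)
    {c : ℝ≥0}
    (hc : ∀ ω, ∫⁻ x, (N (∑ j ∈ Finset.range L, x j : S) ^ p : ℝ≥0)
      ∂(Measure.infinitePi fun j => κ j ω) ≤ c) {G : Set Ω} (hG : MeasurableSet[⨆ i, ℱ i] G) :
    ∫⁻ ω in G, (N (∑ j ∈ Finset.range L, e j ω : S) ^ p : ℝ≥0) ∂μ ≤ c * μ G := by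
  have hGm := iSup_filtration_le ℱ G hG
  have hNm : Measurable fun x : ℕ → S =>
      ((N (∑ j ∈ Finset.range L, x j : S) ^ p : ℝ≥0) : ℝ≥0∞) := by
    refine (((hN.restrict S).measurable.comp ?_).pow_const p).coe_nnreal_ennreal
    exact Finset.measurable_sum _ fun j _ => measurable_pi_apply j
  have hF : Measurable[(⨆ i, ℱ i).prod inferInstance] fun z : Ω × (ℕ → S) =>
      G.indicator (fun _ => (1 : ℝ≥0∞)) z.1 * (N (∑ j ∈ Finset.range L, z.2 j : S) ^ p : ℝ≥0) := by
    refine Measurable.mul ?_ ?_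
    · have hGi : Measurable[⨆ i, ℱ i] (G.indicator fun _ => (1 : ℝ≥0∞)) :=
        measurable_const.indicator hG
      exact hGi.comp (@measurable_fst _ _ (⨆ i, ℱ i) _)
    · exact hNm.comp (@measurable_snd _ _ (⨆ i, ℱ i) _)
  have h1 := h.lintegral_right hF
  have h2 : ∀ u : Ω → ℝ≥0∞, (fun ω => G.indicator (fun _ => (1 : ℝ≥0∞)) ω * u ω) = G.indicator u :=
    fun u => by
      ext ω
      by_cases hω : ω ∈ G <;> simp [hω]
  simp only [lintegral_const_mul _ hNm] at h1
  rw [h2, h2, lintegral_indicator hGm, lintegral_indicator hGm] at h1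
  rw [h1]
  exact (lintegral_mono hc).trans (by simp)

/-- The tangent sequence chosen in the definition of `T` may differ from `e` and have values outside
`S`. After modification on a null set it lies in `S` and has the same kernels, so the moment bound
for the product measures bounds its conditional moment. -/
lemma TangentKernel.eLpNorm_T_le (h : TangentKernel μ ℱ d e κ) (hS : MeasurableSet (S : Set X))
    (hN : QuasiNorm ρ N) (hp : 0 < p) (hL : ∀ j, L ≤ j → d j =ᵐ[μ] 0) {f : ℕ → Ω → X}
    (hfd : ∀ j, (fun ω => (d j ω : X)) =ᵐ[μ] diff f (j + 1)) {c : ℝ≥0}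
    (hc : ∀ ω, ∫⁻ x, (N (∑ j ∈ Finset.range L, x j : S) ^ p : ℝ≥0)
      ∂(Measure.infinitePi fun j => κ j ω) ≤ (c ^ p : ℝ≥0)) :
    eLpNorm (T μ ℱ N p f) ∞ μ ≤ c := by
  by_cases hex : ∃ e, IsDecoupledTangent μ ℱ (diff f) e
  swap
  -- Without a tangent sequence `T` has the default value `0`.
  · rw [T, dif_neg hex]
    simp
  have hT : T μ ℱ N p f = fun ω =>
      (μ[fun ω' => (N (∑' k : ℕ, hex.choose (k + 1) ω') : ℝ) ^ p | ⨆ i, ℱ i]) ω ^ (1 / p) := by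
    rw [T, dif_pos hex]
  have he' := hex.choose_spec
  rw [hT]
  generalize hex.choose = e' at he'
  obtain ⟨ê, hêe, hê⟩ := he'.exists_restrict hS
    (d := fun n => diff (fun n => ∑ j ∈ Finset.range n, d j) n) fun n hn => by
      obtain ⟨j, rfl⟩ : ∃ j, n = j + 1 := ⟨n - 1, by lia⟩
      rw [diff_sum_range]
      exact hfd j
  have hk := h.congr_right (diff_sum_range d) hê
  have hz : ∀ᵐ ω ∂μ, ∀ j, L ≤ j → e' (j + 1) ω = 0 :=
    ae_all_iff.2 fun j => Filter.eventually_imp_distrib_left.2 fun hj =>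
      he'.ae_eq_zero (by lia) ((hfd j).symm.trans ((hL j hj).mono fun ω hω => by simp [hω]))
  have heq : ∀ᵐ ω ∂μ, ∀ j, (ê (j + 1) ω : X) = e' (j + 1) ω :=
    ae_all_iff.2 fun j => hêe (j + 1) (by lia)
  have hsum : (fun ω => (N (∑' k : ℕ, e' (k + 1) ω) : ℝ) ^ p) =ᵐ[μ]
      fun ω => ((N (∑ j ∈ Finset.range L, ê (j + 1) ω : S) ^ p : ℝ≥0) : ℝ) := by
    filter_upwards [hz, heq] with ω h1 h2
    rw [tsum_eq_sum (s := Finset.range L) fun j hj => h1 j (by simpa using hj), NNReal.coe_rpow,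
      AddSubgroup.val_finsetSum]
    simp only [h2]
  have hm : Measurable fun ω => N (∑ j ∈ Finset.range L, ê (j + 1) ω : S) ^ p :=
    ((hN.restrict S).measurable.comp
      (Finset.measurable_sum _ fun j _ => hk.measurable_right j)).pow_const p
  have hle := condExp_le_of_setLIntegral_le (iSup_filtration_le ℱ) hm.aemeasurable
    fun G hG => hk.setLIntegral_right_le hN hc hG
  rw [eLpNorm_exponent_top]
  refine (eLpNormEssSup_le_of_ae_nnnorm_bound (C := c) ?_)
  filter_upwards [hle, condExp_congr_ae (m := ⨆ i, ℱ i) hsum] with ω h1 h2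
  rw [h2, ← NNReal.coe_le_coe, coe_nnnorm, Real.norm_of_nonneg (Real.rpow_nonneg h1.1 _)]
  calc _ ≤ ((c ^ p : ℝ≥0) : ℝ) ^ (1 / p) := Real.rpow_le_rpow h1.1 h1.2 (by positivity)
    _ = c := by
      rw [NNReal.coe_rpow, ← Real.rpow_mul (NNReal.coe_nonneg c), mul_one_div_cancel hp.ne', Real.rpow_one]

/-- The partial sums of a bounded sequence with a tangent kernel, of finite length. -/
lemma TangentKernel.mem_dInf (h : TangentKernel μ ℱ d e κ) (hN : QuasiNorm ρ N)
    (hbdd : ∃ M : ℝ≥0, ∀ j, ∀ᵐ ω ∂μ, N (d j ω) ≤ M) (hL : ∀ j, L ≤ j → d j =ᵐ[μ] 0) :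
    (fun n ω => ((∑ j ∈ Finset.range n, d j ω : S) : X)) ∈ DInf μ ℱ N := by
  have hdiff : ∀ j, diff (fun n ω => ((∑ j ∈ Finset.range n, d j ω : S) : X)) (j + 1) =
      fun ω => (d j ω : X) := fun j => by
    ext ω
    simp [diff, Finset.sum_range_succ]
  refine ⟨⟨?_, fun n => ?_, ?_, fun n hn B hB => ?_, L + 1, fun n hn => ?_⟩, ?_⟩
  · ext ω
    simp
  · have h1 : Measurable[ℱ n] fun ω => ∑ j ∈ Finset.range n, d j ω :=
      @Finset.measurable_sum _ _ _ _ _ _ (ℱ n) _ _ fun j hj =>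
        (h.measurable_left j).mono (ℱ.mono (by simpa using hj)) le_rfl
    have h2 : StronglyMeasurable[ℱ n] fun ω => ∑ j ∈ Finset.range n, d j ω :=
      h1.stronglyMeasurable
    exact continuous_subtype_val.comp_stronglyMeasurable h2
  · obtain ⟨M, hM⟩ := hbdd
    refine ⟨(L * M ^ ρ) ^ (1 / ρ), fun n => ?_⟩
    have h0 : ∀ᵐ ω ∂μ, ∀ j, L ≤ j → d j ω = 0 :=
      ae_all_iff.2 fun j => Filter.eventually_imp_distrib_left.2 fun hj => hL j hj
    filter_upwards [ae_all_iff.2 hM, h0] with ω h1 h2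
    have hρ := hN.pos
    rw [one_div, NNReal.le_rpow_inv_iff hρ]
    calc _ ≤ ∑ j ∈ Finset.range n, N (d j ω) ^ ρ := (hN.restrict S).sum_rpow_le _ _
      _ ≤ ∑ j ∈ Finset.range L, N (d j ω) ^ ρ := by
        refine Finset.sum_le_sum_of_ne_zero fun j _ hj => ?_
        by_contra hjL
        rw [h2 j (by simpa using hjL)] at hj
        simp [hN.zero, hρ.ne'] at hj
      _ ≤ ∑ j ∈ Finset.range L, M ^ ρ := Finset.sum_le_sum fun j _ =>
        NNReal.rpow_le_rpow (h1 j) hρ.le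
      _ = L * M ^ ρ := by simp
  · obtain ⟨j, rfl⟩ : ∃ j, n = j + 1 := ⟨n - 1, by lia⟩
    rw [hdiff, Nat.add_sub_cancel]
    exact h.condSymmetric j _ (measurable_subtype_coe hB)
  · obtain ⟨j, rfl⟩ : ∃ j, n = j + 1 := ⟨n - 1, by lia⟩
    rw [hdiff]
    exact (hL j (by lia)).mono fun ω hω => by simp [hω]
  · refine ⟨fun n ω => ((∑ j ∈ Finset.range n, e j ω : S) : X), by ext ω; simp, ?_⟩
    have h1 := h.isDecoupledSum.2.subtype_val
    convert h1 using 1 <;> ext n ω <;> simp [diff]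

/-- The partial sums `f` of `d` form a member of `D_∞` that vanishes up to time `k`. Starting at `k`
and stopping at `L` changes their differences at most on null sets, so the supremum in `bmoSup` can
be evaluated at `f`, `k`, `L` and `B`. -/
lemma tailBound_of_bmoSup_lt (hS : MeasurableSet (S : Set X)) (hN : QuasiNorm ρ N) (hp : 0 < p)
    {A b : ℝ≥0} (H : bmoSup μ ℱ N p A < ENNReal.ofReal b) (L : ℕ) :
    TailBound μ ℱ (fun x : S => N x) p A b L := by
  intro d e κ h hbdd hL k hkL hdk _ c hc B hB
  rcases eq_or_ne (μ B) 0 with hB0 | hB0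
  · exact (measure_mono_null Set.inter_subset_left hB0).trans_le zero_le
  set f : ℕ → Ω → X := fun n ω => ((∑ j ∈ Finset.range n, d j ω : S) : X) with hf
  have hf0 : f 0 = 0 := by
    ext ω
    simp [hf]
  have hfk : f k = 0 := by
    ext ω
    simp only [hf]
    rw [Finset.sum_eq_zero fun j hj => by rw [hdk j (by simpa using hj)]; rfl]
    rfl
  have hdiff : ∀ j, diff f (j + 1) = fun ω => (d j ω : X) := fun j => by
    ext ω
    simp [diff, hf, Finset.sum_range_succ]
  have hT := h.eLpNorm_T_le hS hN hp hL (f := startedStopped k L f) (c := c) (fun j => by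
    rw [diff_startedStopped, diff_stopped, diff_stopped, hdiff]
    by_cases hjk : j < k
    · have : d j = 0 := hdk j hjk
      rw [if_pos (by lia), if_pos (by lia), sub_self, this]
      rfl
    · rw [if_neg (by lia : ¬ j + 1 ≤ k), sub_zero]
      split_ifs with hjL
      · rfl
      · exact (hL j (by lia)).mono fun ω hω => by simp [hω]) hc
  have h1 : ProbabilityTheory.cond μ B
      {ω | ENNReal.ofReal A * eLpNorm (T μ ℱ N p (startedStopped k L f)) ∞ μ
        < (limNorm N (startedStopped k L f) ω : ℝ≥0∞)} ≤ b := by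
    refine le_trans ?_ (H.le.trans (by simp))
    exact le_iSup₂_of_le f (h.mem_dInf hN hbdd hL) <| le_iSup₂_of_le k L <|
      le_iSup₂_of_le hkL B <| le_iSup₂_of_le hB hB0 le_rfl
  rw [ProbabilityTheory.cond_apply (ℱ.le k _ hB)] at h1
  have h2 : μ (B ∩ {ω | ENNReal.ofReal A * eLpNorm (T μ ℱ N p (startedStopped k L f)) ∞ μ
        < (limNorm N (startedStopped k L f) ω : ℝ≥0∞)}) ≤ b * μ B := by
    rw [mul_comm, ← div_eq_mul_inv, ENNReal.div_le_iff hB0 (measure_ne_top _ _)] at h1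
    exact h1
  refine (measure_mono (Set.inter_subset_inter_right _ fun ω hω => ?_)).trans h2
  have h3 : A * c < N (∑ j ∈ Finset.range L, d j ω : S) := hω
  rw [Set.mem_ofPred_eq, limNorm_startedStopped N hf0 hkL, hfk, Pi.zero_apply, sub_zero]
  calc _ ≤ ((A * c : ℝ≥0) : ℝ≥0∞) := by
        rw [ENNReal.ofReal_coe_nnreal, ENNReal.coe_mul]
        gcongr
    _ < _ := ENNReal.coe_lt_coe.2 h3

end Transfer

end Decoupling

namespace Decoupling

/-! ### Eventually constant sequences and conclusion -/

section EventuallyConstant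

variable {Ω X : Type*} [AddCommGroup X] [MeasurableSpace X]

lemma eq_of_diff_eq_zero {f : ℕ → Ω → X} {L : ℕ} {ω : Ω}
    (h : ∀ j, L ≤ j → diff f (j + 1) ω = 0) {n : ℕ} (hn : L ≤ n) : f n ω = f L ω := by
  induction n, hn using Nat.le_induction with
  | base => rfl
  | succ n hn ih =>
    have h1 := h n hn
    simp only [diff, Nat.add_sub_cancel, Pi.sub_apply, sub_eq_zero] at h1
    rw [h1, ih]

lemma maximal_eq_maxNorm {N : X → ℝ≥0} {f : ℕ → Ω → X} {L : ℕ} {ω : Ω}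
    (h : ∀ n, L ≤ n → f n ω = f L ω) :
    maximal N f ω = maxNorm N (fun n => f n ω) (L + 1) := by
  have hle : ∀ n, N (f n ω) ≤ maxNorm N (fun n => f n ω) (L + 1) := fun n => by
    rcases le_total n L with hn | hn
    · exact le_maxNorm N (fun n => f n ω) (by lia)
    · rw [h n hn]
      exact le_maxNorm N (fun n => f n ω) (by lia)
  refine le_antisymm (ciSup_le hle) (Finset.sup_le fun n _ => ?_)
  exact le_ciSup (f := fun n => N (f n ω)) ⟨_, Set.forall_mem_range.2 hle⟩ n

lemma limNorm_eq {N : X → ℝ≥0} {f : ℕ → Ω → X} {L : ℕ} {ω : Ω} (h : ∀ n, L ≤ n → f n ω = f L ω) :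
    limNorm N f ω = N (f L ω) := by
  refine (tendsto_const_nhds.congr' ?_).limUnder_eq
  filter_upwards [eventually_ge_atTop L] with n hn
  rw [h n hn]

end EventuallyConstant

section Main

variable {Ω X : Type*} {mΩ : MeasurableSpace Ω} [AddCommGroup X] [MetricSpace X]
  [MeasurableSpace X] [BorelSpace X] [IsTopologicalAddGroup X] {μ : Measure Ω}
  [IsProbabilityMeasure μ] {ℱ : Filtration ℕ mΩ} {N : X → ℝ≥0} {ρ : ℝ}

/-- A sequence in `M_∞` is a sequence in `M_∞` of some closed separable subgroup. -/
lemma MInf.exists_restrict {f : ℕ → Ω → X} (hf : MInf μ ℱ N f) :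
    ∃ S : AddSubgroup X, IsClosed (S : Set X) ∧ TopologicalSpace.IsSeparable (S : Set X) ∧
      ∃ f₀ : ℕ → Ω → S, (∀ n ω, (f₀ n ω : X) = f n ω) ∧ MInf μ ℱ (fun x : S => N x) f₀ := by
  have hsep : TopologicalSpace.IsSeparable (⋃ n, Set.range (f n)) :=
    .iUnion fun n => (hf.adapted n).isSeparable_range
  obtain ⟨S, hSc, hSs, hS⟩ := exists_isClosed_isSeparable_addSubgroup hsep
  have hmem : ∀ n ω, f n ω ∈ S := fun n ω => hS (Set.mem_iUnion.2 ⟨n, ω, rfl⟩)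
  have hSsc : SecondCountableTopology S := hSs.secondCountableTopology
  refine ⟨S, hSc, hSs, fun n ω => ⟨f n ω, hmem n ω⟩, fun _ _ => rfl, ⟨?_, fun n => ?_, hf.bounded,
    fun n hn B hB => ?_, ?_⟩⟩
  · ext ω
    simp [hf.zero]
  · have h1 : Measurable[ℱ n] fun ω => (⟨f n ω, hmem n ω⟩ : S) :=
      (hf.adapted n).measurable.subtype_mk
    exact h1.stronglyMeasurable
  · have h1 := hf.condSymmetric n hn (Subtype.val '' B)
      ((MeasurableEmbedding.subtype_coe hSc.measurableSet).measurableSet_image.2 hB)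
    have h2 : ∀ (ξ : Ω → S) (ξ' : Ω → X), (∀ ω, (ξ ω : X) = ξ' ω) →
        ξ' ⁻¹' (Subtype.val '' B) = ξ ⁻¹' B := fun ξ ξ' h => by
      ext ω
      simp [← h]
    rw [h2 (diff (fun n ω => (⟨f n ω, hmem n ω⟩ : S)) n) (diff f n) fun _ => rfl,
      h2 (-diff (fun n ω => (⟨f n ω, hmem n ω⟩ : S)) n) (-diff f n) fun _ => rfl] at h1
    exact h1
  · obtain ⟨n₀, h0⟩ := hf.eventually_const
    exact ⟨n₀, fun n hn => (h0 n hn).mono fun ω hω => Subtype.ext hω⟩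

lemma MInf.diff_bounded {f : ℕ → Ω → X} (hf : MInf μ ℱ N f) (hN : QuasiNorm ρ N) :
    ∃ M : ℝ≥0, ∀ j, ∀ᵐ ω ∂μ, N (diff f (j + 1) ω) ≤ M := by
  obtain ⟨M, hM⟩ := hf.bounded
  have hρ := hN.pos
  refine ⟨(M ^ ρ + M ^ ρ) ^ (1 / ρ), fun j => ?_⟩
  filter_upwards [hM (j + 1), hM j] with ω h1 h2
  rw [one_div, NNReal.le_rpow_inv_iff hρ]
  exact (hN.sub_rpow_le _ _).trans
    (add_le_add (NNReal.rpow_le_rpow h1 hρ.le) (NNReal.rpow_le_rpow h2 hρ.le))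

/-- Both sides are computed in a closed separable subgroup `S`, which is Polish, so that regular
conditional laws exist. Beyond the index `n₀` all differences vanish almost surely, which turns
`maximal` and `limNorm` into the finite expressions of the moment inequality. -/
lemma lintegral_maximal_le [CompleteSpace X] (hN : QuasiNorm ρ N) {p q : ℝ} (hp : ρ ≤ p)
    (hq : 0 < q) {Φ : ℝ≥0 → ℝ≥0} (hmono : Monotone Φ) (hcont : Continuous Φ) (h0 : Φ 0 = 0)
    (hΦq : ∀ s t : ℝ≥0, 1 ≤ s → Φ (s * t) ≤ s ^ q * Φ t) {A b : ℝ≥0} (hb : 0 < b)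
    (hb1 : (b : ℝ) < (2 : ℝ) ^ (-(2 * p / ρ) + p - 1))
    (H : bmoSup μ ℱ N p A < ENNReal.ofReal b) {f g : ℕ → Ω → X} (hf : MInf μ ℱ N f)
    (hg : IsDecoupledSum μ ℱ f g) :
    ∫⁻ ω, (Φ (maximal N f ω) : ℝ≥0∞) ∂μ ≤
      ENNReal.ofReal (const ρ p q A b) * ∫⁻ ω, (Φ (limNorm N g ω) : ℝ≥0∞) ∂μ := by
  obtain ⟨S, hSc, hSs, f₀, hf₀, hf₀M⟩ := hf.exists_restrict
  have hSsc : SecondCountableTopology S := hSs.secondCountableTopology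
  have hScomp : CompleteSpace S := hSc.completeSpace_coe
  have hdiff : ∀ n ω, ((diff f₀ n ω : S) : X) = diff f n ω := fun n ω => by simp [diff, hf₀]
  obtain ⟨e, heg, he⟩ := hg.2.exists_restrict hSc.measurableSet (d := diff f₀)
    fun n _ => Eventually.of_forall fun ω => hdiff n ω
  have hg₀ : IsDecoupledSum μ ℱ f₀ fun n => ∑ j ∈ Finset.range n, e (j + 1) := by
    refine ⟨by simp, fun n hn => ?_, fun n hn => ?_, fun n hn B hB => ?_⟩
    · obtain ⟨j, rfl⟩ : ∃ j, n = j + 1 := ⟨n - 1, by lia⟩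
      rw [diff_sum_range]
      exact he.stronglyMeasurable _ hn
    · obtain ⟨j, rfl⟩ : ∃ j, n = j + 1 := ⟨n - 1, by lia⟩
      rw [diff_sum_range]
      exact he.tangent _ hn
    · have h1 := he.condIndep n hn B hB
      rw [iInter_Icc_eq_iInter_range, prod_Icc_eq_prod_range] at h1 ⊢
      simpa only [diff_sum_range (fun j => e (j + 1))] using h1
  obtain ⟨κ, hκ⟩ := exists_tangentKernel hf₀M hg₀
  simp only [diff_sum_range (fun j => e (j + 1))] at hκ
  obtain ⟨n₀, hn₀⟩ := hf₀M.eventually_const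
  have hL : ∀ j, n₀ ≤ j → diff f₀ (j + 1) =ᵐ[μ] 0 := fun j hj => hn₀ _ (by lia)
  obtain ⟨β, R, hβ, hR, hβR, hbβ, hRr⟩ :=
    exists_parameters (A := A) hN.pos hN.le_one hp hq hb hb1
  have hmain := hκ.lintegral_maxNorm_sum_le (hN.restrict S) hmono hcont h0 hΦq hp
    (tailBound_of_bmoSup_lt hSc.measurableSet hN (hN.pos.trans_le hp) H n₀)
    (hf₀M.diff_bounded (hN.restrict S)) hL hβ hR hβR hbβ
  have hleft : ∀ᵐ ω ∂μ, maximal N f ω =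
      maxNorm (fun x : S => N x) (fun n => ∑ j ∈ Finset.range n, diff f₀ (j + 1) ω) (n₀ + 1) := by
    filter_upwards [ae_all_iff.2 fun j => Filter.eventually_imp_distrib_left.2 (hL j)] with ω hω
    have h1 : ∀ n, ∑ j ∈ Finset.range n, diff f₀ (j + 1) ω = f₀ n ω := fun n => by
      rw [← sum_range_diff hf₀M.zero n, Finset.sum_apply]
    rw [maximal_eq_maxNorm (L := n₀) fun n hn => eq_of_diff_eq_zero
      (fun j hj => by rw [← hdiff, hω j hj]; rfl) hn]
    simp only [maxNorm, h1, hf₀]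
  have hright : ∀ᵐ ω ∂μ, limNorm N g ω = N (∑ j ∈ Finset.range n₀, e (j + 1) ω : S) := by
    have h1 : ∀ᵐ ω ∂μ, ∀ j, (e (j + 1) ω : X) = diff g (j + 1) ω :=
      ae_all_iff.2 fun j => heg (j + 1) (by lia)
    have h2 : ∀ᵐ ω ∂μ, ∀ j, n₀ ≤ j → diff g (j + 1) ω = 0 :=
      ae_all_iff.2 fun j => Filter.eventually_imp_distrib_left.2 fun hj =>
        hg.2.ae_eq_zero (by lia) ((hL j hj).mono fun ω hω => by rw [← hdiff, hω]; rfl)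
    filter_upwards [h1, h2] with ω h1 h2
    have h3 := limNorm_eq (N := N) (f := g) (L := n₀) fun n hn => eq_of_diff_eq_zero h2 hn
    rw [h3, ← sum_range_diff hg.1 n₀,
      Finset.sum_apply, AddSubgroup.val_finsetSum]
    simp only [h1]
  have hl := lintegral_congr_ae (EventuallyEq.fun_comp hleft fun t => (Φ t : ℝ≥0∞))
  have hr := lintegral_congr_ae (EventuallyEq.fun_comp hright fun t => (Φ t : ℝ≥0∞))
  simp only [Function.comp_def] at hl hr
  rw [hl, hr]
  refine hmain.trans ?_
  gcongr
  rw [← ENNReal.ofReal_coe_nnreal]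
  exact ENNReal.ofReal_le_ofReal (le_const hN.pos hN.le_one hp hq hR hRr)

end Main

end Decoupling

theorem proposition3p3 {Ω X : Type*}
    [AddCommGroup X] [Module ℝ X] [MetricSpace X] [MeasurableSpace X] [BorelSpace X]
    (r : ℝ) (hr₀ : 0 < r) (hr₁ : r ≤ 1)
    (N : X → ℝ≥0) (hN : Decoupling.IsQuasiBanach r N)
    [mΩ : MeasurableSpace Ω] (μ : Measure Ω) [IsProbabilityMeasure μ] [μ.IsComplete]
    (ℱ : Filtration ℕ mΩ) (hℱ : ℱ 0 = ⊥)
    (p : ℝ) (hp : 0 < p)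
    (Φ : ℝ≥0 → ℝ≥0) (hΦ_mono : Monotone Φ) (hΦ_cont : Continuous Φ) (hΦ_zero : Φ 0 = 0)
    (q : ℝ) (hq : 0 < q) (hΦq : ∀ s t : ℝ≥0, 1 ≤ s → Φ (s * t) ≤ s ^ q * Φ t)
    (A b : ℝ) (hA : 0 < A) (hb₀ : 0 < b)
    (hb₁ : b < (2 : ℝ) ^ (-(2 * p / min r p) + p - 1))
    (hbmo : Decoupling.bmoSup μ ℱ N p A < ENNReal.ofReal b) :
    (∀ f ∈ Decoupling.DInf μ ℱ N, ∀ g, Decoupling.IsDecoupledSum μ ℱ f g →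
      ∫⁻ ω, (Φ (Decoupling.maximal N f ω) : ℝ≥0∞) ∂μ
        ≤ ENNReal.ofReal (Decoupling.const (min r p) p q A b) *
          ∫⁻ ω, (Φ (Decoupling.limNorm N g ω) : ℝ≥0∞) ∂μ) ∧
    (r = 1 → 1 ≤ p →
      ∀ f ∈ Decoupling.DInf μ ℱ N, ∀ g, Decoupling.IsDecoupledSum μ ℱ f g →
        ∫⁻ ω, (Φ (Decoupling.maximal N f ω) : ℝ≥0∞) ∂μ
          ≤ ENNReal.ofReal (Decoupling.constOne p q A b) *
            ∫⁻ ω, (Φ (Decoupling.limNorm N g ω) : ℝ≥0∞) ∂μ) := by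
  have := hN.complete
  have := hN.isTopologicalAddGroup
  have hN' := hN.quasiNorm hr₀ hr₁ (lt_min hr₀ hp) (min_le_left r p)
  lift A to ℝ≥0 using hA.le
  lift b to ℝ≥0 using hb₀.le
  have hmain : ∀ f ∈ Decoupling.DInf μ ℱ N, ∀ g, Decoupling.IsDecoupledSum μ ℱ f g →
      ∫⁻ ω, (Φ (Decoupling.maximal N f ω) : ℝ≥0∞) ∂μ
        ≤ ENNReal.ofReal (Decoupling.const (min r p) p q A b) *
          ∫⁻ ω, (Φ (Decoupling.limNorm N g ω) : ℝ≥0∞) ∂μ := fun f hf g hg =>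
    Decoupling.lintegral_maximal_le hN' (min_le_right r p) hq hΦ_mono hΦ_cont hΦ_zero hΦq
      (by exact_mod_cast hb₀) hb₁ hbmo hf.1 hg
  refine ⟨hmain, fun hr hp1 => ?_⟩
  rw [hr, min_eq_left hp1] at hmain hb₁
  rwa [Decoupling.const_one_eq hA] at hmain
  -- For `ρ = 1` the restriction on `b` reads `b < 2 ^ (-p - 1)`; it makes the base of the power
  -- `-q` in `constOne` nonnegative, as `const_one_eq` requires.
  have h1 : (2 : ℝ) ^ (p + 1) * b ≤ 1 := by
    calc (2 : ℝ) ^ (p + 1) * b ≤ 2 ^ (p + 1) * 2 ^ (-(2 * p / 1) + p - 1) := by gcongr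
      _ = 1 := by
        rw [← Real.rpow_add two_pos]
        ring_nf
        exact Real.rpow_zero 2
  exact sub_nonneg.2 (Real.rpow_le_one (by positivity) h1 (by positivity))
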